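/- **Setting.** Let $(\mathcal A,\Delta,\epsilon,S)$ be a Hopf algebra over $\mathbf C$ with invertible antipode, $\mathcal I$ a finite set, and sum over repeated indices in $\mathcal I$. A representation is a matrix $v\in M_N(\mathcal A)$ with $\Delta v_{ij}=v_{ik}\otimes v_{kj}$, $\epsilon(v_{ij})=\delta_{ij}$; $(v\top w)_{ij,kl}=v_{ik}w_{jl}$; $\mathrm{Mor}(v,w)$ is the set of complex matrices $X$ with $Xv=wX$; $I$ also denotes the trivial representation $(1)$. Assume that every representation is completely reducible, that $\Lambda=(\Lambda_{rs})_{r,s\in\mathcal I}$ is an irreducible representation, and that $\mathrm{Mor}(v\top w,\Lambda\top v\top w)=\{0\}$ for all irreducible representations $v,w$. For $a\in\mathcal A$ and $\xi,\xi'\in\mathcal A'$ (linear functionals) put $a*\xi=(\xi\otimes\mathrm{id})\Delta a$, $\xi*a=(\mathrm{id}\otimes\xi)\Delta a$, $\xi*\xi'=(\xi\otimes\xi')\Delta$. Let $f_{st},\eta_s\in\mathcal A'$ ($s,t\in\mathcal I$) satisfy $\Lambda_{st}(f_{tr}*a)=(a*f_{st})\Lambda_{tr}$ for all $a\in\mathcal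 A$, and let $a\mapsto\begin{pmatrix}f(a)&\eta(a)\\0&\epsilon(a)\end{pmatrix}$ be a unital homomorphism. Put $\phi_s(a)=a*\eta_s-\Lambda_{st}(\eta_t*a)$. Let $\tilde{\mathcal B}$ be the unital algebra generated by $\mathcal A$ (with $1_{\tilde{\mathcal B}}=1_{\mathcal A}$) and elements $\tilde p_s$, $s\in\mathcal I$, with relations $\tilde p_sa=(a*f_{st})\tilde p_t+\phi_s(a)$. It is a bialgebra with the comultiplication extending that of $\mathcal A$ and $\Delta\tilde p_s=\Lambda_{st}\otimes\tilde p_t+\tilde p_s\otimes 1$. Let $\tilde{\mathcal B}^k$ be the left $\mathcal A$-submodule spanned by the products of at most $k$ elements $\tilde p_s$, and for an ideal $J$ put $J_2=J\cap\tilde{\mathcal B}^2$. Let $\dot\Gamma$ be the bicovariant bimodule with left $\mathcal A$-basis $\dot p_s$, $\dot p_sa=(a*f_{st})\dot p_t$, with left coaction $\dot p_s\mapsto\Lambda_{st}\otimes\dot p_t$ and right coaction $\dot p_s\mapsto\dot p_s\otimes 1$. Let $\rho$ be the left $\mathcal A$-linear map of $\dot\Gamma\otimes_{\mathcal A}\dot\Gamma$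 with $\rho(x\otimes\omega)=\omega\otimes x$ for right-invariant $x$ and left-invariant $\omega$; explicitly $\rho(\dot p_i\otimes\dot p_j)=R_{ij,sm}\,\dot p_s\otimes\dot p_m$ with $R_{ij,sm}=f_{im}(\Lambda_{js})$. Identify $\dot\Gamma\otimes_{\mathcal A}\dot\Gamma$ with $\tilde{\mathcal B}^2/\tilde{\mathcal B}^1$ by $\dot p_i\otimes\dot p_j\mapsto[\tilde p_i\tilde p_j]$. Assume $\rho^2=\mathrm{id}$ (equivalently $R^2=\mathbf 1\otimes\mathbf 1$, where $\mathbf 1$ is the unit matrix of size $|\mathcal I|$). Put $Z_{ij,m}=\eta_i(\Lambda_{jm})$, and $$A_3=\mathbf 1\otimes\mathbf 1\otimes\mathbf 1-R\otimes\mathbf 1-\mathbf 1\otimes R+(R\otimes\mathbf 1)(\mathbf 1\otimes R)+(\mathbf 1\otimes R)(R\otimes\mathbf 1)-(R\otimes\mathbf 1)(\mathbf 1\otimes R)(R\otimes\mathbf 1).$$ For complex numbers $T=(T_{ij})_{i,j\in\mathcal I}$ put $$\tau_{ij}=\eta_j*\eta_i-\eta_i(\Lambda_{js})\eta_s+T_{ij}\epsilon-(f_{jn}*f_{im})T_{mn},\qquad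 F_{ijk,m}=\tau_{ij}(\Lambda_{km}),$$ $$s_{kl}=(R-\mathbf 1\otimes\mathbf 1)_{kl,ij}\bigl(\tilde p_i\tilde p_j-\eta_i(\Lambda_{js})\tilde p_s+T_{ij}-\Lambda_{im}\Lambda_{jn}T_{mn}\bigr).$$ Call $T$ *admissible* if 1. $g_{\alpha\beta}(\tau_\beta*b)=b*\tau_\alpha$ for all $b\in\mathcal A$ and all $\alpha$ (sum over $\beta$), where $\tau_\alpha=a^\alpha_{ij}\tau_{ij}$, the rows $a^\alpha$ form a basis of $\{x:\ x(R+\mathbf 1\otimes\mathbf 1)=0\}$ and $g$ is the representation with $a(\Lambda\top\Lambda)=g\,a$ (the condition does not depend on the basis); 2. $A_3F=0$; 3. $A_3(Z\otimes\mathbf 1-\mathbf 1\otimes Z)T\in\mathrm{Mor}(I,\Lambda\top\Lambda\top\Lambda)$. **Theorem.** The following conditions on $J\subset\tilde{\mathcal B}$ are equivalent: (i) $J$ is a two-sided ideal with $\Delta J\subset J\otimes\tilde{\mathcal B}+\tilde{\mathcal B}\otimes J$, $\epsilon(J)=0$, $J\cap\tilde{\mathcal B}^1=\{0\}$ and $J_2/\tilde{\mathcal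 B}^1=\ker(\rho+\mathrm{id})$, where $J_2/\tilde{\mathcal B}^1$ denotes the image of $J_2$ in $\tilde{\mathcal B}^2/\tilde{\mathcal B}^1$; (ii) $J$ is the two-sided ideal generated by the $s_{kl}$, $k,l\in\mathcal I$, for some admissible $T$. If (i) or (ii) holds, then $J_2=\mathcal A\cdot\mathrm{span}\{s_{kl}:k,l\in\mathcal I\}$ (for every $T$ as in (ii)), and $\mathcal B=\tilde{\mathcal B}/J$, with $p_s$ the class of $\tilde p_s$, is a quotient bialgebra of $\tilde{\mathcal B}$ such that: $\mathcal B$ is generated as an algebra by $\mathcal A$ and the $p_s$; $\mathcal A$ is a sub-bialgebra of $\mathcal B$; $\begin{pmatrix}\Lambda&p\\0&1\end{pmatrix}$ is a representation; some $p_s\notin\mathcal A$; and $\Gamma\mathcal A\subset\Gamma$ for $\Gamma=\mathcal A\cdot\mathrm{span}\{p_s\}+\mathcal A$. -/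

import Mathlib

open scoped TensorProduct Matrix Kronecker

noncomputable section

namespace InhomQG

/-! ### Representations of a quantum group and intertwiners -/

section Reps

variable {C : Type*} [Ring C] [Bialgebra ℂ C]

/-- `v` is a representation: `Δ v_ij = ∑ k, v_ik ⊗ v_kj` and `ε (v_ij) = δ_ij`. -/
structure IsRep {n : Type*} [Fintype n] [DecidableEq n] (v : Matrix n n C) : Prop where
  comul : ∀ i j, Coalgebra.comul (R := ℂ) (v i j) = ∑ k, v i k ⊗ₜ[ℂ] v k j
  counit : ∀ i j, Coalgebra.counit (R := ℂ) (v i j) = if i = j then 1 else 0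

/-- A subspace `W` of the carrier space `ℂⁿ` is invariant for `v`: the coaction
`e_j ↦ ∑ i, e_i ⊗ v_ij` maps `W` into `W ⊗ C`.  This is tested on all slices by functionals. -/
def IsInvariant {n : Type*} [Fintype n] (v : Matrix n n C) (W : Submodule ℂ (n → ℂ)) : Prop :=
  ∀ φ : C →ₗ[ℂ] ℂ, ∀ x ∈ W, (v.map φ) *ᵥ x ∈ W

/-- An irreducible representation (in particular of nonzero dimension). -/
def IsIrreducible {n : Type*} [Fintype n] [DecidableEq n] (v : Matrix n n C) : Prop :=
  IsRep v ∧ Nonempty n ∧ ∀ W : Submodule ℂ (n → ℂ), IsInvariant v W → W = ⊥ ∨ W = ⊤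

/-- Complete reducibility: each invariant subspace has an invariant complement. -/
def IsCompletelyReducible {n : Type*} [Fintype n] (v : Matrix n n C) : Prop :=
  ∀ W : Submodule ℂ (n → ℂ), IsInvariant v W →
    ∃ W' : Submodule ℂ (n → ℂ), IsInvariant v W' ∧ IsCompl W W'

/-- A complex matrix regarded as a matrix over `C`. -/
abbrev scal (C : Type*) [Ring C] [Algebra ℂ C] {m n : Type*} (X : Matrix m n ℂ) : Matrix m n C :=
  X.map (algebraMap ℂ C)

/-- `Mor(v, w)`: the complex matrices `X` with `X v = w X`.  The tensor product `v ⊤ w` of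
representations, `(v ⊤ w)_{ij,kl} = v_ik w_jl`, is Mathlib's Kronecker product `v ⊗ₖ w`. -/
def Mor {m n : Type*} [Fintype m] [Fintype n] (v : Matrix m m C) (w : Matrix n n C) :
    Set (Matrix n m ℂ) :=
  {X | scal C X * v = w * scal C X}

/-- The trivial representation `I`. -/
def trivialRep (C : Type*) [Ring C] : Matrix Unit Unit C := 1

end Reps

/-! ### Convolutions -/

section Conv

variable {A : Type*} [Ring A] [Bialgebra ℂ A]

/-- `a * ρ = (ρ ⊗ id) Δ a`, as a linear map in `a`. -/
def convL (ρ : A →ₗ[ℂ] ℂ) : A →ₗ[ℂ] A :=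
  (TensorProduct.lid ℂ A).toLinearMap ∘ₗ TensorProduct.map ρ LinearMap.id ∘ₗ Coalgebra.comul

/-- `ρ * a = (id ⊗ ρ) Δ a`, as a linear map in `a`. -/
def convR (ρ : A →ₗ[ℂ] ℂ) : A →ₗ[ℂ] A :=
  (TensorProduct.rid ℂ A).toLinearMap ∘ₗ TensorProduct.map LinearMap.id ρ ∘ₗ Coalgebra.comul

/-- `ρ * ρ' = (ρ ⊗ ρ') Δ`. -/
def conv (ρ ρ' : A →ₗ[ℂ] ℂ) : A →ₗ[ℂ] ℂ :=
  (TensorProduct.lid ℂ ℂ).toLinearMap ∘ₗ TensorProduct.map ρ ρ' ∘ₗ Coalgebra.comul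

lemma map_convL_comul (ρ : A →ₗ[ℂ] ℂ) (a : A) :
    TensorProduct.map (convL ρ) LinearMap.id (Coalgebra.comul (R := ℂ) a) =
      Coalgebra.comul (R := ℂ) (convL ρ a) := by
  let F : A ⊗[ℂ] (A ⊗[ℂ] A) →ₗ[ℂ] A ⊗[ℂ] A :=
    (TensorProduct.lid ℂ (A ⊗[ℂ] A)).toLinearMap ∘ₗ TensorProduct.map ρ LinearMap.id
  have h1 : ∀ w : A ⊗[ℂ] A, TensorProduct.map (convL ρ) LinearMap.id w =
      F (TensorProduct.assoc ℂ A A A (Coalgebra.comul.rTensor A w)) := by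
    intro w
    induction w with
    | zero => simp
    | add x y hx hy => simp only [map_add, hx, hy]
    | tmul x y =>
      simp only [convL, TensorProduct.map_tmul, LinearMap.coe_comp, Function.comp_apply,
        LinearMap.rTensor_tmul, LinearMap.id_apply]
      generalize Coalgebra.comul (R := ℂ) x = z
      induction z with
      | zero => simp
      | add u v hu hv => simp only [map_add, TensorProduct.add_tmul, hu, hv]
      | tmul u v => simp [F, TensorProduct.smul_tmul']
  have h2 : ∀ w : A ⊗[ℂ] A, F (Coalgebra.comul.lTensor A w) =
      Coalgebra.comul (R := ℂ) (TensorProduct.lid ℂ A (TensorProduct.map ρ LinearMap.id w)) := by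
    intro w
    induction w with
    | zero => simp
    | add x y hx hy => simp only [map_add, hx, hy]
    | tmul x y => simp [F]
  rw [h1, Coalgebra.coassoc_apply, h2]
  rfl

lemma map_convR_comul (ρ : A →ₗ[ℂ] ℂ) (a : A) :
    TensorProduct.map LinearMap.id (convR ρ) (Coalgebra.comul (R := ℂ) a) =
      Coalgebra.comul (R := ℂ) (convR ρ a) := by
  let F : (A ⊗[ℂ] A) ⊗[ℂ] A →ₗ[ℂ] A ⊗[ℂ] A :=
    (TensorProduct.rid ℂ (A ⊗[ℂ] A)).toLinearMap ∘ₗ TensorProduct.map LinearMap.id ρ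
  have h1 : ∀ w : A ⊗[ℂ] A, TensorProduct.map LinearMap.id (convR ρ) w =
      F ((TensorProduct.assoc ℂ A A A).symm (Coalgebra.comul.lTensor A w)) := by
    intro w
    induction w with
    | zero => simp
    | add x y hx hy => simp only [map_add, hx, hy]
    | tmul x y =>
      simp only [convR, TensorProduct.map_tmul, LinearMap.coe_comp, Function.comp_apply,
        LinearMap.lTensor_tmul, LinearMap.id_apply]
      generalize Coalgebra.comul (R := ℂ) y = z
      induction z with
      | zero => simp
      | add u v hu hv => simp only [map_add, TensorProduct.tmul_add, hu, hv]
      | tmul u v => simp [F]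
  have h2 : ∀ w : A ⊗[ℂ] A, F (Coalgebra.comul.rTensor A w) =
      Coalgebra.comul (R := ℂ) (TensorProduct.rid ℂ A (TensorProduct.map LinearMap.id ρ w)) := by
    intro w
    induction w with
    | zero => simp
    | add x y hx hy => simp only [map_add, hx, hy]
    | tmul x y => simp [F]
  rw [h1, Coalgebra.coassoc_symm_apply, h2]
  rfl

lemma map_convL_eq_convR (ρ : A →ₗ[ℂ] ℂ) (a : A) :
    TensorProduct.map LinearMap.id (convL ρ) (Coalgebra.comul (R := ℂ) a) =
      TensorProduct.map (convR ρ) LinearMap.id (Coalgebra.comul (R := ℂ) a) := by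
  let F : A ⊗[ℂ] (A ⊗[ℂ] A) →ₗ[ℂ] A ⊗[ℂ] A := TensorProduct.map LinearMap.id
    ((TensorProduct.lid ℂ A).toLinearMap ∘ₗ TensorProduct.map ρ LinearMap.id)
  have h1 : ∀ w : A ⊗[ℂ] A, TensorProduct.map (convR ρ) LinearMap.id w =
      F (TensorProduct.assoc ℂ A A A (Coalgebra.comul.rTensor A w)) := by
    intro w
    induction w with
    | zero => simp
    | add x y hx hy => simp only [map_add, hx, hy]
    | tmul x y =>
      simp only [convR, TensorProduct.map_tmul, LinearMap.coe_comp, Function.comp_apply,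
        LinearMap.rTensor_tmul, LinearMap.id_apply]
      generalize Coalgebra.comul (R := ℂ) x = z
      induction z with
      | zero => simp
      | add u v hu hv => simp only [map_add, TensorProduct.add_tmul, hu, hv]
      | tmul u v => simp [F, TensorProduct.smul_tmul]
  have h2 : ∀ w : A ⊗[ℂ] A, F (Coalgebra.comul.lTensor A w) =
      TensorProduct.map LinearMap.id (convL ρ) w := by
    intro w
    induction w with
    | zero => simp
    | add x y hx hy => simp only [map_add, hx, hy]
    | tmul x y => simp [F, convL]
  rw [h1, Coalgebra.coassoc_apply, h2]

lemma counit_convL (ρ : A →ₗ[ℂ] ℂ) (a : A) :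
    Coalgebra.counit (R := ℂ) (convL ρ a) = ρ a := by
  have h : ∀ w : A ⊗[ℂ] A,
      Coalgebra.counit (R := ℂ) (TensorProduct.lid ℂ A (TensorProduct.map ρ LinearMap.id w)) =
        ρ (TensorProduct.rid ℂ A (Coalgebra.counit.lTensor A w)) := by
    intro w
    induction w with
    | zero => simp
    | add x y hx hy => simp only [map_add, hx, hy]
    | tmul x y => simp [mul_comm]
  have := h (Coalgebra.comul a)
  rw [Coalgebra.lTensor_counit_comul] at this
  simpa [convL] using this

lemma counit_convR (ρ : A →ₗ[ℂ] ℂ) (a : A) :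
    Coalgebra.counit (R := ℂ) (convR ρ a) = ρ a := by
  have h : ∀ w : A ⊗[ℂ] A,
      Coalgebra.counit (R := ℂ) (TensorProduct.rid ℂ A (TensorProduct.map LinearMap.id ρ w)) =
        ρ (TensorProduct.lid ℂ A (Coalgebra.counit.rTensor A w)) := by
    intro w
    induction w with
    | zero => simp
    | add x y hx hy => simp only [map_add, hx, hy]
    | tmul x y => simp [mul_comm]
  have := h (Coalgebra.comul a)
  rw [Coalgebra.rTensor_counit_comul] at this
  simpa [convR] using this

end Conv

/-- The data `Λ, f, η`: a representation `Λ` of `H`, and functionals `f_st`, `η_s` on `A`. -/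
structure InhomData (A I : Type*) [Ring A] [Bialgebra ℂ A] [Fintype I] [DecidableEq I] where
  /-- the distinguished representation `Λ` -/
  Λ : Matrix I I A
  /-- the functionals `f_st` -/
  f : I → I → A →ₗ[ℂ] ℂ
  /-- the functionals `η_s` -/
  η : I → A →ₗ[ℂ] ℂ
  isRep : IsRep Λ
  /-- `∑ t, Λ_st (f_tr * a) = ∑ t, (a * f_st) Λ_tr` -/
  exchange : ∀ s r a, ∑ t, Λ s t * convR (f t r) a = ∑ t, convL (f s t) a * Λ t r
  /-- `a ↦ (f(a), η(a); 0, ε(a))` is a unital homomorphism -/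
  block_mul : ∀ a b : A,
    Matrix.fromBlocks (Matrix.of fun s t => f s t (a * b)) (Matrix.of fun s (_ : Unit) => η s (a * b))
        0 (Matrix.of fun _ _ => Coalgebra.counit (R := ℂ) (a * b)) =
      Matrix.fromBlocks (Matrix.of fun s t => f s t a) (Matrix.of fun s (_ : Unit) => η s a)
        0 (Matrix.of fun (_ : Unit) _ => Coalgebra.counit (R := ℂ) a) *
      Matrix.fromBlocks (Matrix.of fun s t => f s t b) (Matrix.of fun s (_ : Unit) => η s b)
        0 (Matrix.of fun (_ : Unit) _ => Coalgebra.counit (R := ℂ) b)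
  block_one :
    Matrix.fromBlocks (Matrix.of fun s t => f s t 1) (Matrix.of fun s (_ : Unit) => η s 1)
      0 (Matrix.of fun (_ : Unit) _ => Coalgebra.counit (R := ℂ) (1 : A)) = 1

namespace InhomData

variable {A I : Type*} [Ring A] [Bialgebra ℂ A] [Fintype I] [DecidableEq I] (D : InhomData A I)

lemma f_mul (s t : I) (a b : A) : D.f s t (a * b) = ∑ m, D.f s m a * D.f m t b := by
  have h := congrFun (congrFun (D.block_mul a b) (Sum.inl s)) (Sum.inl t)
  simpa [Matrix.mul_apply] using h

lemma f_one (s t : I) : D.f s t 1 = if s = t then 1 else 0 := by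
  have h := congrFun (congrFun D.block_one (Sum.inl s)) (Sum.inl t)
  simpa [Matrix.one_apply] using h

/-- `φ_s(a) = a * η_s - ∑ t, Λ_st (η_t * a)`. -/
def φ (s : I) : A →ₗ[ℂ] A :=
  convL (D.η s) - ∑ t, LinearMap.mulLeft ℂ (D.Λ s t) ∘ₗ convR (D.η t)

lemma φ_apply (s : I) (a : A) :
    D.φ s a = convL (D.η s) a - ∑ t, D.Λ s t * convR (D.η t) a := by
  simp [φ]

lemma comul_φ (s : I) (a : A) : Coalgebra.comul (R := ℂ) (D.φ s a) =
    ∑ t, (D.Λ s t ⊗ₜ[ℂ] (1 : A)) *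
      TensorProduct.map LinearMap.id (D.φ t) (Coalgebra.comul (R := ℂ) a) +
    TensorProduct.map (D.φ s) LinearMap.id (Coalgebra.comul (R := ℂ) a) := by
  have e1 : ∀ t (w : A ⊗[ℂ] A), TensorProduct.map LinearMap.id (D.φ t) w =
      TensorProduct.map LinearMap.id (convL (D.η t)) w -
      ∑ r, ((1 : A) ⊗ₜ[ℂ] D.Λ t r) * TensorProduct.map LinearMap.id (convR (D.η r)) w := by
    intro t w
    induction w with
    | zero => simp
    | add x y hx hy =>
      simp only [map_add, hx, hy, mul_add, Finset.sum_add_distrib]; abel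
    | tmul x y => simp [φ_apply, TensorProduct.tmul_sub, TensorProduct.tmul_sum]
  have e2 : ∀ (w : A ⊗[ℂ] A), TensorProduct.map (D.φ s) LinearMap.id w =
      TensorProduct.map (convL (D.η s)) LinearMap.id w -
      ∑ t, (D.Λ s t ⊗ₜ[ℂ] (1 : A)) * TensorProduct.map (convR (D.η t)) LinearMap.id w := by
    intro w
    induction w with
    | zero => simp
    | add x y hx hy =>
      simp only [map_add, hx, hy, mul_add, Finset.sum_add_distrib]; abel
    | tmul x y => simp [φ_apply, TensorProduct.sub_tmul, TensorProduct.sum_tmul]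
  simp only [e1, e2, mul_sub, Finset.sum_sub_distrib, map_convL_eq_convR, map_convR_comul,
    map_convL_comul]
  rw [φ_apply, map_sub, map_sum]
  simp only [Bialgebra.comul_mul, D.isRep.comul, Finset.sum_mul, Finset.mul_sum, ← mul_assoc,
    Algebra.TensorProduct.tmul_mul_tmul, mul_one, one_mul]
  rw [Finset.sum_comm]
  abel

lemma counit_φ (s : I) (a : A) : Coalgebra.counit (R := ℂ) (D.φ s a) = 0 := by
  simp [φ_apply, counit_convL, counit_convR, Bialgebra.counit_mul, D.isRep.counit]

/-! ### The algebra `B̃` -/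

/-- The defining relations of `B̃`: `A` is mapped to `B̃` by a unital algebra homomorphism, and
`p̃_s a = ∑ t, (a * f_st) p̃_t + φ_s(a)`. -/
inductive Rel : FreeAlgebra ℂ (A ⊕ I) → FreeAlgebra ℂ (A ⊕ I) → Prop
  | add (a b : A) : Rel (FreeAlgebra.ι ℂ (Sum.inl (a + b)))
      (FreeAlgebra.ι ℂ (Sum.inl a) + FreeAlgebra.ι ℂ (Sum.inl b))
  | mul (a b : A) : Rel (FreeAlgebra.ι ℂ (Sum.inl (a * b)))
      (FreeAlgebra.ι ℂ (Sum.inl a) * FreeAlgebra.ι ℂ (Sum.inl b))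
  | scalar (c : ℂ) : Rel (FreeAlgebra.ι ℂ (Sum.inl (algebraMap ℂ A c)))
      (algebraMap ℂ (FreeAlgebra ℂ (A ⊕ I)) c)
  | comm (s : I) (a : A) : Rel
      (FreeAlgebra.ι ℂ (Sum.inr s) * FreeAlgebra.ι ℂ (Sum.inl a))
      (∑ t, FreeAlgebra.ι ℂ (Sum.inl (convL (D.f s t) a)) * FreeAlgebra.ι ℂ (Sum.inr t) +
        FreeAlgebra.ι ℂ (Sum.inl (D.φ s a)))

/-- `B̃`: the unital algebra generated by `A` and `p̃_s`, `s ∈ I`, with the relations `Rel`. -/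
def Tilde : Type _ := RingQuot D.Rel

instance : Ring D.Tilde := inferInstanceAs (Ring (RingQuot D.Rel))

instance : Algebra ℂ D.Tilde := inferInstanceAs (Algebra ℂ (RingQuot D.Rel))

/-- The quotient map from the free algebra. -/
def toTilde : FreeAlgebra ℂ (A ⊕ I) →ₐ[ℂ] D.Tilde := RingQuot.mkAlgHom ℂ D.Rel

/-- The generators `p̃_s`. -/
def p (s : I) : D.Tilde := D.toTilde (FreeAlgebra.ι ℂ (Sum.inr s))

/-- The canonical homomorphism `A → B̃`. -/
def ιAlg : A →ₐ[ℂ] D.Tilde :=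
  AlgHom.ofLinearMap
    { toFun := fun a => D.toTilde (FreeAlgebra.ι ℂ (Sum.inl a))
      map_add' := fun a b => by
        rw [← map_add]; exact RingQuot.mkAlgHom_rel ℂ (Rel.add a b)
      map_smul' := fun c a => by
        have h1 := RingQuot.mkAlgHom_rel ℂ (Rel.mul (D := D) (algebraMap ℂ A c) a)
        have h2 := RingQuot.mkAlgHom_rel ℂ (Rel.scalar (D := D) c)
        rw [map_mul, h2, AlgHom.commutes, ← Algebra.smul_def, ← Algebra.smul_def] at h1
        exact h1 }
    (by
      have h := RingQuot.mkAlgHom_rel ℂ (Rel.scalar (D := D) 1)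
      simp only [map_one] at h
      exact h)
    (fun a b => by
      have h := RingQuot.mkAlgHom_rel ℂ (Rel.mul (D := D) a b)
      rw [map_mul] at h
      exact h)

lemma p_mul_ι (s : I) (a : A) :
    D.p s * D.ιAlg a = ∑ t, D.ιAlg (convL (D.f s t) a) * D.p t + D.ιAlg (D.φ s a) := by
  have h := RingQuot.mkAlgHom_rel ℂ (Rel.comm (D := D) s a)
  rw [map_mul, map_add, map_sum] at h
  simp only [map_mul] at h
  exact h

/-- The universal property of `B̃`. -/
def lift {B : Type*} [Ring B] [Algebra ℂ B] (g : A →ₐ[ℂ] B) (q : I → B)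
    (h : ∀ s a, q s * g a = ∑ t, g (convL (D.f s t) a) * q t + g (D.φ s a)) :
    D.Tilde →ₐ[ℂ] B :=
  RingQuot.liftAlgHom ℂ ⟨FreeAlgebra.lift ℂ (Sum.elim g q), by
    intro x y hxy
    cases hxy with
    | add a b => simp
    | mul a b => simp
    | scalar c => simp
    | comm s a => simpa using h s a⟩

section lift

variable {B : Type*} [Ring B] [Algebra ℂ B] (g : A →ₐ[ℂ] B) (q : I → B)
    (h : ∀ s a, q s * g a = ∑ t, g (convL (D.f s t) a) * q t + g (D.φ s a))

@[simp] lemma lift_ι (a : A) : D.lift g q h (D.ιAlg a) = g a := by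
  change (RingQuot.liftAlgHom ℂ ⟨FreeAlgebra.lift ℂ (Sum.elim g q), _⟩ : RingQuot D.Rel →ₐ[ℂ] B)
    (RingQuot.mkAlgHom ℂ D.Rel _) = _
  rw [RingQuot.liftAlgHom_mkAlgHom_apply]
  simp

@[simp] lemma lift_p (s : I) : D.lift g q h (D.p s) = q s := by
  change (RingQuot.liftAlgHom ℂ ⟨FreeAlgebra.lift ℂ (Sum.elim g q), _⟩ : RingQuot D.Rel →ₐ[ℂ] B)
    (RingQuot.mkAlgHom ℂ D.Rel _) = _
  rw [RingQuot.liftAlgHom_mkAlgHom_apply]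
  simp

lemma hom_ext {u v : D.Tilde →ₐ[ℂ] B} (h1 : ∀ a, u (D.ιAlg a) = v (D.ιAlg a))
    (h2 : ∀ s, u (D.p s) = v (D.p s)) : u = v := by
  apply RingQuot.ringQuot_ext' (S := ℂ)
  apply FreeAlgebra.hom_ext
  funext x
  rcases x with a | s
  · exact h1 a
  · exact h2 s

end lift

/-! ### The bialgebra structure of `B̃` -/

lemma p_tmul_one (s : I) (w : A ⊗[ℂ] A) :
    (D.p s ⊗ₜ[ℂ] (1 : D.Tilde)) * Algebra.TensorProduct.map D.ιAlg D.ιAlg w =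
      ∑ t, Algebra.TensorProduct.map D.ιAlg D.ιAlg
        (TensorProduct.map (convL (D.f s t)) LinearMap.id w) * (D.p t ⊗ₜ[ℂ] (1 : D.Tilde)) +
      Algebra.TensorProduct.map D.ιAlg D.ιAlg (TensorProduct.map (D.φ s) LinearMap.id w) := by
  induction w with
  | zero => simp
  | add x y hx hy =>
    simp only [map_add, mul_add, add_mul, hx, hy, Finset.sum_add_distrib]; abel
  | tmul x y => simp [p_mul_ι, TensorProduct.add_tmul, TensorProduct.sum_tmul]

lemma one_tmul_p (s : I) (w : A ⊗[ℂ] A) :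
    ((1 : D.Tilde) ⊗ₜ[ℂ] D.p s) * Algebra.TensorProduct.map D.ιAlg D.ιAlg w =
      ∑ t, Algebra.TensorProduct.map D.ιAlg D.ιAlg
        (TensorProduct.map LinearMap.id (convL (D.f s t)) w) * ((1 : D.Tilde) ⊗ₜ[ℂ] D.p t) +
      Algebra.TensorProduct.map D.ιAlg D.ιAlg (TensorProduct.map LinearMap.id (D.φ s) w) := by
  induction w with
  | zero => simp
  | add x y hx hy =>
    simp only [map_add, mul_add, add_mul, hx, hy, Finset.sum_add_distrib]; abel
  | tmul x y => simp [p_mul_ι, TensorProduct.tmul_add, TensorProduct.tmul_sum]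

lemma exchange_comul (s r : I) (a : A) :
    ∑ t, (D.Λ s t ⊗ₜ[ℂ] (1 : A)) *
        TensorProduct.map LinearMap.id (convL (D.f t r)) (Coalgebra.comul (R := ℂ) a) =
      ∑ t, Coalgebra.comul (R := ℂ) (convL (D.f s t) a) * (D.Λ t r ⊗ₜ[ℂ] (1 : A)) := by
  simp only [map_convL_eq_convR, ← map_convL_comul]
  generalize Coalgebra.comul (R := ℂ) a = w
  induction w with
  | zero => simp
  | add x y hx hy => simp only [map_add, mul_add, add_mul, hx, hy, Finset.sum_add_distrib]
  | tmul x y =>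
    simp only [TensorProduct.map_tmul, LinearMap.id_apply, Algebra.TensorProduct.tmul_mul_tmul,
      one_mul, mul_one, ← TensorProduct.sum_tmul, D.exchange]

/-- The comultiplication of `B̃`: it extends that of `A`, and
`Δ p̃_s = ∑ t, Λ_st ⊗ p̃_t + p̃_s ⊗ 1`. -/
def comulTilde : D.Tilde →ₐ[ℂ] D.Tilde ⊗[ℂ] D.Tilde :=
  D.lift ((Algebra.TensorProduct.map D.ιAlg D.ιAlg).comp (Bialgebra.comulAlgHom ℂ A))
    (fun s => ∑ t, D.ιAlg (D.Λ s t) ⊗ₜ[ℂ] D.p t + D.p s ⊗ₜ[ℂ] 1)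
    (by
      intro s a
      simp only [AlgHom.comp_apply, Bialgebra.comulAlgHom_apply]
      have e : ∀ t, D.ιAlg (D.Λ s t) ⊗ₜ[ℂ] D.p t =
          Algebra.TensorProduct.map D.ιAlg D.ιAlg (D.Λ s t ⊗ₜ[ℂ] (1 : A)) *
            ((1 : D.Tilde) ⊗ₜ[ℂ] D.p t) := by intro t; simp
      have e' : ∀ t r, D.ιAlg (D.Λ t r) ⊗ₜ[ℂ] D.p r =
          Algebra.TensorProduct.map D.ιAlg D.ιAlg (D.Λ t r ⊗ₜ[ℂ] (1 : A)) *
            ((1 : D.Tilde) ⊗ₜ[ℂ] D.p r) := by intro t r; simp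
      have h1 := congrArg (Algebra.TensorProduct.map D.ιAlg D.ιAlg) (D.comul_φ s a)
      have h2 : ∀ r, _ := fun r =>
        congrArg (fun z => Algebra.TensorProduct.map D.ιAlg D.ιAlg z *
          ((1 : D.Tilde) ⊗ₜ[ℂ] D.p r)) (D.exchange_comul s r a)
      simp only [map_add, map_sum, map_mul, Finset.sum_mul] at h1 h2
      rw [h1, add_mul, p_tmul_one, Finset.sum_mul]
      simp only [e', mul_assoc, one_tmul_p, mul_add, Finset.sum_add_distrib, map_convL_comul,
        Finset.mul_sum]
      rw [Finset.sum_comm]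
      simp only [← mul_assoc, h2]
      rw [Finset.sum_comm]
      abel)

/-- The counit of `B̃`: it extends that of `A`, and `ε(p̃_s) = 0`. -/
def counitTilde : D.Tilde →ₐ[ℂ] ℂ :=
  D.lift (Bialgebra.counitAlgHom ℂ A) (fun _ => 0) (by
    intro s a
    simp [counit_φ])

@[simp] lemma comulTilde_ι (a : A) : D.comulTilde (D.ιAlg a) =
    Algebra.TensorProduct.map D.ιAlg D.ιAlg (Coalgebra.comul (R := ℂ) a) := by
  simp [comulTilde]

@[simp] lemma comulTilde_p (s : I) : D.comulTilde (D.p s) =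
    ∑ t, D.ιAlg (D.Λ s t) ⊗ₜ[ℂ] D.p t + D.p s ⊗ₜ[ℂ] 1 := by
  simp [comulTilde]

@[simp] lemma counitTilde_ι (a : A) : D.counitTilde (D.ιAlg a) = Coalgebra.counit (R := ℂ) a := by
  simp [counitTilde]

@[simp] lemma counitTilde_p (s : I) : D.counitTilde (D.p s) = 0 := by
  simp [counitTilde]

instance : Bialgebra ℂ D.Tilde :=
  Bialgebra.ofAlgHom D.comulTilde D.counitTilde
    (by
      apply D.hom_ext
      · intro a
        have h1 : ∀ w : A ⊗[ℂ] A, Algebra.TensorProduct.assoc ℂ ℂ ℂ D.Tilde D.Tilde D.Tilde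
            (Algebra.TensorProduct.map D.comulTilde (.id ℂ D.Tilde)
              (Algebra.TensorProduct.map D.ιAlg D.ιAlg w)) =
            Algebra.TensorProduct.map D.ιAlg (Algebra.TensorProduct.map D.ιAlg D.ιAlg)
              (TensorProduct.assoc ℂ A A A (Coalgebra.comul.rTensor A w)) := by
          intro w
          induction w with
          | zero => simp
          | add x y hx hy => simp only [map_add, hx, hy]
          | tmul x y =>
            simp only [Algebra.TensorProduct.map_tmul, comulTilde_ι, LinearMap.rTensor_tmul,
              AlgHom.id_apply]
            generalize Coalgebra.comul (R := ℂ) x = z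
            induction z with
            | zero => simp
            | add u v hu hv => simp only [map_add, TensorProduct.add_tmul, hu, hv]
            | tmul u v => simp
        have h2 : ∀ w : A ⊗[ℂ] A, Algebra.TensorProduct.map (.id ℂ D.Tilde) D.comulTilde
              (Algebra.TensorProduct.map D.ιAlg D.ιAlg w) =
            Algebra.TensorProduct.map D.ιAlg (Algebra.TensorProduct.map D.ιAlg D.ιAlg)
              (Coalgebra.comul.lTensor A w) := by
          intro w
          induction w with
          | zero => simp
          | add x y hx hy => simp only [map_add, hx, hy]
          | tmul x y => simp
        simp only [AlgHom.comp_apply, comulTilde_ι, h2]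
        rw [← Coalgebra.coassoc_apply]
        exact h1 _
      · intro s
        simp [D.isRep.comul, TensorProduct.tmul_add, TensorProduct.add_tmul,
          TensorProduct.tmul_sum, TensorProduct.sum_tmul, Finset.sum_add_distrib,
          Algebra.TensorProduct.one_def, add_assoc]
        exact Finset.sum_comm)
    (by
      apply D.hom_ext
      · intro a
        have h1 : ∀ w : A ⊗[ℂ] A, Algebra.TensorProduct.map D.counitTilde (.id ℂ D.Tilde)
              (Algebra.TensorProduct.map D.ιAlg D.ιAlg w) =
            Algebra.TensorProduct.map (.id ℂ ℂ) D.ιAlg (Coalgebra.counit.rTensor A w) := by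
          intro w
          induction w with
          | zero => simp
          | add x y hx hy => simp only [map_add, hx, hy]
          | tmul x y => simp
        simp only [AlgHom.comp_apply, comulTilde_ι, h1, Coalgebra.rTensor_counit_comul]
        simp
      · intro s
        simp [D.isRep.counit, TensorProduct.ite_tmul])
    (by
      apply D.hom_ext
      · intro a
        have h1 : ∀ w : A ⊗[ℂ] A, Algebra.TensorProduct.map (.id ℂ D.Tilde) D.counitTilde
              (Algebra.TensorProduct.map D.ιAlg D.ιAlg w) =
            Algebra.TensorProduct.map D.ιAlg (.id ℂ ℂ) (Coalgebra.counit.lTensor A w) := by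
          intro w
          induction w with
          | zero => simp
          | add x y hx hy => simp only [map_add, hx, hy]
          | tmul x y => simp
        simp only [AlgHom.comp_apply, comulTilde_ι, h1, Coalgebra.lTensor_counit_comul]
        simp
      · intro s
        simp)

/-- The canonical homomorphism `A → B̃` as a bialgebra homomorphism. -/
def ι : A →ₐc[ℂ] D.Tilde :=
  BialgHom.ofAlgHom D.ιAlg
    (by
      ext a
      exact D.counitTilde_ι a)
    (by
      ext a
      exact (D.comulTilde_ι a).symm)

/-- `B̃^k`: the left `A`-module spanned by the products of at most `k` elements `p̃_s`. -/
def filt (k : ℕ) : Submodule ℂ D.Tilde :=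
  Submodule.span ℂ {x | ∃ (a : A) (l : List I), l.length ≤ k ∧ x = D.ι a * (l.map D.p).prod}

/-! ### The matrix `R`, the bimodules `Γ̇`, `Γ̇ ⊗_A Γ̇` and the braiding `ρ` -/

/-- `R_{ij,sm} = f_im(Λ_js)`. -/
def R : Matrix (I × I) (I × I) ℂ :=
  Matrix.of fun ij sm => D.f ij.1 sm.2 (D.Λ ij.2 sm.1)

/-- The product `Γ̇ × Γ̇ → Γ̇ ⊗_A Γ̇`.  Here `Γ̇` is the free left `A`-module with basis `ṗ_s`
and right multiplication `ṗ_s a = ∑ t, (a * f_st) ṗ_t`; an element `∑ x_s ṗ_s` is given by the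
family `x : I → A`.  Then `Γ̇ ⊗_A Γ̇` is the free left `A`-module with basis `ṗ_m ⊗ ṗ_j`, and
`x ⊗ y = ∑ x_i (y_j * f_im) ṗ_m ⊗ ṗ_j`. -/
def tens (x y : I → A) : I × I → A :=
  fun mj => ∑ i, x i * convL (D.f i mj.1) (y mj.2)

/-- The braiding `ρ` of `Γ̇ ⊗_A Γ̇`, in the basis `ṗ_i ⊗ ṗ_j`: the left `A`-linear map with
`ρ(ṗ_i ⊗ ṗ_j) = ∑ R_{ij,sm} ṗ_s ⊗ ṗ_m`. It is the map with `ρ(η ⊗ ω) = ω ⊗ η` for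
right-invariant `η` and left-invariant `ω`, see `braiding_tens`. -/
def braiding : (I × I → A) →ₗ[A] (I × I → A) where
  toFun c := c ᵥ* scal A D.R
  map_add' c d := Matrix.add_vecMul _ c d
  map_smul' a c := Matrix.smul_vecMul a c _

/-- `x ∈ Γ̇` is right-invariant: `Δ_R x = x ⊗ 1`, where `Δ_R (a ṗ_s) = Δ(a) (ṗ_s ⊗ 1)`. -/
def IsRightInv (x : I → A) : Prop :=
  ∀ s, Coalgebra.comul (R := ℂ) (x s) = x s ⊗ₜ[ℂ] (1 : A)

/-- `x ∈ Γ̇` is left-invariant: `Δ_L x = 1 ⊗ x`, where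
`Δ_L (a ṗ_s) = ∑ t, Δ(a) (Λ_st ⊗ ṗ_t)`. -/
def IsLeftInv (x : I → A) : Prop :=
  ∀ t, ∑ s, Coalgebra.comul (R := ℂ) (x s) * (D.Λ s t ⊗ₜ[ℂ] (1 : A)) = (1 : A) ⊗ₜ[ℂ] x t

lemma braiding_tens (x y : I → A) (hx : IsRightInv x) (hy : D.IsLeftInv y) :
    D.braiding (D.tens x y) = D.tens y x := by
  have hx' : ∀ i, x i = algebraMap ℂ A (Coalgebra.counit (R := ℂ) (x i)) := by
    intro i
    have h := congrArg (fun z => TensorProduct.lid ℂ A (Coalgebra.counit.rTensor A z)) (hx i)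
    simpa [Algebra.algebraMap_eq_smul_one] using h
  have h1 : ∀ i m (b : A) (w : A ⊗[ℂ] A),
      TensorProduct.lid ℂ A (TensorProduct.map (D.f i m) LinearMap.id (w * (b ⊗ₜ[ℂ] (1 : A)))) =
        ∑ a, D.f a m b • TensorProduct.lid ℂ A (TensorProduct.map (D.f i a) LinearMap.id w) := by
    intro i m b w
    induction w with
    | zero => simp
    | add u v hu hv => simp only [add_mul, map_add, hu, hv, smul_add, Finset.sum_add_distrib]
    | tmul u v => simp [f_mul, Finset.sum_smul, smul_smul, mul_comm]
  funext sm
  obtain ⟨s, m⟩ := sm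
  have h2 : ∀ i, ∑ j, ∑ a, D.f a m (D.Λ j s) • convL (D.f i a) (y j) =
      if i = m then y s else 0 := by
    intro i
    have h := congrArg (fun z => TensorProduct.lid ℂ A
      (TensorProduct.map (D.f i m) LinearMap.id z)) (hy s)
    simp only [map_sum, h1] at h
    simpa [f_one, convL] using h
  have h3 : ∀ i, convL (D.f i s) (x m) = if i = s then x m else 0 := by
    intro i
    rw [hx' m]
    simp [convL, f_one, Algebra.TensorProduct.one_def, Algebra.algebraMap_eq_smul_one]
  have h4 : ∀ i, ∑ j, ∑ a, x i * convL (D.f i a) (y j) * algebraMap ℂ A (D.f a m (D.Λ j s)) =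
      if i = m then x i * y s else 0 := by
    intro i
    have h := congrArg (fun z => x i * z) (h2 i)
    simp only [Finset.mul_sum] at h
    rw [mul_ite, mul_zero] at h
    rw [← h]
    refine Finset.sum_congr rfl fun j _ => Finset.sum_congr rfl fun a _ => ?_
    rw [← Algebra.commutes, ← Algebra.smul_def, mul_smul_comm]
  change ((D.tens x y) ᵥ* scal A D.R) (s, m) = D.tens y x (s, m)
  simp only [Matrix.vecMul, dotProduct, tens, Fintype.sum_prod_type, h3, R, scal, Matrix.map_apply,
    Matrix.of_apply, Finset.sum_mul]
  have h5 : ∑ a, ∑ j, ∑ i, x i * convL (D.f i a) (y j) * algebraMap ℂ A (D.f a m (D.Λ j s)) =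
      ∑ i, ∑ j, ∑ a, x i * convL (D.f i a) (y j) * algebraMap ℂ A (D.f a m (D.Λ j s)) := by
    rw [Finset.sum_comm]
    conv_rhs => rw [Finset.sum_comm]
    exact Finset.sum_congr rfl fun j _ => Finset.sum_comm
  rw [h5]
  simp only [h4]
  rw [Finset.sum_ite_eq' Finset.univ m]
  simp only [Finset.mem_univ, if_true, mul_ite, mul_zero, Finset.sum_ite_eq']
  rw [hx' m, Algebra.commutes]

/-- The identification `Γ̇ ⊗_A Γ̇ → Γ̇_2 = B̃²/B̃¹ ⊆ B̃/B̃¹`, `ṗ_i ⊗ ṗ_j ↦ [p̃_i p̃_j]`, left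
`A`-linear. -/
def toGamma₂ : (I × I → A) →ₗ[ℂ] (D.Tilde ⧸ D.filt 1) :=
  (D.filt 1).mkQ ∘ₗ
    ∑ ij : I × I, (LinearMap.mulRight ℂ (D.p ij.1 * D.p ij.2) ∘ₗ D.ιAlg.toLinearMap) ∘ₗ
      LinearMap.proj ij

/-- The identification turns the tensor product in `Γ̇ ⊗_A Γ̇` into the product of `B̃`. -/
lemma toGamma₂_tens (x y : I → A) : D.toGamma₂ (D.tens x y) =
    (D.filt 1).mkQ ((∑ i, D.ι (x i) * D.p i) * ∑ j, D.ι (y j) * D.p j) := by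
  have hι : ∀ a, D.ι a = D.ιAlg a := fun _ => rfl
  have h1 : D.toGamma₂ (D.tens x y) = (D.filt 1).mkQ
      (∑ m, ∑ j, ∑ i, D.ιAlg (x i) * D.ιAlg (convL (D.f i m) (y j)) * (D.p m * D.p j)) := by
    simp [toGamma₂, tens, Fintype.sum_prod_type, mul_assoc]
  have h2 : (∑ i, D.ι (x i) * D.p i) * ∑ j, D.ι (y j) * D.p j =
      ∑ m, ∑ j, ∑ i, D.ιAlg (x i) * D.ιAlg (convL (D.f i m) (y j)) * (D.p m * D.p j) +
      ∑ i, ∑ j, D.ι (x i * D.φ i (y j)) * D.p j := by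
    have h3 : ∀ i j, D.ιAlg (x i) * D.p i * (D.ιAlg (y j) * D.p j) =
        ∑ m, D.ιAlg (x i) * D.ιAlg (convL (D.f i m) (y j)) * (D.p m * D.p j) +
        D.ιAlg (x i * D.φ i (y j)) * D.p j := by
      intro i j
      rw [mul_assoc, ← mul_assoc (D.p i), p_mul_ι, map_mul]
      simp only [add_mul, mul_add, Finset.sum_mul, Finset.mul_sum, mul_assoc]
    simp only [hι, Finset.sum_mul_sum, h3, Finset.sum_add_distrib]
    congr 1
    conv_rhs => rw [Finset.sum_comm]
    rw [Finset.sum_comm]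
    refine Finset.sum_congr rfl fun j _ => Finset.sum_comm
  have h4 : ∑ i, ∑ j, D.ι (x i * D.φ i (y j)) * D.p j ∈ D.filt 1 :=
    Submodule.sum_mem _ fun i _ => Submodule.sum_mem _ fun j _ =>
      Submodule.subset_span ⟨x i * D.φ i (y j), [j], by simp, by simp⟩
  have h5 : (D.filt 1).mkQ (∑ i, ∑ j, D.ι (x i * D.φ i (y j)) * D.p j) = 0 :=
    (Submodule.Quotient.mk_eq_zero (D.filt 1)).2 h4
  rw [h1, h2, map_add, h5, add_zero]

/-! ### The two conditions on `J` -/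

/-- `J_2 = J ∩ B̃²`. -/
def J₂ (J : Ideal D.Tilde) : Submodule ℂ D.Tilde := J.restrictScalars ℂ ⊓ D.filt 2

/-- The intrinsic condition on `J`: it is a two-sided ideal with `Δ J ⊆ J ⊗ B̃ + B̃ ⊗ J` and `ε(J) = 0`
(together this is `Submodule.IsCoideal`, by `Submodule.isCoideal_iff_comul_mem`), with
`J ∩ B̃¹ = {0}` and `K = J_2/B̃¹ = ker (ρ + id)`. -/
structure CondI (J : Ideal D.Tilde) : Prop where
  isTwoSided : J.IsTwoSided
  isCoideal : (J.restrictScalars ℂ).IsCoideal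
  inf_filt_one : J.restrictScalars ℂ ⊓ D.filt 1 = ⊥
  eq_ker : (D.J₂ J).map (D.filt 1).mkQ =
    ((LinearMap.ker (D.braiding + LinearMap.id)).restrictScalars ℂ).map D.toGamma₂

/-- `τ_ij = η_j * η_i - η_i(Λ_js) η_s + T_ij ε - (f_jn * f_im) T_mn`. -/
def τ (T : I × I → ℂ) (i j : I) : A →ₗ[ℂ] ℂ :=
  conv (D.η j) (D.η i) - ∑ s, D.η i (D.Λ j s) • D.η s + T (i, j) • Coalgebra.counit
    - ∑ m, ∑ n, T (m, n) • conv (D.f j n) (D.f i m)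

/-- `g_αβ (τ_β * b) = b * τ_α` for all `b`, where `τ_α = a^α_ij τ_ij`, the rows `a^α` of the matrix
`a` form a basis of `{x : x (R + 1) = 0}` and `g` is the representation of `H` with
`a (Λ ⊤ Λ) = g a`.  (The condition does not depend on the choice of the basis.) -/
def CondBimodule (T : I × I → ℂ) : Prop :=
  ∃ (N : ℕ) (a : Matrix (Fin N) (I × I) ℂ) (g : Matrix (Fin N) (Fin N) A),
    LinearIndependent ℂ a.row ∧
    (∀ x : I × I → ℂ, x ∈ Submodule.span ℂ (Set.range a.row) ↔ x ᵥ* (D.R + 1) = 0) ∧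
    IsRep g ∧
    scal A a * (D.Λ ⊗ₖ D.Λ) = g * scal A a ∧
    ∀ (b : A) (α : Fin N),
      ∑ β, g α β * convR (∑ ij, a β ij • D.τ T ij.1 ij.2) b =
        convL (∑ ij, a α ij • D.τ T ij.1 ij.2) b

/-- `X ⊗ 1` for a matrix `X` with rows `I × I`. -/
def tensOne {κ : Type*} (X : Matrix (I × I) κ ℂ) : Matrix (I × I × I) (κ × I) ℂ :=
  Matrix.of fun ijk mn => X (ijk.1, ijk.2.1) mn.1 * (1 : Matrix I I ℂ) ijk.2.2 mn.2

/-- `1 ⊗ X` for a matrix `X` with rows `I × I`. -/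
def oneTens {κ : Type*} (X : Matrix (I × I) κ ℂ) : Matrix (I × I × I) (I × κ) ℂ :=
  Matrix.of fun ijk mn => (1 : Matrix I I ℂ) ijk.1 mn.1 * X ijk.2 mn.2

/-- `R ⊗ 1` as a square matrix. -/
def R₁₂ : Matrix (I × I × I) (I × I × I) ℂ :=
  (tensOne D.R).submatrix id (Equiv.prodAssoc I I I).symm

/-- `1 ⊗ R` as a square matrix. -/
def R₂₃ : Matrix (I × I × I) (I × I × I) ℂ := oneTens D.R

/-- `A_3`. -/
def A₃ : Matrix (I × I × I) (I × I × I) ℂ :=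
  1 - D.R₁₂ - D.R₂₃ + D.R₁₂ * D.R₂₃ + D.R₂₃ * D.R₁₂ - D.R₁₂ * D.R₂₃ * D.R₁₂

/-- `F_{ijk,m} = τ_ij(Λ_km)`. -/
def F (T : I × I → ℂ) : Matrix (I × I × I) I ℂ :=
  Matrix.of fun ijk m => D.τ T ijk.1 ijk.2.1 (D.Λ ijk.2.2 m)

/-- `Z_{ij,m} = η_i(Λ_jm)`. -/
def Z : Matrix (I × I) I ℂ := Matrix.of fun ij m => D.η ij.1 (D.Λ ij.2 m)

/-- The conditions on the constants `T`; the last one is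
`A_3 (Z ⊗ 1 - 1 ⊗ Z) T ∈ Mor(I, Λ ⊤ Λ ⊤ Λ)`. -/
structure CondT (T : I × I → ℂ) : Prop where
  bimodule : D.CondBimodule T
  A₃_mul_F : D.A₃ * D.F T = 0
  mor : Matrix.replicateCol Unit ((D.A₃ * (tensOne D.Z - oneTens D.Z)) *ᵥ T) ∈
    Mor (trivialRep A) (D.Λ ⊗ₖ (D.Λ ⊗ₖ D.Λ))

/-- `s_kl = (R - 1)_{kl,ij} (p̃_i p̃_j - η_i(Λ_js) p̃_s + T_ij - Λ_im Λ_jn T_mn)`. -/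
def s (T : I × I → ℂ) (kl : I × I) : D.Tilde :=
  ∑ ij : I × I, (D.R - 1) kl ij •
    (D.p ij.1 * D.p ij.2 - ∑ s, D.η ij.1 (D.Λ ij.2 s) • D.p s + algebraMap ℂ D.Tilde (T ij)
      - ∑ m, ∑ n, T (m, n) • D.ι (D.Λ ij.1 m * D.Λ ij.2 n))

/-- The two-sided ideal generated by the `s_kl`. -/
def idealS (T : I × I → ℂ) : Ideal D.Tilde :=
  TwoSidedIdeal.asIdeal (TwoSidedIdeal.span (Set.range (D.s T)))

/-- `J` is the ideal generated by the `s_kl` for some admissible constants `T`. -/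
def CondII (J : Ideal D.Tilde) : Prop := ∃ T : I × I → ℂ, D.CondT T ∧ J = D.idealS T

end InhomData

/-! ### Inhomogeneous quantum groups over `H` -/

section Conditions

variable {A I : Type*} [Ring A] [Bialgebra ℂ A] [Fintype I] [DecidableEq I]

/-- `Γ = A · span{p_i} + A`. -/
def Gamma {B : Type*} [Ring B] [Bialgebra ℂ B] (i : A →ₐc[ℂ] B) (p : I → B) : Submodule ℂ B :=
  Submodule.span ℂ {x | ∃ a s, x = i a * p s} ⊔ Submodule.span ℂ (Set.range i)

/-- The conditions defining an inhomogeneous quantum group: `B` is a bialgebra, `A` is embedded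
in `B` by `i`, and `p_s` are elements of `B`. -/
structure IsInhomogeneous (Λ : Matrix I I A) {B : Type*} [Ring B] [Bialgebra ℂ B]
    (i : A →ₐc[ℂ] B) (p : I → B) : Prop where
  /-- `B` is generated by `A` and the `p_s` -/
  generated : Algebra.adjoin ℂ (Set.range i ∪ Set.range p) = ⊤
  /-- `A` is a sub-bialgebra of `B` -/
  injective : Function.Injective i
  /-- `(Λ, p; 0, 1)` is a representation -/
  isRep : IsRep (Matrix.fromBlocks (Λ.map i) (Matrix.replicateCol Unit p) 0 1)
  /-- some `p_s` is not in `A` -/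
  exists_notMem : ∃ s, p s ∉ Set.range i
  /-- `Γ A ⊆ Γ` -/
  bimodule : ∀ x ∈ Gamma i p, ∀ a, x * i a ∈ Gamma i p

/-- `B̃/J` is a quotient bialgebra of `B̃` and is an inhomogeneous quantum group. -/
def InhomData.QuotientIsInhomogeneous (D : InhomData A I) (J : Ideal D.Tilde) : Prop :=
  ∃ (_ : J.IsTwoSided) (_ : (J.restrictScalars ℂ).IsCoideal),
    IsInhomogeneous D.Λ ((Bialgebra.Quotient.mkBialgHom (R := ℂ) J).comp D.ι)
      (fun s => Ideal.Quotient.mk J (D.p s))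

end Conditions

end InhomQG

end

/-!
Let `Q_ij = p̃_i p̃_j - Z_ij,s p̃_s + T_ij - Λ_im Λ_jn T_mn`, so that `s = (R - 1) Q`. The algebra `B̃` is
free as a left `A`-module on the words in the `p̃_s` (`wordLift`), and the theorem is a statement about
the nonhomogeneous quadratic quotients of `B̃` by relations with leading part `(R - 1) (p̃ ⊗ p̃)`.

*Meaning of admissibility.* Modulo the image of `1 + R`, which `R - 1` annihilates, the product `Q b`
with `b ∈ A` and the coproduct of `Q` are again expressed through `Q`. Hence the span of the `s_kl` over
`A` is always a coideal (`comul_s`), while `s b` has a remainder in `A`, the contraction of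
`b * τ_ij - Λ_is Λ_jt (τ_st * b)` with `R - 1` (`s_mul_ι`). The overlaps `Q_ij p̃_k - p̃_i Q_jk`, contracted
with the rows of `A_3`, have a remainder with linear part `A_3 F` and with constant part given by the
vector `A_3 (Z ⊗ 1 - 1 ⊗ Z) T` (`antisymm_overlap`). Admissibility says that all these remainders, which
lie in `B̃¹`, vanish. In particular it is forced as soon as an ideal contains the `s_kl` and meets `B̃¹`
trivially (`condT_of_s_mem`).

*The ideal of an admissible `T`.* Let the adjacent transpositions act on the words of length `n + 1` by
`p̃_k p̃_l ↦ p̃_k p̃_l + s_kl = R_{kl,mn} p̃_m p̃_n + ⋯` (`swap`). For admissible `T` they satisfy the Coxeter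
relations modulo the products of degree at most `n` that contain some `s_kl`. The symmetrizer is then
the identity on `B̃^n` and kills the products of degree `n + 1` containing some `s_kl`. This is a
Poincaré–Birkhoff–Witt theorem (`mem_jfilt_of_mem_idealS`): the ideal has no unexpected elements in low
degree, so it meets `B̃¹` trivially and its part of degree at most two is `A · span {s_kl}`.

*From an intrinsic ideal to `T`.* Let `J` satisfy the intrinsic condition. Its quadratic elements are
`s_kl`, for `T = 0`, plus terms of degree at most one. Since `J ∩ B̃¹ = 0`, the coefficients of the elements of
`B̃¹` extend to linear maps on `B̃` that vanish on `J` (`exists_coeff`), and applying pairs of them to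
coproducts determines the coproducts of the lower-order terms (`comul_lower_terms`). The linear terms
turn out to be scalars that intertwine `Λ` with `Λ ⊤ Λ`, so they vanish. The constant terms form a
cocycle with values in `Λ ⊤ Λ`, which is a coboundary by complete reducibility
(`IsRep.exists_coboundary`), that is, of the form `T - (Λ ⊤ Λ) T`. Thus all the `s_kl` belong to `J` for
suitable `T` (`CondI.exists_s_mem`).

*No further generators.* Let `∂_t` be the convolution with the functional that extracts the coefficient
of `p̃_t` and vanishes on `J`. It preserves the coideal `J` and lowers degrees, and in leading order it
is the derivation with `p̃_i ↦ Λ_it`. With the left-invariant elements `ζ_t = (Λ⁻¹)_tr p̃_r`, which commute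
with the `p̃_i` modulo the `s_kl` and lower-order terms, there is an Euler formula `∑_t (∂_t x) ζ_t = n x`,
again modulo the `s_kl` and lower-order terms (`sum_wordDeriv_mul_zeta_sub_mem`). By induction on the
degree every element of `J` lies in the ideal generated by the `s_kl` (`CondI.eq_idealS`).
-/

noncomputable section

namespace InhomQG

/-! ### Calculus of convolutions -/

section Conv

variable {A : Type*} [Ring A] [Bialgebra ℂ A]

lemma conv_apply_convL (ρ ρ' : A →ₗ[ℂ] ℂ) (a : A) : conv ρ ρ' a = ρ' (convL ρ a) := by
  have h : ∀ w : A ⊗[ℂ] A, TensorProduct.lid ℂ ℂ (TensorProduct.map ρ ρ' w) =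
      ρ' (TensorProduct.lid ℂ A (TensorProduct.map ρ LinearMap.id w)) := by
    intro w
    induction w with
    | zero => simp
    | add x y hx hy => simp only [map_add, hx, hy]
    | tmul x y => simp
  exact h _

lemma conv_apply_convR (ρ ρ' : A →ₗ[ℂ] ℂ) (a : A) : conv ρ ρ' a = ρ (convR ρ' a) := by
  have h : ∀ w : A ⊗[ℂ] A, TensorProduct.lid ℂ ℂ (TensorProduct.map ρ ρ' w) =
      ρ (TensorProduct.rid ℂ A (TensorProduct.map LinearMap.id ρ' w)) := by
    intro w
    induction w with
    | zero => simp
    | add x y hx hy => simp only [map_add, hx, hy]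
    | tmul x y => simp [mul_comm]
  exact h _

lemma convL_convL (ρ ρ' : A →ₗ[ℂ] ℂ) (a : A) : convL ρ' (convL ρ a) = convL (conv ρ ρ') a := by
  have h : conv ρ ρ' = ρ' ∘ₗ convL ρ := LinearMap.ext fun a => conv_apply_convL ρ ρ' a
  rw [h]
  have h1 := congrArg (fun z => TensorProduct.lid ℂ A (TensorProduct.map ρ' LinearMap.id z))
    (map_convL_comul ρ a)
  simp only [TensorProduct.map_map, LinearMap.comp_id] at h1
  exact h1.symm

lemma convR_convR (ρ ρ' : A →ₗ[ℂ] ℂ) (a : A) : convR ρ (convR ρ' a) = convR (conv ρ ρ') a := by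
  have h : conv ρ ρ' = ρ ∘ₗ convR ρ' := LinearMap.ext fun a => conv_apply_convR ρ ρ' a
  rw [h]
  have h1 := congrArg (fun z => TensorProduct.rid ℂ A (TensorProduct.map LinearMap.id ρ z))
    (map_convR_comul ρ' a)
  simp only [TensorProduct.map_map, LinearMap.comp_id] at h1
  exact h1.symm

lemma convL_convR (ρ ρ' : A →ₗ[ℂ] ℂ) (a : A) : convL ρ (convR ρ' a) = convR ρ' (convL ρ a) := by
  have h : ∀ w : A ⊗[ℂ] A, TensorProduct.lid ℂ A (TensorProduct.map ρ LinearMap.id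
      (TensorProduct.map LinearMap.id (convR ρ') w)) =
      convR ρ' (TensorProduct.lid ℂ A (TensorProduct.map ρ LinearMap.id w)) := by
    intro w
    induction w with
    | zero => simp
    | add x y hx hy => simp only [map_add, hx, hy]
    | tmul x y => simp
  have h1 := h (Coalgebra.comul a)
  rw [map_convR_comul] at h1
  exact h1

@[simp] lemma convL_counit (a : A) : convL (Coalgebra.counit (R := ℂ)) a = a := by
  have h := Coalgebra.rTensor_counit_comul (R := ℂ) a
  rw [LinearMap.rTensor] at h
  simp [convL, h]

@[simp] lemma convR_counit (a : A) : convR (Coalgebra.counit (R := ℂ)) a = a := by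
  have h := Coalgebra.lTensor_counit_comul (R := ℂ) a
  rw [LinearMap.lTensor] at h
  simp [convR, h]

/-- A product formula for a functional passes to the left convolution with it. -/
lemma convL_mul {κ : Type*} [Fintype κ] (ρ : A →ₗ[ℂ] ℂ) (α β : κ → A →ₗ[ℂ] ℂ)
    (h : ∀ a b, ρ (a * b) = ∑ k, α k a * β k b) (a b : A) :
    convL ρ (a * b) = ∑ k, convL (α k) a * convL (β k) b := by
  have h1 : ∀ v w : A ⊗[ℂ] A, TensorProduct.lid ℂ A (TensorProduct.map ρ LinearMap.id (v * w)) =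
      ∑ k, TensorProduct.lid ℂ A (TensorProduct.map (α k) LinearMap.id v) *
        TensorProduct.lid ℂ A (TensorProduct.map (β k) LinearMap.id w) := by
    intro v w
    induction v with
    | zero => simp
    | add x y hx hy => simp only [add_mul, map_add, hx, hy, Finset.sum_add_distrib]
    | tmul x y =>
      induction w with
      | zero => simp
      | add u v hu hv => simp only [mul_add, map_add, hu, hv, Finset.sum_add_distrib]
      | tmul u v => simp only [h, Algebra.TensorProduct.tmul_mul_tmul, TensorProduct.map_tmul,
          TensorProduct.lid_tmul, LinearMap.id_apply, Finset.sum_smul, smul_mul_smul_comm]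
  have := h1 (Coalgebra.comul a) (Coalgebra.comul b)
  rw [← Bialgebra.comul_mul] at this
  exact this

/-- A product formula for a functional passes to the right convolution with it. -/
lemma convR_mul {κ : Type*} [Fintype κ] (ρ : A →ₗ[ℂ] ℂ) (α β : κ → A →ₗ[ℂ] ℂ)
    (h : ∀ a b, ρ (a * b) = ∑ k, α k a * β k b) (a b : A) :
    convR ρ (a * b) = ∑ k, convR (α k) a * convR (β k) b := by
  have h1 : ∀ v w : A ⊗[ℂ] A, TensorProduct.rid ℂ A (TensorProduct.map LinearMap.id ρ (v * w)) =
      ∑ k, TensorProduct.rid ℂ A (TensorProduct.map LinearMap.id (α k) v) *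
        TensorProduct.rid ℂ A (TensorProduct.map LinearMap.id (β k) w) := by
    intro v w
    induction v with
    | zero => simp
    | add x y hx hy => simp only [add_mul, map_add, hx, hy, Finset.sum_add_distrib]
    | tmul x y =>
      induction w with
      | zero => simp
      | add u v hu hv => simp only [mul_add, map_add, hu, hv, Finset.sum_add_distrib]
      | tmul u v => simp only [h, Algebra.TensorProduct.tmul_mul_tmul, TensorProduct.map_tmul,
          TensorProduct.rid_tmul, LinearMap.id_apply, Finset.sum_smul, smul_mul_smul_comm]
  have := h1 (Coalgebra.comul a) (Coalgebra.comul b)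
  rw [← Bialgebra.comul_mul] at this
  exact this

lemma convL_rep {n : Type*} [Fintype n] [DecidableEq n] {v : Matrix n n A} (hv : IsRep v)
    (ρ : A →ₗ[ℂ] ℂ) (i j : n) : convL ρ (v i j) = ∑ k, ρ (v i k) • v k j := by
  simp [convL, hv.comul]

lemma convR_rep {n : Type*} [Fintype n] [DecidableEq n] {v : Matrix n n A} (hv : IsRep v)
    (ρ : A →ₗ[ℂ] ℂ) (i j : n) : convR ρ (v i j) = ∑ k, ρ (v k j) • v i k := by
  simp [convR, hv.comul]

lemma algebraMap_injective_of_bialgebra : Function.Injective (algebraMap ℂ A) := by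
  intro x y h
  simpa using congrArg (Coalgebra.counit (R := ℂ)) h

end Conv

section WordModule

variable {A I : Type*} [Ring A] [Algebra ℂ A]

/-- The action of `A` on the free left module with basis the words. -/
def wordModA : A →ₐ[ℂ] Module.End ℂ (List I →₀ A) :=
  AlgHom.ofLinearMap
    { toFun := fun a => Finsupp.mapRange.linearMap (LinearMap.mulLeft ℂ a)
      map_add' := fun a b => Finsupp.lhom_ext fun w x => by simp [add_mul]
      map_smul' := fun c a => Finsupp.lhom_ext fun w x => by simp [-Finsupp.single_mul] }
    (Finsupp.lhom_ext fun w x => by simp)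
    (fun a b => Finsupp.lhom_ext fun w x => by simp [-Finsupp.single_mul])

lemma wordModA_single (a b : A) (w : List I) :
    wordModA a (Finsupp.single w b) = Finsupp.single w (a * b) := by
  simp [wordModA]

end WordModule

namespace InhomData

variable {A I : Type*} [Ring A] [Bialgebra ℂ A] [Fintype I] [DecidableEq I] (D : InhomData A I)

lemma η_mul (s : I) (a b : A) :
    D.η s (a * b) = ∑ m, D.f s m a * D.η m b + D.η s a * Coalgebra.counit (R := ℂ) b := by
  have h := congrFun (congrFun (D.block_mul a b) (Sum.inl s)) (Sum.inr ())
  simpa [Matrix.mul_apply] using h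

@[simp] lemma η_one (s : I) : D.η s 1 = 0 := by
  have h := congrFun (congrFun D.block_one (Sum.inl s)) (Sum.inr ())
  simpa [Matrix.one_apply] using h

lemma convL_f_mul (s t : I) (a b : A) :
    convL (D.f s t) (a * b) = ∑ m, convL (D.f s m) a * convL (D.f m t) b :=
  convL_mul _ _ _ (D.f_mul s t) a b

/-- The twisted derivation rule for `η_s` as a single sum over `Option I`, with `none` standing for the
last term, so that `convL_mul` and `convR_mul` apply. -/
lemma η_mul_option (s : I) (a b : A) : D.η s (a * b) =
    ∑ k : Option I, (k.elim (D.η s) (D.f s)) a * (k.elim Coalgebra.counit D.η) b := by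
  rw [Fintype.sum_option, η_mul, add_comm]
  rfl

lemma convL_η_mul (s : I) (a b : A) :
    convL (D.η s) (a * b) = ∑ m, convL (D.f s m) a * convL (D.η m) b + convL (D.η s) a * b := by
  rw [convL_mul _ _ _ (D.η_mul_option s) a b, Fintype.sum_option, add_comm]
  simp

lemma convR_η_mul (s : I) (a b : A) :
    convR (D.η s) (a * b) = ∑ m, convR (D.f s m) a * convR (D.η m) b + convR (D.η s) a * b := by
  rw [convR_mul _ _ _ (D.η_mul_option s) a b, Fintype.sum_option, add_comm]
  simp

lemma φ_mul (s : I) (a b : A) :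
    D.φ s (a * b) = ∑ t, convL (D.f s t) a * D.φ t b + D.φ s a * b := by
  simp only [φ_apply, convL_η_mul, convR_η_mul, mul_add, Finset.sum_add_distrib, mul_sub,
    Finset.sum_sub_distrib, sub_mul, Finset.sum_mul, Finset.mul_sum, ← mul_assoc]
  have h : ∑ t, ∑ r, D.Λ s t * convR (D.f t r) a * convR (D.η r) b =
      ∑ t, ∑ r, convL (D.f s t) a * D.Λ t r * convR (D.η r) b := by
    rw [Finset.sum_comm]
    conv_rhs => rw [Finset.sum_comm]
    refine Finset.sum_congr rfl fun r _ => ?_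
    rw [← Finset.sum_mul, ← Finset.sum_mul, D.exchange]
  rw [h]
  abel

lemma convL_one (ρ : A →ₗ[ℂ] ℂ) : convL ρ (1 : A) = algebraMap ℂ A (ρ 1) := by
  simp [convL, Algebra.TensorProduct.one_def, Algebra.algebraMap_eq_smul_one]

lemma convL_f_one (s t : I) : convL (D.f s t) (1 : A) = if s = t then 1 else 0 := by
  rw [convL_one, f_one]; split_ifs <;> simp

@[simp] lemma φ_one (s : I) : D.φ s 1 = 0 := by
  simp [φ_apply, convL, convR, Algebra.TensorProduct.one_def]

/-! ### A basis of `B̃` over `A` -/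

/-- The monomial `p̃_{l_1} ⋯ p̃_{l_k}`. -/
def word (l : List I) : D.Tilde := (l.map D.p).prod

@[simp] lemma word_nil : D.word [] = 1 := rfl

@[simp] lemma word_cons (i : I) (l : List I) : D.word (i :: l) = D.p i * D.word l := by
  simp [word]

@[simp] lemma word_append (l l' : List I) : D.word (l ++ l') = D.word l * D.word l' := by
  simp [word]

lemma ι_eq (a : A) : D.ι a = D.ιAlg a := rfl

lemma p_mul_ι' (s : I) (a : A) :
    D.p s * D.ι a = ∑ t, D.ι (convL (D.f s t) a) * D.p t + D.ι (D.φ s a) :=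
  D.p_mul_ι s a

/-- The action of `p̃_s` on the free left module with basis the words, dictated by the
commutation relations. -/
def wordModP (s : I) : Module.End ℂ (List I →₀ A) :=
  Finsupp.lsum ℂ fun w => ∑ t, Finsupp.lsingle (t :: w) ∘ₗ convL (D.f s t) +
    Finsupp.lsingle w ∘ₗ D.φ s

lemma wordModP_single (s : I) (b : A) (w : List I) :
    D.wordModP s (Finsupp.single w b) =
      ∑ t, Finsupp.single (t :: w) (convL (D.f s t) b) + Finsupp.single w (D.φ s b) := by
  simp [wordModP]

/-- The action of `B̃` on the free left `A`-module with basis the words. -/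
def wordMod : D.Tilde →ₐ[ℂ] Module.End ℂ (List I →₀ A) :=
  D.lift wordModA D.wordModP (by
    intro s a
    refine Finsupp.lhom_ext fun w b => ?_
    simp only [Module.End.mul_apply, wordModA_single, wordModP_single, LinearMap.add_apply,
      LinearMap.sum_apply, convL_f_mul, φ_mul, Finsupp.single_add, Finsupp.single_finsetSum,
      map_add, map_sum, Finset.sum_add_distrib]
    rw [Finset.sum_comm]
    abel)

lemma wordMod_ι_single (a b : A) (w : List I) :
    D.wordMod (D.ι a) (Finsupp.single w b) = Finsupp.single w (a * b) := by
  rw [ι_eq, wordMod, lift_ι, wordModA_single]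

lemma wordMod_word (l : List I) :
    D.wordMod (D.word l) (Finsupp.single [] 1) = Finsupp.single l 1 := by
  induction l with
  | nil => simp
  | cons i l ih =>
    rw [word_cons, map_mul, Module.End.mul_apply, ih]
    rw [wordMod, lift_p, wordModP_single]
    simp only [convL_f_one, φ_one, Finsupp.single_zero, add_zero]
    rw [Finset.sum_eq_single i]
    · simp
    · intro b _ hb; simp [Ne.symm hb]
    · simp

/-- The linear map on `B̃` prescribed by its values on the elements `a · p̃_{l_1} ⋯ p̃_{l_k}`;
its existence expresses that the monomials form a basis of `B̃` over `A`. -/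
def wordLift {M : Type*} [AddCommGroup M] [Module ℂ M] (h : List I → A →ₗ[ℂ] M) :
    D.Tilde →ₗ[ℂ] M :=
  Finsupp.lsum ℂ h ∘ₗ LinearMap.applyₗ (Finsupp.single [] 1) ∘ₗ D.wordMod.toLinearMap

lemma wordLift_apply {M : Type*} [AddCommGroup M] [Module ℂ M] (h : List I → A →ₗ[ℂ] M)
    (a : A) (l : List I) : D.wordLift h (D.ι a * D.word l) = h l a := by
  simp [wordLift, wordMod_word, wordMod_ι_single]

lemma ι_mul_word_mem_filt (a : A) (l : List I) {k : ℕ} (h : l.length ≤ k) :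
    D.ι a * D.word l ∈ D.filt k :=
  Submodule.subset_span ⟨a, l, h, rfl⟩

lemma word_mem_filt (l : List I) {k : ℕ} (h : l.length ≤ k) : D.word l ∈ D.filt k := by
  simpa using D.ι_mul_word_mem_filt 1 l h

lemma ι_mem_filt (a : A) (k : ℕ) : D.ι a ∈ D.filt k := by
  simpa using D.ι_mul_word_mem_filt a [] (Nat.zero_le k)

lemma p_mem_filt (i : I) {k : ℕ} (h : 1 ≤ k) : D.p i ∈ D.filt k := by
  simpa using D.word_mem_filt [i] (k := k) (by simpa using h)

lemma filt_mono {k l : ℕ} (h : k ≤ l) : D.filt k ≤ D.filt l :=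
  Submodule.span_mono fun _ ⟨a, w, hw, hx⟩ => ⟨a, w, hw.trans h, hx⟩

lemma filt_induction {k : ℕ} {P : D.Tilde → Prop} (h0 : P 0) (hadd : ∀ x y, P x → P y → P (x + y))
    (hw : ∀ a l, l.length ≤ k → P (D.ι a * D.word l)) {x : D.Tilde} (hx : x ∈ D.filt k) : P x := by
  have h : ∀ y ∈ Submodule.span ℂ {x | ∃ (a : A) (l : List I), l.length ≤ k ∧
      x = D.ι a * (l.map D.p).prod}, P y := by
    intro y hy
    induction hy using Submodule.closure_induction with
    | zero => exact h0
    | add x y _ _ hx hy => exact hadd x y hx hy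
    | smul_mem c x hx =>
      obtain ⟨a, l, hl, rfl⟩ := hx
      have := hw (c • a) l hl
      rwa [map_smul, smul_mul_assoc] at this
  exact h x hx

/-- A submodule contains `B̃^k` as soon as it contains the generators. -/
lemma filt_le {k : ℕ} {N : Submodule ℂ D.Tilde}
    (h : ∀ a l, l.length ≤ k → D.ι a * D.word l ∈ N) : D.filt k ≤ N :=
  Submodule.span_le.2 fun _ ⟨a, l, hl, hx⟩ => hx ▸ h a l hl

lemma ι_mul_mem_filt (a : A) {k : ℕ} {x : D.Tilde} (hx : x ∈ D.filt k) :
    D.ι a * x ∈ D.filt k := by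
  have : D.filt k ≤ (D.filt k).comap (LinearMap.mulLeft ℂ (D.ι a)) := D.filt_le fun b l hl => by
    simp only [Submodule.mem_comap, LinearMap.mulLeft_apply, ← mul_assoc, ← map_mul]
    exact D.ι_mul_word_mem_filt _ _ hl
  exact this hx

lemma p_mul_mem_filt (i : I) {k : ℕ} {x : D.Tilde} (hx : x ∈ D.filt k) :
    D.p i * x ∈ D.filt (k + 1) := by
  have : D.filt k ≤ (D.filt (k + 1)).comap (LinearMap.mulLeft ℂ (D.p i)) :=
    D.filt_le fun b l hl => by
      simp only [Submodule.mem_comap, LinearMap.mulLeft_apply, ← mul_assoc, p_mul_ι', add_mul,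
        Finset.sum_mul]
      refine add_mem (sum_mem fun t _ => ?_) (D.ι_mul_word_mem_filt _ _ (by omega))
      rw [mul_assoc, ← word_cons]
      exact D.ι_mul_word_mem_filt _ _ (by simpa using hl)
  exact this hx

lemma word_mul_mem_filt (l : List I) {k m : ℕ} {x : D.Tilde} (hx : x ∈ D.filt k)
    (h : l.length + k ≤ m) : D.word l * x ∈ D.filt m := by
  induction l generalizing m with
  | nil => simpa using D.filt_mono (by simpa using h) hx
  | cons i l ih =>
    rw [word_cons, mul_assoc]
    simp only [List.length_cons] at h
    obtain ⟨m, rfl⟩ : ∃ m', m = m' + 1 := ⟨m - 1, by omega⟩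
    exact D.p_mul_mem_filt i (ih (by omega))

lemma mul_mem_filt {k l m : ℕ} {x y : D.Tilde} (hx : x ∈ D.filt k) (hy : y ∈ D.filt l)
    (h : k + l ≤ m) : x * y ∈ D.filt m := by
  have : D.filt k ≤ (D.filt m).comap (LinearMap.mulRight ℂ y) :=
    D.filt_le fun b w hw => by
      simp only [Submodule.mem_comap, LinearMap.mulRight_apply, mul_assoc]
      exact D.ι_mul_mem_filt _ (D.word_mul_mem_filt w hy (by omega))
  exact this hx

lemma exists_mem_filt (x : D.Tilde) : ∃ k, x ∈ D.filt k := by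
  -- The union of the `B̃^k` is a subalgebra containing the generators.
  let S : Subalgebra ℂ D.Tilde :=
    { carrier := {x | ∃ k, x ∈ D.filt k}
      mul_mem' := by
        rintro x y ⟨k, hx⟩ ⟨l, hy⟩
        exact ⟨k + l, D.mul_mem_filt hx hy le_rfl⟩
      add_mem' := by
        rintro x y ⟨k, hx⟩ ⟨l, hy⟩
        exact ⟨max k l, add_mem (D.filt_mono (le_max_left _ _) hx)
          (D.filt_mono (le_max_right _ _) hy)⟩
      algebraMap_mem' := fun c => ⟨0, by
        rw [← AlgHom.commutes D.ιAlg]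
        exact D.ι_mem_filt _ 0⟩ }
  let g : D.Tilde →ₐ[ℂ] S := D.lift (D.ιAlg.codRestrict S fun a => ⟨0, D.ι_mem_filt a 0⟩)
    (fun i => ⟨D.p i, 1, D.p_mem_filt i le_rfl⟩) (by
      intro s a
      apply Subtype.ext
      simpa using D.p_mul_ι s a)
  have hg : S.val.comp g = AlgHom.id ℂ D.Tilde := by
    apply D.hom_ext
    · intro a
      simp [g]
    · intro s
      simp [g]
  have := (g x).2
  rwa [show ((g x : S) : D.Tilde) = x from AlgHom.congr_fun hg x] at this

lemma word_induction {P : D.Tilde → Prop} (h0 : P 0) (hadd : ∀ x y, P x → P y → P (x + y))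
    (hw : ∀ a l, P (D.ι a * D.word l)) (x : D.Tilde) : P x := by
  obtain ⟨k, hk⟩ := D.exists_mem_filt x
  exact D.filt_induction h0 hadd (fun a l _ => hw a l) hk

end InhomData

end InhomQG

namespace InhomQG

namespace InhomData

/-! ### The matrices `R`, `Z` and the antisymmetrizer `A_3` -/

section

variable {A I : Type*} [Ring A] [Bialgebra ℂ A] [Fintype I] [DecidableEq I] (D : InhomData A I)

lemma f_Λ (i j s m : I) : D.f i m (D.Λ j s) = D.R (i, j) (s, m) := rfl

lemma η_Λ (i j m : I) : D.η i (D.Λ j m) = D.Z (i, j) m := rfl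

lemma conv_rep (ρ ρ' : A →ₗ[ℂ] ℂ) (i j : I) :
    conv ρ ρ' (D.Λ i j) = ∑ k, ρ (D.Λ i k) * ρ' (D.Λ k j) := by
  rw [conv_apply_convL, convL_rep D.isRep]
  simp

lemma counit_conv (ρ : A →ₗ[ℂ] ℂ) (a : A) : conv Coalgebra.counit ρ a = ρ a := by
  rw [conv_apply_convL, convL_counit]

/-- The functionals `f` intertwine with `R`: apply `f_xy` to the exchange relation of `Λ`
and `f`. -/
lemma R_conv_f_f (x s r y : I) (a : A) :
    ∑ t, ∑ z, D.R (x, s) (t, z) * conv (D.f z y) (D.f t r) a =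
      ∑ t, ∑ z, conv (D.f s t) (D.f x z) a * D.R (z, t) (r, y) := by
  have h := congrArg (D.f x y) (D.exchange s r a)
  simp only [map_sum, f_mul, ← conv_apply_convR, ← conv_apply_convL, f_Λ] at h
  exact h

/-- The mixed relation between the functionals `f` and `η`: apply `η_x` to the exchange relation
of `Λ` and `f`. -/
lemma R_conv_η_f (x s r : I) (a : A) :
    ∑ t, ∑ z, D.R (x, s) (t, z) * conv (D.η z) (D.f t r) a + ∑ t, D.Z (x, s) t * D.f t r a =
      ∑ t, ∑ z, conv (D.f s t) (D.f x z) a * D.Z (z, t) r + conv (D.f s r) (D.η x) a := by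
  have h := congrArg (D.η x) (D.exchange s r a)
  simp only [map_sum, η_mul, ← conv_apply_convR, ← conv_apply_convL, f_Λ, η_Λ,
    Finset.sum_add_distrib, D.isRep.counit, counit_conv] at h
  simpa using h

/-- `R` is an intertwiner of `Λ ⊤ Λ`. -/
lemma R_mul_ΛΛ : scal A D.R * (D.Λ ⊗ₖ D.Λ) = (D.Λ ⊗ₖ D.Λ) * scal A D.R := by
  ext ⟨s, j⟩ ⟨k, r⟩
  have h := D.exchange s r (D.Λ j k)
  simp only [convL_rep D.isRep, convR_rep D.isRep, f_Λ, Finset.mul_sum, Finset.sum_mul] at h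
  simp only [Matrix.mul_apply, Fintype.sum_prod_type, scal, Matrix.map_apply,
    Matrix.kroneckerMap_apply, ← Algebra.commutes (R := ℂ) (A := A), ← Algebra.smul_def]
  rw [Finset.sum_comm]
  simpa using h.symm

lemma R_ΛΛ_apply (s j k r : I) : ∑ m, ∑ t, D.R (s, j) (m, t) • (D.Λ m k * D.Λ t r) =
    ∑ t, ∑ m, D.R (t, m) (k, r) • (D.Λ s t * D.Λ j m) := by
  have h := congrFun (congrFun D.R_mul_ΛΛ (s, j)) (k, r)
  simpa only [Matrix.mul_apply, Fintype.sum_prod_type, scal, Matrix.map_apply,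
    Matrix.kroneckerMap_apply, ← Algebra.commutes (R := ℂ) (A := A), ← Algebra.smul_def] using h

variable {κ : Type*}

lemma tensOne_mul {ν : Type*} [Fintype κ] (X : Matrix (I × I) κ ℂ) (M : Matrix (κ × I) ν ℂ)
    (i j k : I) (c : ν) :
    (tensOne X * M) (i, j, k) c = ∑ l, X (i, j) l * M (l, k) c := by
  simp [Matrix.mul_apply, tensOne, Fintype.sum_prod_type, Matrix.one_apply]

lemma oneTens_mul {ν : Type*} [Fintype κ] (X : Matrix (I × I) κ ℂ) (M : Matrix (I × κ) ν ℂ)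
    (i j k : I) (c : ν) :
    (oneTens X * M) (i, j, k) c = ∑ l, X (j, k) l * M (i, l) c := by
  simp only [Matrix.mul_apply, oneTens, Fintype.sum_prod_type, Matrix.one_apply, Matrix.of_apply]
  rw [Finset.sum_eq_single i]
  · simp
  · intro b _ hb; simp [Ne.symm hb]
  · simp

lemma R₁₂_mul {ν : Type*} (M : Matrix (I × I × I) ν ℂ) (i j k : I) (c : ν) :
    (D.R₁₂ * M) (i, j, k) c = ∑ l, ∑ m, D.R (i, j) (l, m) * M (l, m, k) c := by
  simp [Matrix.mul_apply, R₁₂, tensOne, Fintype.sum_prod_type, Matrix.one_apply]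

lemma R₂₃_mul {ν : Type*} (M : Matrix (I × I × I) ν ℂ) (i j k : I) (c : ν) :
    (D.R₂₃ * M) (i, j, k) c = ∑ l, ∑ m, D.R (j, k) (l, m) * M (i, l, m) c := by
  rw [R₂₃, oneTens_mul, Fintype.sum_prod_type]

lemma R₁₂_apply (i j k l m n : I) :
    D.R₁₂ (i, j, k) (l, m, n) = D.R (i, j) (l, m) * if k = n then 1 else 0 := by
  simp [R₁₂, tensOne, Matrix.one_apply]

lemma R₂₃_apply (i j k l m n : I) :
    D.R₂₃ (i, j, k) (l, m, n) = (if i = l then 1 else 0) * D.R (j, k) (m, n) := by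
  simp [R₂₃, oneTens, Matrix.one_apply]

/-- The Yang–Baxter equation for `R`. -/
lemma R_braid : D.R₁₂ * D.R₂₃ * D.R₁₂ = D.R₂₃ * D.R₁₂ * D.R₂₃ := by
  ext ⟨x, s, u⟩ ⟨v, r, y⟩
  have h := D.R_conv_f_f x s r y (D.Λ u v)
  simp only [conv_rep, f_Λ] at h
  rw [Matrix.mul_assoc, Matrix.mul_assoc, R₁₂_mul, R₂₃_mul]
  simp only [R₁₂_mul, R₂₃_mul, R₁₂_apply, R₂₃_apply, ite_mul, one_mul, zero_mul, mul_ite, mul_one,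
    mul_zero, Finset.sum_ite_eq', Finset.sum_ite_irrel, Finset.sum_const_zero, Finset.mem_univ,
    if_true]
  rw [h]
  simp only [Finset.sum_mul, Finset.mul_sum, ← mul_assoc]
  conv_rhs => rw [Finset.sum_comm]
  exact Finset.sum_congr rfl fun _ _ => Finset.sum_comm

/-- The compatibility of `Z` with `R`. -/
lemma R_Z_relation : D.R₁₂ * oneTens D.Z * D.R + tensOne D.Z * D.R =
    D.R₂₃ * D.R₁₂ * oneTens D.Z + D.R₂₃ * tensOne D.Z := by
  ext ⟨x, s, u⟩ ⟨v, r⟩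
  have h := D.R_conv_η_f x s r (D.Λ u v)
  simp only [conv_rep, f_Λ, η_Λ] at h
  simp only [Matrix.add_apply, Matrix.mul_assoc, R₁₂_mul, R₂₃_mul, tensOne_mul]
  simp only [oneTens_mul]
  simp only [oneTens, tensOne, Matrix.of_apply, Matrix.one_apply, ite_mul, one_mul, zero_mul,
    mul_ite, mul_one, mul_zero, Finset.sum_ite_eq', Finset.sum_ite_irrel, Finset.sum_const_zero,
    Finset.mem_univ, if_true]
  rw [h]
  simp only [Finset.sum_mul, Finset.mul_sum, ← mul_assoc]
  congr 1
  conv_rhs => rw [Finset.sum_comm]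
  exact Finset.sum_congr rfl fun _ _ => Finset.sum_comm

lemma R_mul_self (hρ : D.braiding ∘ₗ D.braiding = LinearMap.id) : D.R * D.R = 1 := by
  have h : scal A D.R * scal A D.R = 1 := by
    refine Matrix.ext_of_single_vecMul fun i => ?_
    rw [← Matrix.vecMul_vecMul, Matrix.vecMul_one]
    exact LinearMap.congr_fun hρ (Pi.single i 1)
  apply Matrix.map_injective algebraMap_injective_of_bialgebra (α := ℂ) (β := A)
  change (D.R * D.R).map (algebraMap ℂ A) = (1 : Matrix (I × I) (I × I) ℂ).map (algebraMap ℂ A)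
  rw [Matrix.map_mul, h]
  simp

section involutive

variable (hR : D.R * D.R = 1)

include hR

lemma R_mul_R_apply (i j k l : I) :
    ∑ m, ∑ n, D.R (i, j) (m, n) * D.R (m, n) (k, l) = if i = k ∧ j = l then 1 else 0 := by
  have h := congrFun (congrFun hR (i, j)) (k, l)
  simpa [Matrix.mul_apply, Fintype.sum_prod_type, Matrix.one_apply] using h

lemma R₁₂_mul_self : D.R₁₂ * D.R₁₂ = 1 := by
  ext ⟨i, j, k⟩ ⟨l, m, n⟩
  rw [R₁₂_mul]
  simp only [R₁₂_apply, ← mul_assoc, ← Finset.sum_mul, D.R_mul_R_apply hR]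
  simp only [Matrix.one_apply, Prod.mk.injEq]
  split_ifs <;> simp_all

lemma R₂₃_mul_self : D.R₂₃ * D.R₂₃ = 1 := by
  ext ⟨i, j, k⟩ ⟨l, m, n⟩
  rw [R₂₃_mul]
  simp only [R₂₃_apply, mul_left_comm, ← Finset.mul_sum, D.R_mul_R_apply hR]
  simp only [Matrix.one_apply, Prod.mk.injEq]
  split_ifs <;> simp_all

/-- The rows of `A_3` are antisymmetric in the first two indices. -/
lemma A₃_mul_R₁₂ : D.A₃ * D.R₁₂ = -D.A₃ := by
  have h := D.R₁₂_mul_self hR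
  simp only [A₃, sub_mul, add_mul, one_mul, Matrix.mul_assoc, h, mul_one]
  abel

/-- The rows of `A_3` are antisymmetric in the last two indices. -/
lemma A₃_mul_R₂₃ : D.A₃ * D.R₂₃ = -D.A₃ := by
  have h := D.R₂₃_mul_self hR
  rw [A₃, R_braid]
  simp only [sub_mul, add_mul, one_mul, Matrix.mul_assoc, h, mul_one]
  abel

/-- The rows of `A_3 (Z ⊗ 1 - 1 ⊗ Z)` are antisymmetric. -/
lemma A₃_mul_Z_mul_R :
    D.A₃ * (tensOne D.Z - oneTens D.Z) * D.R = -(D.A₃ * (tensOne D.Z - oneTens D.Z)) := by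
  have h := congrArg (fun M => D.A₃ * M) D.R_Z_relation
  simp only [Matrix.mul_add, ← Matrix.mul_assoc, D.A₃_mul_R₁₂ hR, D.A₃_mul_R₂₃ hR,
    Matrix.neg_mul, neg_neg] at h
  simp only [Matrix.mul_sub, Matrix.sub_mul]
  rw [neg_sub, ← sub_eq_zero, ← sub_eq_zero.2 h]
  abel

end involutive

lemma R₁₂_mul_ΛΛΛ : scal A D.R₁₂ * (D.Λ ⊗ₖ (D.Λ ⊗ₖ D.Λ)) =
    (D.Λ ⊗ₖ (D.Λ ⊗ₖ D.Λ)) * scal A D.R₁₂ := by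
  ext ⟨s, j, u⟩ ⟨k, r, v⟩
  have h := congrArg (fun z => z * D.Λ u v) (D.R_ΛΛ_apply s j k r)
  simp only [Finset.sum_mul, smul_mul_assoc, mul_assoc] at h
  simp only [Matrix.mul_apply, Fintype.sum_prod_type, scal, Matrix.map_apply,
    Matrix.kroneckerMap_apply, ← Algebra.commutes (R := ℂ) (A := A), ← Algebra.smul_def,
    R₁₂_apply, mul_ite, mul_one, mul_zero, ite_smul, zero_smul, Finset.sum_ite_eq,
    Finset.sum_ite_eq', Finset.mem_univ, if_true]
  exact h

lemma R₂₃_mul_ΛΛΛ : scal A D.R₂₃ * (D.Λ ⊗ₖ (D.Λ ⊗ₖ D.Λ)) =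
    (D.Λ ⊗ₖ (D.Λ ⊗ₖ D.Λ)) * scal A D.R₂₃ := by
  ext ⟨u, s, j⟩ ⟨v, k, r⟩
  have h := congrArg (fun z => D.Λ u v * z) (D.R_ΛΛ_apply s j k r)
  simp only [Finset.mul_sum, mul_smul_comm] at h
  simp only [Matrix.mul_apply, Fintype.sum_prod_type, scal, Matrix.map_apply,
    Matrix.kroneckerMap_apply, ← Algebra.commutes (R := ℂ) (A := A), ← Algebra.smul_def,
    R₂₃_apply, ite_mul, one_mul, zero_mul, ite_smul, zero_smul, Finset.sum_ite_eq,
    Finset.sum_ite_eq', Finset.mem_univ, if_true, Finset.sum_ite_irrel, Finset.sum_const_zero]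
  exact h

lemma A₃_mul_ΛΛΛ : scal A D.A₃ * (D.Λ ⊗ₖ (D.Λ ⊗ₖ D.Λ)) =
    (D.Λ ⊗ₖ (D.Λ ⊗ₖ D.Λ)) * scal A D.A₃ := by
  let φ : Matrix (I × I × I) (I × I × I) ℂ →+* Matrix (I × I × I) (I × I × I) A :=
    (algebraMap ℂ A).mapMatrix
  have h1 : Commute (φ D.R₁₂) (D.Λ ⊗ₖ (D.Λ ⊗ₖ D.Λ)) := D.R₁₂_mul_ΛΛΛ
  have h2 : Commute (φ D.R₂₃) (D.Λ ⊗ₖ (D.Λ ⊗ₖ D.Λ)) := D.R₂₃_mul_ΛΛΛ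
  have h3 : Commute (φ D.A₃) (D.Λ ⊗ₖ (D.Λ ⊗ₖ D.Λ)) := by
    simp only [A₃, map_sub, map_add, map_mul, map_one]
    exact (((((Commute.one_left _).sub_left h1).sub_left h2).add_left (h1.mul_left h2)).add_left
      (h2.mul_left h1)).sub_left ((h1.mul_left h2).mul_left h1)
  exact h3

end

end InhomData
end InhomQG

namespace InhomQG

section Sums

variable {α β γ δ M : Type*} [Fintype α] [Fintype β] [Fintype γ] [Fintype δ] [AddCommMonoid M]

lemma sum_rotate (F : α → β → γ → M) :
    ∑ a, ∑ b, ∑ c, F a b c = ∑ c, ∑ a, ∑ b, F a b c := by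
  rw [Finset.sum_comm_cycle]

lemma sum_comm_pairs (F : α → β → γ → δ → M) :
    ∑ a, ∑ b, ∑ c, ∑ d, F a b c d = ∑ c, ∑ d, ∑ a, ∑ b, F a b c d := by
  rw [sum_rotate]
  exact Finset.sum_congr rfl fun c _ => sum_rotate fun a b d => F a b c d

end Sums

section Conv

variable {A : Type*} [Ring A] [Bialgebra ℂ A]

/-- Left convolution as a linear function of the functional. -/
def convLHom (a : A) : (A →ₗ[ℂ] ℂ) →ₗ[ℂ] A where
  toFun ρ := convL ρ a
  map_add' ρ ρ' := by simp [convL, TensorProduct.map_add_left]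
  map_smul' c ρ := by simp [convL, TensorProduct.map_smul_left]

/-- Right convolution as a linear function of the functional. -/
def convRHom (a : A) : (A →ₗ[ℂ] ℂ) →ₗ[ℂ] A where
  toFun ρ := convR ρ a
  map_add' ρ ρ' := by simp [convR, TensorProduct.map_add_right]
  map_smul' c ρ := by simp [convR, TensorProduct.map_smul_right]

lemma convLHom_apply (ρ : A →ₗ[ℂ] ℂ) (a : A) : convLHom a ρ = convL ρ a := rfl

lemma convRHom_apply (ρ : A →ₗ[ℂ] ℂ) (a : A) : convRHom a ρ = convR ρ a := rfl

end Conv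

namespace InhomData

variable {A I : Type*} [Ring A] [Bialgebra ℂ A] [Fintype I] [DecidableEq I] (D : InhomData A I)

/-! ### The quadratic elements and multiplication from the right by `A` -/

lemma convL_R_f_f (x s r y : I) (b : A) :
    ∑ t, ∑ z, D.R (x, s) (t, z) • convL (conv (D.f z y) (D.f t r)) b =
      ∑ t, ∑ z, D.R (z, t) (r, y) • convL (conv (D.f s t) (D.f x z)) b := by
  have h : ∑ t, ∑ z, D.R (x, s) (t, z) • conv (D.f z y) (D.f t r) =
      ∑ t, ∑ z, D.R (z, t) (r, y) • conv (D.f s t) (D.f x z) := by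
    ext a
    simpa [mul_comm] using D.R_conv_f_f x s r y a
  have h' := congrArg (convLHom b) h
  simp only [map_sum, map_smul] at h'
  exact h'

lemma convL_R_η_f (x s r : I) (b : A) :
    ∑ t, ∑ z, D.R (x, s) (t, z) • convL (conv (D.η z) (D.f t r)) b +
        ∑ t, D.Z (x, s) t • convL (D.f t r) b =
      ∑ t, ∑ z, D.Z (z, t) r • convL (conv (D.f s t) (D.f x z)) b +
        convL (conv (D.f s r) (D.η x)) b := by
  have h : ∑ t, ∑ z, D.R (x, s) (t, z) • conv (D.η z) (D.f t r) +
        ∑ t, D.Z (x, s) t • D.f t r =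
      ∑ t, ∑ z, D.Z (z, t) r • conv (D.f s t) (D.f x z) + conv (D.f s r) (D.η x) := by
    ext a
    simpa [mul_comm] using D.R_conv_η_f x s r a
  have h' := congrArg (convLHom b) h
  simp only [map_add, map_sum, map_smul] at h'
  exact h'

lemma convL_f_Λ_mul (i j k n : I) (c : A) : convL (D.f i n) (D.Λ j k * c) =
    ∑ t, ∑ z, D.R (i, j) (t, z) • (D.Λ t k * convL (D.f z n) c) := by
  simp only [convL_f_mul, convL_rep D.isRep, f_Λ, Finset.sum_mul, smul_mul_assoc]
  exact Finset.sum_comm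

lemma φ_Λ (i j k : I) : D.φ i (D.Λ j k) =
    ∑ l, D.Z (i, j) l • D.Λ l k - ∑ s, ∑ m, D.Z (s, m) k • (D.Λ i s * D.Λ j m) := by
  simp only [φ_apply, convL_rep D.isRep, convR_rep D.isRep, η_Λ, Finset.mul_sum, mul_smul_comm]

lemma φ_Λ_mul (i j k : I) (c : A) : D.φ i (D.Λ j k * c) =
    ∑ t, ∑ z, D.R (i, j) (t, z) • (D.Λ t k * D.φ z c) + D.φ i (D.Λ j k) * c := by
  simp only [φ_mul, convL_rep D.isRep, f_Λ, Finset.sum_mul, smul_mul_assoc]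
  rw [Finset.sum_comm]

/-- The coefficients of `p̃_n` in `p̃_i p̃_j b`, corrected by those of `Z_ij,s p̃_s b`, are
symmetric: they are in the image of `1 + R`. -/
lemma linear_coeff_eq (i j n : I) (b : A) (K : I → I → A)
    (hK : ∀ i j, K i j = convL (conv (D.η j) (D.f i n)) b -
      ∑ t, D.Λ i t * convR (D.η t) (convL (D.f j n) b)) :
    D.φ i (convL (D.f j n) b) + convL (D.f i n) (D.φ j b) - ∑ s, D.Z (i, j) s • convL (D.f s n) b +
        ∑ t, ∑ z, D.Z (z, t) n • convL (conv (D.f j t) (D.f i z)) b =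
      K i j + ∑ t, ∑ z, D.R (i, j) (t, z) • K t z := by
  have h1 := D.convL_R_η_f i j n b
  have h2 : convL (D.f i n) (D.φ j b) = convL (conv (D.η j) (D.f i n)) b -
      ∑ t, ∑ z, D.R (i, j) (t, z) • ∑ k, D.Λ t k * convR (D.η k) (convL (D.f z n) b) := by
    rw [φ_apply, map_sub, map_sum, convL_convL]
    simp only [convL_f_Λ_mul, Finset.smul_sum, convL_convR]
    congr 1
    rw [Finset.sum_comm]
    exact Finset.sum_congr rfl fun _ _ => Finset.sum_comm
  rw [h2, φ_apply, convL_convL]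
  simp only [hK, smul_sub, Finset.sum_sub_distrib]
  rw [← sub_eq_zero] at h1 ⊢
  rw [← neg_eq_zero, ← h1]
  abel

/-- The constant term of `p̃_i p̃_j b - Z_ij,s p̃_s b`, up to the image of `1 + R`. -/
lemma constant_coeff_eq (i j : I) (b : A) (τ' : I → I → A →ₗ[ℂ] ℂ)
    (hτ : ∀ i j, τ' i j = conv (D.η j) (D.η i) - ∑ s, D.Z (i, j) s • D.η s) (K : I → I → A)
    (hK : ∀ i j, K i j = ∑ t, ∑ w, D.Λ i t * D.Λ j w * convR (conv (D.η w) (D.η t)) b -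
      ∑ s, D.Λ i s * convR (D.η s) (convL (D.η j) b)) :
    D.φ i (D.φ j b) - ∑ s, D.Z (i, j) s • D.φ s b =
      convL (τ' i j) b - ∑ s, ∑ t, D.Λ i s * D.Λ j t * convR (τ' s t) b +
        (K i j + ∑ t, ∑ z, D.R (i, j) (t, z) • K t z) := by
  have hL : convL (τ' i j) b = convL (conv (D.η j) (D.η i)) b -
      ∑ s, D.Z (i, j) s • convL (D.η s) b := by
    rw [hτ]
    have h' := map_sub (convLHom b) (conv (D.η j) (D.η i)) (∑ s, D.Z (i, j) s • D.η s)
    simp only [map_sum, map_smul] at h'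
    exact h'
  have hR : ∀ s t, convR (τ' s t) b = convR (conv (D.η t) (D.η s)) b -
      ∑ r, D.Z (s, t) r • convR (D.η r) b := by
    intro s t
    rw [hτ]
    have h' := map_sub (convRHom b) (conv (D.η t) (D.η s)) (∑ r, D.Z (s, t) r • D.η r)
    simp only [map_sum, map_smul] at h'
    exact h'
  have h0 : ∀ t z, ∑ k, D.Λ t k * D.φ z (convR (D.η k) b) = -K t z := by
    intro t z
    simp only [φ_apply, hK, mul_sub, Finset.sum_sub_distrib, convL_convR, convR_convR,
      Finset.mul_sum, mul_assoc, neg_sub]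
  have h1 : D.φ i (D.φ j b) = convL (conv (D.η j) (D.η i)) b -
      ∑ s, D.Λ i s * convR (D.η s) (convL (D.η j) b) +
      ∑ t, ∑ z, D.R (i, j) (t, z) • K t z -
      ∑ t, D.φ i (D.Λ j t) * convR (D.η t) b := by
    have h2 : ∑ k, ∑ t, ∑ z, D.R (i, j) (t, z) • (D.Λ t k * D.φ z (convR (D.η k) b)) =
        -∑ t, ∑ z, D.R (i, j) (t, z) • K t z := by
      rw [Finset.sum_comm, ← Finset.sum_neg_distrib]
      refine Finset.sum_congr rfl fun t _ => ?_
      rw [Finset.sum_comm, ← Finset.sum_neg_distrib]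
      refine Finset.sum_congr rfl fun z _ => ?_
      rw [← Finset.smul_sum, h0, smul_neg]
    rw [D.φ_apply j, map_sub, D.φ_apply i, convL_convL, map_sum]
    simp only [φ_Λ_mul, Finset.sum_add_distrib, h2]
    abel
  have h3 : ∑ t, D.φ i (D.Λ j t) * convR (D.η t) b =
      ∑ l, ∑ t, D.Z (i, j) l • (D.Λ l t * convR (D.η t) b) -
      ∑ s, ∑ m, D.Λ i s * D.Λ j m * ∑ t, D.Z (s, m) t • convR (D.η t) b := by
    simp only [φ_Λ, sub_mul, Finset.sum_mul, Finset.sum_sub_distrib, smul_mul_assoc,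
      Finset.mul_sum, mul_smul_comm]
    congr 1
    · exact Finset.sum_comm
    · rw [Finset.sum_comm]
      exact Finset.sum_congr rfl fun _ _ => Finset.sum_comm
  rw [h1, h3, hL]
  simp only [hR, mul_sub, Finset.sum_sub_distrib, φ_apply, smul_sub, Finset.smul_sum]
  rw [hK i j]
  abel

/-- The exchange relation used twice. -/
lemma exchange_exchange (i j k l : I) (b : A) :
    ∑ m, ∑ n, convL (conv (D.f j n) (D.f i m)) b * (D.Λ m k * D.Λ n l) =
      ∑ m, ∑ n, D.Λ i m * D.Λ j n * convR (conv (D.f n l) (D.f m k)) b := by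
  have h1 : ∀ n, ∑ m, convL (D.f i m) (convL (D.f j n) b) * D.Λ m k =
      ∑ m, D.Λ i m * convL (D.f j n) (convR (D.f m k) b) := by
    intro n
    simp only [convL_convR, D.exchange]
  rw [Finset.sum_comm]
  simp only [← convL_convL, ← mul_assoc, ← Finset.sum_mul, h1]
  simp only [Finset.sum_mul]
  rw [Finset.sum_comm]
  refine Finset.sum_congr rfl fun m _ => ?_
  simp only [mul_assoc, ← Finset.mul_sum, ← D.exchange, ← convR_convR]

/-- `Q_ij = p̃_i p̃_j - Z_ij,s p̃_s + T_ij - Λ_im Λ_jn T_mn`; the elements `s_kl` are the entries of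
`(R - 1) Q`. -/
def quad (T : I × I → ℂ) (i j : I) : D.Tilde :=
  D.p i * D.p j - ∑ s, D.Z (i, j) s • D.p s + algebraMap ℂ D.Tilde (T (i, j))
    - ∑ m, ∑ n, T (m, n) • D.ι (D.Λ i m * D.Λ j n)

lemma s_eq (T : I × I → ℂ) (k l : I) :
    D.s T (k, l) = ∑ i, ∑ j, (D.R - 1) (k, l) (i, j) • D.quad T i j := by
  rw [s, Fintype.sum_prod_type]
  rfl

/-- The defect of bimodule covariance of `τ`:
`Ω_ij(b) = b * τ_ij - Λ_is Λ_jt (τ_st * b)`. -/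
def omega (T : I × I → ℂ) (i j : I) (b : A) : A :=
  convL (D.τ T i j) b - ∑ s, ∑ t, D.Λ i s * D.Λ j t * convR (D.τ T s t) b

lemma τ_eq (T : I × I → ℂ) (i j : I) : D.τ T i j =
    (conv (D.η j) (D.η i) - ∑ s, D.Z (i, j) s • D.η s) + T (i, j) • Coalgebra.counit
    - ∑ m, ∑ n, T (m, n) • conv (D.f j n) (D.f i m) := rfl

/-- The contribution of the constants `T` to the constant term of `Q_ij b`. -/
lemma omega_eq (T : I × I → ℂ) (i j : I) (b : A) (τ' : I → I → A →ₗ[ℂ] ℂ)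
    (hτ : ∀ i j, τ' i j = conv (D.η j) (D.η i) - ∑ s, D.Z (i, j) s • D.η s) :
    D.omega T i j b = convL (τ' i j) b - ∑ s, ∑ t, D.Λ i s * D.Λ j t * convR (τ' s t) b +
      T (i, j) • b - ∑ m, ∑ n, T (m, n) • (D.Λ i m * D.Λ j n * b) -
      ∑ m, ∑ n, convL (conv (D.f j n) (D.f i m)) b *
        (algebraMap ℂ A (T (m, n)) - ∑ k, ∑ l, T (k, l) • (D.Λ m k * D.Λ n l)) := by
  have hL : convL (D.τ T i j) b = convL (τ' i j) b + T (i, j) • b -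
      ∑ m, ∑ n, T (m, n) • convL (conv (D.f j n) (D.f i m)) b := by
    have h' : convLHom b (D.τ T i j) = convLHom b (τ' i j) +
        T (i, j) • convLHom b Coalgebra.counit -
        ∑ m, ∑ n, T (m, n) • convLHom b (conv (D.f j n) (D.f i m)) := by
      simp only [τ_eq, hτ, map_sub, map_add, map_smul, map_sum]
    simpa only [convLHom_apply, convL_counit] using h'
  have hR : ∀ s t, convR (D.τ T s t) b = convR (τ' s t) b + T (s, t) • b -
      ∑ m, ∑ n, T (m, n) • convR (conv (D.f t n) (D.f s m)) b := by
    intro s t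
    have h' : convRHom b (D.τ T s t) = convRHom b (τ' s t) +
        T (s, t) • convRHom b Coalgebra.counit -
        ∑ m, ∑ n, T (m, n) • convRHom b (conv (D.f t n) (D.f s m)) := by
      simp only [τ_eq, hτ, map_sub, map_add, map_smul, map_sum]
    simpa only [convRHom_apply, convR_counit] using h'
  have h1 : ∑ s, ∑ t, D.Λ i s * D.Λ j t *
        ∑ m, ∑ n, T (m, n) • convR (conv (D.f t n) (D.f s m)) b =
      ∑ m, ∑ n, convL (conv (D.f j n) (D.f i m)) b *
        ∑ k, ∑ l, T (k, l) • (D.Λ m k * D.Λ n l) := by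
    simp only [Finset.mul_sum]
    rw [sum_comm_pairs]
    conv_rhs => rw [sum_comm_pairs]
    simp only [mul_smul_comm, ← Finset.smul_sum, D.exchange_exchange]
  rw [omega, hL]
  simp only [hR, mul_sub, mul_add, Finset.sum_sub_distrib, Finset.sum_add_distrib, h1,
    mul_smul_comm, ← Algebra.commutes (R := ℂ) (A := A), ← Algebra.smul_def]
  abel

/-- Right multiplication of the quadratic elements by `b ∈ A`, up to the image of `1 + R`. -/
lemma quad_mul_ι (T : I × I → ℂ) (b : A) : ∃ K : I → I → D.Tilde, ∀ i j,
    D.quad T i j * D.ι b =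
      ∑ m, ∑ n, D.ι (convL (conv (D.f j n) (D.f i m)) b) * D.quad T m n + D.ι (D.omega T i j b) +
      (K i j + ∑ t, ∑ z, D.R (i, j) (t, z) • K t z) := by
  obtain ⟨τ', hτ⟩ : ∃ τ' : I → I → A →ₗ[ℂ] ℂ,
      ∀ i j, τ' i j = conv (D.η j) (D.η i) - ∑ s, D.Z (i, j) s • D.η s := ⟨_, fun _ _ => rfl⟩
  obtain ⟨K₁, hK₁⟩ : ∃ K₁ : I → I → I → A,
      ∀ n i j, K₁ n i j = convL (conv (D.η j) (D.f i n)) b -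
      ∑ t, D.Λ i t * convR (D.η t) (convL (D.f j n) b) := ⟨_, fun _ _ _ => rfl⟩
  obtain ⟨K₀, hK₀⟩ : ∃ K₀ : I → I → A,
      ∀ i j, K₀ i j = ∑ t, ∑ w, D.Λ i t * D.Λ j w * convR (conv (D.η w) (D.η t)) b -
      ∑ s, D.Λ i s * convR (D.η s) (convL (D.η j) b) := ⟨_, fun _ _ => rfl⟩
  refine ⟨fun i j => ∑ n, D.ι (K₁ n i j) * D.p n + D.ι (K₀ i j), fun i j => ?_⟩
  have hpp : D.p i * D.p j * D.ι b =
      ∑ m, ∑ n, D.ι (convL (conv (D.f j n) (D.f i m)) b) * (D.p m * D.p n) +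
      ∑ n, D.ι (D.φ i (convL (D.f j n) b) + convL (D.f i n) (D.φ j b)) * D.p n +
      D.ι (D.φ i (D.φ j b)) := by
    rw [mul_assoc, p_mul_ι', mul_add, Finset.mul_sum]
    simp only [← mul_assoc, p_mul_ι', add_mul, Finset.sum_mul, Finset.sum_add_distrib, map_add,
      convL_convL]
    rw [Finset.sum_comm]
    abel
  have h1 := fun n => D.linear_coeff_eq i j n b (K₁ n) (hK₁ n)
  have h0 := D.constant_coeff_eq i j b τ' hτ K₀ hK₀
  have hKR : ∑ t, ∑ z, D.R (i, j) (t, z) • (∑ n, D.ι (K₁ n t z) * D.p n + D.ι (K₀ t z)) =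
      ∑ n, D.ι (∑ t, ∑ z, D.R (i, j) (t, z) • K₁ n t z) * D.p n +
      D.ι (∑ t, ∑ z, D.R (i, j) (t, z) • K₀ t z) := by
    simp only [smul_add, Finset.sum_add_distrib, map_sum, map_smul, Finset.sum_mul,
      Finset.smul_sum, smul_mul_assoc]
    congr 1
    exact sum_rotate _
  have hquad : ∑ m, ∑ n, D.ι (convL (conv (D.f j n) (D.f i m)) b) * D.quad T m n =
      ∑ m, ∑ n, D.ι (convL (conv (D.f j n) (D.f i m)) b) * (D.p m * D.p n) -
      ∑ n, D.ι (∑ t, ∑ z, D.Z (z, t) n • convL (conv (D.f j t) (D.f i z)) b) * D.p n +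
      D.ι (∑ m, ∑ n, convL (conv (D.f j n) (D.f i m)) b *
        (algebraMap ℂ A (T (m, n)) - ∑ k, ∑ l, T (k, l) • (D.Λ m k * D.Λ n l))) := by
    have e : ∀ c : ℂ, D.ι (algebraMap ℂ A c) = algebraMap ℂ D.Tilde c :=
      fun c => AlgHom.commutes D.ιAlg c
    have e1 : ∑ n, D.ι (∑ t, ∑ z, D.Z (z, t) n • convL (conv (D.f j t) (D.f i z)) b) * D.p n =
        ∑ m, ∑ n, D.ι (convL (conv (D.f j n) (D.f i m)) b) * ∑ s, D.Z (m, n) s • D.p s := by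
      simp only [map_sum, map_smul, Finset.sum_mul, Finset.mul_sum, smul_mul_assoc, mul_smul_comm]
      rw [← sum_rotate, Finset.sum_comm]
    rw [e1]
    simp only [quad, map_sum, map_smul, map_mul, map_sub, mul_sub, mul_add,
      Finset.sum_sub_distrib, Finset.sum_add_distrib, e]
    abel
  have hφ : D.φ i (D.φ j b) = ∑ s, D.Z (i, j) s • D.φ s b +
      (convL (τ' i j) b - ∑ s, ∑ t, D.Λ i s * D.Λ j t * convR (τ' s t) b +
        (K₀ i j + ∑ t, ∑ z, D.R (i, j) (t, z) • K₀ t z)) := by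
    rw [← h0]; abel
  have hlin : ∀ n, D.φ i (convL (D.f j n) b) + convL (D.f i n) (D.φ j b) =
      ∑ s, D.Z (i, j) s • convL (D.f s n) b -
        ∑ t, ∑ z, D.Z (z, t) n • convL (conv (D.f j t) (D.f i z)) b +
      (K₁ n i j + ∑ t, ∑ z, D.R (i, j) (t, z) • K₁ n t z) := by
    intro n
    rw [← h1]; abel
  have hZ : (∑ s, D.Z (i, j) s • D.p s) * D.ι b =
      ∑ n, D.ι (∑ s, D.Z (i, j) s • convL (D.f s n) b) * D.p n +
      D.ι (∑ s, D.Z (i, j) s • D.φ s b) := by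
    simp only [Finset.sum_mul, smul_mul_assoc, p_mul_ι', smul_add, Finset.sum_add_distrib,
      map_sum, map_smul, Finset.smul_sum]
    rw [Finset.sum_comm]
  have hT : (∑ m, ∑ n, T (m, n) • D.ι (D.Λ i m * D.Λ j n)) * D.ι b =
      D.ι (∑ m, ∑ n, T (m, n) • (D.Λ i m * D.Λ j n * b)) := by
    simp only [Finset.sum_mul, smul_mul_assoc, map_sum, map_smul, map_mul]
  rw [hquad, hKR, D.omega_eq T i j b τ' hτ, quad, sub_mul, add_mul, sub_mul, hpp, hZ, hT, hφ,
    ← Algebra.smul_def]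
  simp only [hlin, map_add, map_sub, add_mul, sub_mul, Finset.sum_add_distrib,
    Finset.sum_sub_distrib, map_smul]
  abel

end InhomData
end InhomQG

namespace InhomQG
namespace InhomData

variable {A I : Type*} [Ring A] [Bialgebra ℂ A] [Fintype I] [DecidableEq I] (D : InhomData A I)

/-! ### The cubic overlap of the quadratic elements -/

lemma sum_smul_vecMul {ν μ M : Type*} [Fintype ν] [Fintype μ] [AddCommMonoid M] [Module ℂ M]
    (y : ν → ℂ) (X : Matrix ν μ ℂ) (G : μ → M) :
    ∑ a, y a • ∑ b, X a b • G b = ∑ b, (y ᵥ* X) b • G b := by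
  simp only [Finset.smul_sum, Matrix.vecMul, dotProduct, Finset.sum_smul, smul_smul]
  exact Finset.sum_comm

lemma R₁₂_smul {M : Type*} [AddCommMonoid M] [Module ℂ M] (G : I × I × I → M) (i j k : I) :
    ∑ x, D.R₁₂ (i, j, k) x • G x = ∑ a, ∑ b, D.R (i, j) (a, b) • G (a, b, k) := by
  simp [Fintype.sum_prod_type, R₁₂_apply]

lemma R₂₃_smul {M : Type*} [AddCommMonoid M] [Module ℂ M] (G : I × I × I → M) (i j k : I) :
    ∑ x, D.R₂₃ (i, j, k) x • G x = ∑ a, ∑ b, D.R (j, k) (a, b) • G (i, a, b) := by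
  simp only [Fintype.sum_prod_type, R₂₃_apply]
  rw [Finset.sum_eq_single i]
  · simp
  · intro b _ hb; simp [Ne.symm hb]
  · simp

lemma tensOne_smul {κ M : Type*} [Fintype κ] [AddCommMonoid M] [Module ℂ M]
    (X : Matrix (I × I) κ ℂ) (G : κ × I → M) (i j k : I) :
    ∑ x, tensOne X (i, j, k) x • G x = ∑ a, X (i, j) a • G (a, k) := by
  simp [Fintype.sum_prod_type, tensOne, Matrix.one_apply]

lemma oneTens_smul {κ M : Type*} [Fintype κ] [AddCommMonoid M] [Module ℂ M]
    (X : Matrix (I × I) κ ℂ) (G : I × κ → M) (i j k : I) :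
    ∑ x, oneTens X (i, j, k) x • G x = ∑ a, X (j, k) a • G (i, a) := by
  simp only [Fintype.sum_prod_type, oneTens, Matrix.of_apply, Matrix.one_apply]
  rw [Finset.sum_eq_single i]
  · simp
  · intro b _ hb; simp [Ne.symm hb]
  · simp

lemma F_apply (T : I × I → ℂ) (i j k l : I) : D.F T (i, j, k) l =
    ∑ s, D.Z (j, k) s * D.Z (i, s) l - ∑ s, D.Z (i, j) s * D.Z (s, k) l +
    (if k = l then T (i, j) else 0) -
    ∑ w, ∑ n, D.R (j, k) (w, n) * ∑ m, D.R (i, w) (l, m) * T (m, n) := by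
  simp only [F, Matrix.of_apply, τ_eq, LinearMap.sub_apply, LinearMap.add_apply,
    LinearMap.sum_apply, LinearMap.smul_apply, smul_eq_mul, conv_rep, f_Λ, η_Λ, D.isRep.counit]
  congr 1
  · simp
  · simp only [Finset.mul_sum]
    rw [sum_rotate]
    refine Finset.sum_congr rfl fun w _ => ?_
    rw [Finset.sum_comm]
    refine Finset.sum_congr rfl fun n _ => Finset.sum_congr rfl fun m _ => ?_
    ring

/-- `(Λ ⊤ Λ) T`, the coboundary part of the quadratic elements. -/
def ΛΛT (T : I × I → ℂ) (i j : I) : A := ∑ m, ∑ n, T (m, n) • (D.Λ i m * D.Λ j n)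

lemma quad_eq (T : I × I → ℂ) (i j : I) : D.quad T i j =
    D.p i * D.p j - ∑ s, D.Z (i, j) s • D.p s + algebraMap ℂ D.Tilde (T (i, j)) -
      D.ι (D.ΛΛT T i j) := by
  simp only [quad, ΛΛT, map_sum, map_smul]

/-- `(Λ ⊤ Λ ⊤ Λ) u`. -/
def ΛΛΛvec (u : I × I × I → ℂ) (i j k : I) : A :=
  ∑ a, ∑ b, ∑ c, u (a, b, c) • (D.Λ i a * D.Λ j b * D.Λ k c)

lemma convL_f_ΛΛT (T : I × I → ℂ) (i j k l : I) : convL (D.f i l) (D.ΛΛT T j k) =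
    ∑ a, ∑ z, D.R (i, j) (a, z) • ∑ b, D.R (z, k) (b, l) • D.ΛΛT T a b := by
  have h : ∀ m n, convL (D.f i l) (D.Λ j m * D.Λ k n) =
      ∑ a, ∑ z, D.R (i, j) (a, z) • ∑ b, D.R (z, k) (b, l) • (D.Λ a m * D.Λ b n) := by
    intro m n
    simp only [convL_f_Λ_mul, convL_rep D.isRep, f_Λ, Finset.mul_sum, mul_smul_comm]
  simp only [ΛΛT, map_sum, map_smul, h]
  simp only [Finset.smul_sum]
  rw [sum_comm_pairs]
  refine Finset.sum_congr rfl fun a _ => Finset.sum_congr rfl fun z _ => ?_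
  rw [sum_rotate]
  refine Finset.sum_congr rfl fun b _ => Finset.sum_congr rfl fun m _ =>
    Finset.sum_congr rfl fun n _ => ?_
  simp only [smul_smul]
  congr 1
  ring

lemma tensOne_Z_mulVec (T : I × I → ℂ) (i j k : I) :
    (tensOne D.Z *ᵥ T) (i, j, k) = ∑ l, D.Z (i, j) l * T (l, k) :=
  tensOne_smul D.Z T i j k

lemma oneTens_Z_mulVec (T : I × I → ℂ) (i j k : I) :
    (oneTens D.Z *ᵥ T) (i, j, k) = ∑ l, D.Z (j, k) l * T (i, l) :=
  oneTens_smul D.Z T i j k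

lemma φ_ΛΛT (T : I × I → ℂ) (i j k : I) : D.φ i (D.ΛΛT T j k) =
    ∑ l, D.Z (i, j) l • D.ΛΛT T l k - D.ΛΛΛvec (tensOne D.Z *ᵥ T) i j k +
    ∑ a, ∑ z, D.R (i, j) (a, z) •
      (∑ l, D.Z (z, k) l • D.ΛΛT T a l - D.ΛΛΛvec (oneTens D.Z *ᵥ T) a z k) := by
  have h1 : ∀ a z, ∑ m, ∑ n, T (m, n) • (D.Λ a m * D.φ z (D.Λ k n)) =
      ∑ l, D.Z (z, k) l • D.ΛΛT T a l - D.ΛΛΛvec (oneTens D.Z *ᵥ T) a z k := by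
    intro a z
    simp only [φ_Λ, mul_sub, smul_sub, Finset.sum_sub_distrib, Finset.mul_sum, mul_smul_comm,
      ΛΛT, ΛΛΛvec, Finset.smul_sum, oneTens_Z_mulVec]
    congr 1
    · rw [sum_rotate]
      refine Finset.sum_congr rfl fun l _ => Finset.sum_congr rfl fun m _ =>
        Finset.sum_congr rfl fun n _ => ?_
      rw [smul_comm]
    · refine Finset.sum_congr rfl fun m _ => ?_
      rw [← sum_rotate]
      refine Finset.sum_congr rfl fun s _ => Finset.sum_congr rfl fun r _ => ?_
      simp only [Finset.sum_smul, smul_smul, mul_assoc]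
      refine Finset.sum_congr rfl fun n _ => ?_
      rw [mul_comm]
  have h2 : ∑ m, ∑ n, T (m, n) • (D.φ i (D.Λ j m) * D.Λ k n) =
      ∑ l, D.Z (i, j) l • D.ΛΛT T l k - D.ΛΛΛvec (tensOne D.Z *ᵥ T) i j k := by
    simp only [φ_Λ, sub_mul, smul_sub, Finset.sum_sub_distrib, Finset.sum_mul, smul_mul_assoc,
      ΛΛT, ΛΛΛvec, Finset.smul_sum, tensOne_Z_mulVec]
    congr 1
    · rw [sum_rotate]
      refine Finset.sum_congr rfl fun l _ => Finset.sum_congr rfl fun m _ =>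
        Finset.sum_congr rfl fun n _ => ?_
      rw [smul_comm]
    · rw [sum_comm_pairs]
      refine Finset.sum_congr rfl fun s _ => Finset.sum_congr rfl fun r _ => ?_
      rw [Finset.sum_comm]
      simp only [Finset.sum_smul, smul_smul]
      refine Finset.sum_congr rfl fun n _ => Finset.sum_congr rfl fun m _ => ?_
      rw [mul_comm]
  simp only [← h1, ← h2]
  simp only [ΛΛT, map_sum, map_smul, φ_Λ_mul, smul_add, Finset.sum_add_distrib]
  rw [add_comm]
  congr 1
  simp only [Finset.smul_sum]
  rw [sum_comm_pairs]
  refine Finset.sum_congr rfl fun a _ => Finset.sum_congr rfl fun z _ =>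
    Finset.sum_congr rfl fun m _ => Finset.sum_congr rfl fun n _ => ?_
  rw [smul_comm]

/-- The overlap `Q_ij p̃_k - p̃_i Q_jk`; the last lines collect the terms which drop out after
antisymmetrization. -/
lemma quad_mul_p_sub (T : I × I → ℂ) (i j k : I) :
    D.quad T i j * D.p k - D.p i * D.quad T j k =
      ∑ s, D.Z (j, k) s • D.quad T i s - ∑ s, D.Z (i, j) s • D.quad T s k +
      ∑ l, D.F T (i, j, k) l • D.p l +
      (∑ w, ∑ n, D.R (j, k) (w, n) • ∑ l, ∑ m, D.R (i, w) (l, m) • (T (m, n) • D.p l) -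
        T (j, k) • D.p i) +
      (∑ a, ∑ z, D.R (i, j) (a, z) • ∑ b, ∑ l, D.R (z, k) (b, l) • (D.ι (D.ΛΛT T a b) * D.p l) -
        D.ι (D.ΛΛT T i j) * D.p k) +
      D.ι (algebraMap ℂ A ((tensOne D.Z *ᵥ T) (i, j, k)) -
        algebraMap ℂ A ((oneTens D.Z *ᵥ T) (i, j, k)) -
        ∑ l, D.Z (i, j) l • D.ΛΛT T l k + ∑ l, D.Z (j, k) l • D.ΛΛT T i l +
        D.φ i (D.ΛΛT T j k)) := by
  have hι : ∀ c : ℂ, D.ι (algebraMap ℂ A c) = algebraMap ℂ D.Tilde c :=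
    fun c => AlgHom.commutes D.ιAlg c
  have hp : D.p i * D.ι (D.ΛΛT T j k) =
      ∑ a, ∑ z, D.R (i, j) (a, z) • ∑ b, ∑ l, D.R (z, k) (b, l) • (D.ι (D.ΛΛT T a b) * D.p l) +
      D.ι (D.φ i (D.ΛΛT T j k)) := by
    rw [p_mul_ι']
    congr 1
    simp only [convL_f_ΛΛT, map_sum, map_smul, Finset.sum_mul, smul_mul_assoc, Finset.smul_sum]
    rw [Finset.sum_comm]
    refine Finset.sum_congr rfl fun a _ => ?_
    rw [Finset.sum_comm]
    exact Finset.sum_congr rfl fun z _ => Finset.sum_comm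
  have hF : ∑ l, D.F T (i, j, k) l • D.p l =
      ∑ s, ∑ l, (D.Z (j, k) s * D.Z (i, s) l) • D.p l -
      ∑ s, ∑ l, (D.Z (i, j) s * D.Z (s, k) l) • D.p l + T (i, j) • D.p k -
      ∑ w, ∑ n, D.R (j, k) (w, n) • ∑ l, ∑ m, D.R (i, w) (l, m) • (T (m, n) • D.p l) := by
    simp only [F_apply, sub_smul, add_smul, Finset.sum_sub_distrib, Finset.sum_add_distrib,
      ite_smul, zero_smul, Finset.sum_ite_eq, Finset.mem_univ, if_true]
    congr 1
    · congr 2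
      · simp only [Finset.sum_smul]
        exact Finset.sum_comm
      · simp only [Finset.sum_smul]
        exact Finset.sum_comm
    · simp only [Finset.sum_smul, Finset.smul_sum, smul_smul, Finset.mul_sum]
      rw [Finset.sum_comm]
      refine Finset.sum_congr rfl fun w _ => ?_
      exact Finset.sum_comm
  have hT1 : algebraMap ℂ A ((tensOne D.Z *ᵥ T) (i, j, k)) =
      ∑ s, D.Z (i, j) s • algebraMap ℂ A (T (s, k)) := by
    simp [tensOne_Z_mulVec, Algebra.smul_def]
  have hT2 : algebraMap ℂ A ((oneTens D.Z *ᵥ T) (i, j, k)) =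
      ∑ s, D.Z (j, k) s • algebraMap ℂ A (T (i, s)) := by
    simp [oneTens_Z_mulVec, Algebra.smul_def]
  rw [hF, hT1, hT2]
  simp only [quad_eq, sub_mul, add_mul, mul_sub, mul_add, hp, map_sub, map_add, map_sum, map_smul,
    smul_sub, smul_add, Finset.sum_sub_distrib, Finset.sum_add_distrib, hι, Finset.sum_mul,
    Finset.mul_sum, smul_mul_assoc, mul_smul_comm, Finset.smul_sum, smul_smul,
    ← Algebra.smul_def, ← Algebra.commutes (R := ℂ) (A := D.Tilde), mul_assoc]
  abel

lemma ΛΛΛvec_sub (u v : I × I × I → ℂ) (i j k : I) :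
    D.ΛΛΛvec (u - v) i j k = D.ΛΛΛvec u i j k - D.ΛΛΛvec v i j k := by
  simp only [ΛΛΛvec, Pi.sub_apply, sub_smul, Finset.sum_sub_distrib]

section contraction

variable {M : Type*} [AddCommGroup M] [Module ℂ M] (y : I × I × I → ℂ)

lemma sum_smul_R₁₂ (h : y ᵥ* D.R₁₂ = -y) (G : I → I → I → M) :
    ∑ x : I × I × I, y x • ∑ a, ∑ b, D.R (x.1, x.2.1) (a, b) • G a b x.2.2 =
      -∑ x, y x • G x.1 x.2.1 x.2.2 := by
  have h' := sum_smul_vecMul y D.R₁₂ fun x => G x.1 x.2.1 x.2.2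
  rw [h] at h'
  simpa [R₁₂_smul] using h'

lemma sum_smul_R₂₃ (h : y ᵥ* D.R₂₃ = -y) (G : I → I → I → M) :
    ∑ x : I × I × I, y x • ∑ a, ∑ b, D.R (x.2.1, x.2.2) (a, b) • G x.1 a b =
      -∑ x, y x • G x.1 x.2.1 x.2.2 := by
  have h' := sum_smul_vecMul y D.R₂₃ fun x => G x.1 x.2.1 x.2.2
  rw [h] at h'
  simpa [R₂₃_smul] using h'

lemma sum_smul_Z₁₂ (G : I → I → M) :
    ∑ x : I × I × I, y x • ∑ a, D.Z (x.1, x.2.1) a • G a x.2.2 =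
      ∑ x, (y ᵥ* tensOne D.Z) x • G x.1 x.2 := by
  rw [← sum_smul_vecMul]
  exact Finset.sum_congr rfl fun x _ => by rw [tensOne_smul]

lemma sum_smul_Z₂₃ (G : I → I → M) :
    ∑ x : I × I × I, y x • ∑ a, D.Z (x.2.1, x.2.2) a • G x.1 a =
      ∑ x, (y ᵥ* oneTens D.Z) x • G x.1 x.2 := by
  rw [← sum_smul_vecMul]
  exact Finset.sum_congr rfl fun x _ => by rw [oneTens_smul]

end contraction

/-- The overlap `Q_ij p̃_k - p̃_i Q_jk`, contracted with a row `y` that is antisymmetric in all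
three indices: it is reduced by the quadratic elements to a remainder of degree at most one. -/
lemma antisymm_overlap (T : I × I → ℂ) (y : I × I × I → ℂ) (h₁ : y ᵥ* D.R₁₂ = -y)
    (h₂ : y ᵥ* D.R₂₃ = -y) :
    ∑ x : I × I × I, y x • (D.quad T x.1 x.2.1 * D.p x.2.2 - D.p x.1 * D.quad T x.2.1 x.2.2) =
      ∑ x : I × I, (y ᵥ* (oneTens D.Z - tensOne D.Z)) x • D.quad T x.1 x.2 +
      ∑ l, (y ᵥ* D.F T) l • D.p l +
      D.ι (∑ x : I × I × I, y x •
        (algebraMap ℂ A (((tensOne D.Z - oneTens D.Z) *ᵥ T) x) -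
          D.ΛΛΛvec ((tensOne D.Z - oneTens D.Z) *ᵥ T) x.1 x.2.1 x.2.2)) := by
  have e₁ := D.sum_smul_R₂₃ y h₂
    (fun i w n => ∑ l, ∑ m, D.R (i, w) (l, m) • (T (m, n) • D.p l))
  rw [D.sum_smul_R₁₂ y h₁ (fun l m n => T (m, n) • D.p l), neg_neg] at e₁
  have e₂ := D.sum_smul_R₁₂ y h₁
    (fun a z k => ∑ b, ∑ l, D.R (z, k) (b, l) • (D.ι (D.ΛΛT T a b) * D.p l))
  rw [D.sum_smul_R₂₃ y h₂ (fun a b l => D.ι (D.ΛΛT T a b) * D.p l), neg_neg] at e₂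
  have e₃ := D.sum_smul_R₁₂ y h₁ (fun a z k =>
    ∑ l, D.Z (z, k) l • D.ΛΛT T a l - D.ΛΛΛvec (oneTens D.Z *ᵥ T) a z k)
  have e₄ := sum_smul_vecMul y (D.F T) D.p
  simp only [quad_mul_p_sub, smul_add, smul_sub, Finset.sum_add_distrib, Finset.sum_sub_distrib]
  rw [e₁, e₂, e₄, D.sum_smul_Z₁₂, D.sum_smul_Z₂₃, Matrix.vecMul_sub]
  simp only [sub_self, add_zero, Pi.sub_apply, sub_smul, Finset.sum_sub_distrib]
  congr 1
  simp only [← map_smul, ← map_sum]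
  congr 1
  simp only [φ_ΛΛT, smul_add, smul_sub, Finset.sum_add_distrib, Finset.sum_sub_distrib,
    Matrix.sub_mulVec, Pi.sub_apply, map_sub, ΛΛΛvec_sub] at e₃ ⊢
  rw [e₃]
  abel

end InhomData
end InhomQG

namespace InhomQG

/-! ### Symmetrizers for the Coxeter relations of type `A` -/

section Symmetrizer

variable {E : Type*} [Ring E] (s : ℕ → E)

/-- `1 + s_{n-1} + s_{n-1} s_{n-2} + ⋯ + s_{n-1} ⋯ s_0`, the sum over the minimal coset
representatives of `S_n` in `S_{n+1}`. -/
def cosetSum : ℕ → E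
  | 0 => 1
  | n + 1 => 1 + s n * cosetSum n

/-- The Coxeter relations of type `A` for `s_0, …, s_{n-1}`: involutivity, the braid relation for
neighbours and commutation of distant generators. -/
structure CoxeterRel (n : ℕ) : Prop where
  sq : ∀ i, i < n → s i * s i = 1
  braid : ∀ i, i + 1 < n → s i * s (i + 1) * s i = s (i + 1) * s i * s (i + 1)
  comm : ∀ i j, i + 2 ≤ j → j < n → s i * s j = s j * s i

variable {s}

lemma CoxeterRel.mono {m n : ℕ} (h : CoxeterRel s n) (hmn : m ≤ n) : CoxeterRel s m :=
  ⟨fun i hi => h.sq i (by omega), fun i hi => h.braid i (by omega),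
    fun i j hij hj => h.comm i j hij (by omega)⟩

lemma cosetSum_comm {n m k : ℕ} (h : CoxeterRel s k) (hk : m < k) (hn : n < m) :
    cosetSum s n * s m = s m * cosetSum s n := by
  induction n with
  | zero => simp [cosetSum]
  | succ n ih =>
    rw [cosetSum, add_mul, mul_add, one_mul, mul_one, mul_assoc, ih (by omega), ← mul_assoc,
      h.comm n m (by omega) hk, mul_assoc]

/-- If `x` absorbs `s_0, …, s_{n-1}` from the right, then `x (1 + s_n + s_n s_{n-1} + ⋯)` absorbs
`s_0, …, s_n`. -/
lemma mul_cosetSum_mul (n : ℕ) (h : CoxeterRel s (n + 1)) (x : E)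
    (hx : ∀ i < n, x * s i = x) (j : ℕ) (hj : j ≤ n) :
    x * cosetSum s (n + 1) * s j = x * cosetSum s (n + 1) := by
  induction n generalizing x j with
  | zero =>
    obtain rfl : j = 0 := by omega
    have := h.sq 0 (by omega)
    simp only [cosetSum, mul_one, mul_add, add_mul, mul_assoc, this]
    abel
  | succ n ih =>
    rcases Nat.lt_or_ge j (n + 1) with hj' | hj'
    · have hc : ∀ i < n, x * s (n + 1) * s i = x * s (n + 1) := by
        intro i hi
        rw [mul_assoc, ← h.comm i (n + 1) (by omega) (by omega), ← mul_assoc, hx i (by omega)]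
      have := ih (h.mono (by omega)) (x * s (n + 1)) hc j (by omega)
      rw [cosetSum, mul_add, mul_one, add_mul, hx j hj', ← mul_assoc, this]
    · obtain rfl : j = n + 1 := by omega
      have h1 : cosetSum s n * s (n + 1) = s (n + 1) * cosetSum s n :=
        cosetSum_comm h (by omega) (by omega)
      have h2 := h.sq (n + 1) (by omega)
      have h3 : x * (s (n + 1) * (s n * s (n + 1))) = x * (s (n + 1) * s n) := by
        rw [← mul_assoc (s (n + 1)), ← h.braid n (by omega), ← mul_assoc, ← mul_assoc,
          hx n (by omega), mul_assoc]
      have h3' : x * s (n + 1) * s n * s (n + 1) = x * s (n + 1) * s n := by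
        simpa only [mul_assoc] using h3
      simp only [cosetSum, mul_add, mul_one, add_mul, ← mul_assoc]
      rw [mul_assoc _ (cosetSum s n) (s (n + 1)), h1, ← mul_assoc, h3', mul_assoc x, h2, mul_one]
      abel

variable [Algebra ℂ E]

variable (s) in
/-- The symmetrizer of the group generated by `s_0, …, s_{n-1}`, as a product of coset sums; it is
normalized by the numbers of cosets so as to fix the vectors fixed by all the `s_i`. -/
def symmetrizer : ℕ → E
  | 0 => 1
  | n + 1 => ((n : ℂ) + 2)⁻¹ • (symmetrizer n * cosetSum s (n + 1))

lemma symmetrizer_mul {n : ℕ} (h : CoxeterRel s n) {j : ℕ} (hj : j < n) :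
    symmetrizer s n * s j = symmetrizer s n := by
  induction n generalizing j with
  | zero => omega
  | succ n ih =>
    rw [symmetrizer, smul_mul_assoc,
      mul_cosetSum_mul n h _ (fun i hi => ih (h.mono (by omega)) hi) j (by omega)]

end Symmetrizer

lemma symmetrizer_apply_of_fixed {V : Type*} [AddCommGroup V] [Module ℂ V]
    {s : ℕ → Module.End ℂ V} {n : ℕ} {x : V} (hx : ∀ i < n, s i x = x) :
    symmetrizer s n x = x := by
  have hc : ∀ m ≤ n, cosetSum s m x = ((m : ℂ) + 1) • x := by
    intro m
    induction m with
    | zero => simp [cosetSum]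
    | succ m ih =>
      intro hm
      simp only [cosetSum, LinearMap.add_apply, Module.End.one_apply, Module.End.mul_apply,
        ih (by omega), map_smul, hx m (by omega)]
      push_cast
      module
  have hs : ∀ m ≤ n, symmetrizer s m x = x := by
    intro m
    induction m with
    | zero => simp [symmetrizer]
    | succ m ih =>
      intro hm
      rw [symmetrizer, LinearMap.smul_apply, Module.End.mul_apply, hc _ hm, map_smul,
        ih (by omega), smul_smul]
      have : (m : ℂ) + 2 ≠ 0 := by exact_mod_cast (by omega : m + 2 ≠ 0)
      have e : ((m : ℂ) + 2)⁻¹ * (((m + 1 : ℕ) : ℂ) + 1) = 1 := by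
        push_cast
        field_simp
        ring
      rw [e, one_smul]
  exact hs n le_rfl

namespace InhomData

variable {A I : Type*} [Ring A] [Bialgebra ℂ A] [Fintype I] [DecidableEq I] (D : InhomData A I)

/-! ### The quadratic relations and the comultiplication -/

lemma comul_ι (a : A) : Coalgebra.comul (R := ℂ) (D.ι a) =
    Algebra.TensorProduct.map D.ιAlg D.ιAlg (Coalgebra.comul (R := ℂ) a) :=
  D.comulTilde_ι a

lemma comul_p (i : I) : Coalgebra.comul (R := ℂ) (D.p i) =
    ∑ t, D.ι (D.Λ i t) ⊗ₜ[ℂ] D.p t + D.p i ⊗ₜ[ℂ] 1 :=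
  D.comulTilde_p i

lemma comul_ι_Λ (i j : I) : Coalgebra.comul (R := ℂ) (D.ι (D.Λ i j)) =
    ∑ k, D.ι (D.Λ i k) ⊗ₜ[ℂ] D.ι (D.Λ k j) := by
  rw [comul_ι, D.isRep.comul, map_sum]
  rfl

/-- The comultiplication of `Q_ij`, up to the image of `1 + R`. -/
lemma comul_quad (T : I × I → ℂ) : ∃ Y : I → I → D.Tilde ⊗[ℂ] D.Tilde, ∀ i j,
    Coalgebra.comul (R := ℂ) (D.quad T i j) =
      ∑ m, ∑ n, D.ι (D.Λ i m * D.Λ j n) ⊗ₜ[ℂ] D.quad T m n + D.quad T i j ⊗ₜ[ℂ] 1 +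
      (Y i j + ∑ t, ∑ z, D.R (i, j) (t, z) • Y t z) := by
  refine ⟨fun i j => ∑ s, (D.ι (D.Λ i s) * D.p j) ⊗ₜ[ℂ] D.p s, fun i j => ?_⟩
  have h1 : ∑ t, (D.p i * D.ι (D.Λ j t)) ⊗ₜ[ℂ] D.p t =
      ∑ t, ∑ z, D.R (i, j) (t, z) • ∑ s, (D.ι (D.Λ t s) * D.p z) ⊗ₜ[ℂ] D.p s +
      ∑ l, D.Z (i, j) l • ∑ t, D.ι (D.Λ l t) ⊗ₜ[ℂ] D.p t -
      ∑ m, ∑ n, D.ι (D.Λ i m * D.Λ j n) ⊗ₜ[ℂ] ∑ s, D.Z (m, n) s • D.p s := by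
    simp only [p_mul_ι', convL_rep D.isRep, f_Λ, φ_Λ, map_sub, map_sum, map_smul, Finset.sum_mul,
      smul_mul_assoc, TensorProduct.add_tmul, TensorProduct.sub_tmul, TensorProduct.sum_tmul,
      TensorProduct.smul_tmul', TensorProduct.tmul_sum, TensorProduct.tmul_smul,
      Finset.sum_add_distrib, Finset.sum_sub_distrib, Finset.smul_sum]
    rw [← add_sub_assoc]
    congr 1
    · congr 1
      · rw [sum_rotate]
        exact Finset.sum_congr rfl fun _ _ => Finset.sum_comm
      · exact Finset.sum_comm
    · rw [← sum_rotate]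
  have h2 : Coalgebra.comul (R := ℂ) (D.p i * D.p j) =
      ∑ m, ∑ n, D.ι (D.Λ i m * D.Λ j n) ⊗ₜ[ℂ] (D.p m * D.p n) +
      ∑ s, (D.ι (D.Λ i s) * D.p j) ⊗ₜ[ℂ] D.p s + ∑ t, (D.p i * D.ι (D.Λ j t)) ⊗ₜ[ℂ] D.p t +
      (D.p i * D.p j) ⊗ₜ[ℂ] 1 := by
    rw [Bialgebra.comul_mul, comul_p, comul_p]
    simp only [add_mul, mul_add, Finset.sum_mul, Finset.mul_sum,
      Algebra.TensorProduct.tmul_mul_tmul, one_mul, mul_one, map_mul, Finset.sum_add_distrib]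
    rw [Finset.sum_comm]
    abel
  have h3 : Coalgebra.comul (R := ℂ) (D.ι (D.ΛΛT T i j)) =
      ∑ m, ∑ n, D.ι (D.Λ i m * D.Λ j n) ⊗ₜ[ℂ] D.ι (D.ΛΛT T m n) := by
    simp only [ΛΛT, map_sum, map_smul, map_mul, Bialgebra.comul_mul, comul_ι_Λ,
      Finset.sum_mul_sum, Algebra.TensorProduct.tmul_mul_tmul, TensorProduct.tmul_sum,
      TensorProduct.tmul_smul, Finset.smul_sum]
    rw [sum_comm_pairs]
  have h4 : D.ι (D.ΛΛT T i j) ⊗ₜ[ℂ] (1 : D.Tilde) =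
      ∑ m, ∑ n, D.ι (D.Λ i m * D.Λ j n) ⊗ₜ[ℂ] algebraMap ℂ D.Tilde (T (m, n)) := by
    simp [ΛΛT, TensorProduct.sum_tmul, Algebra.algebraMap_eq_smul_one, TensorProduct.smul_tmul']
  simp only [quad_eq, map_sub, map_add, map_sum, map_smul, h2, h3, comul_p, smul_add,
    Finset.sum_add_distrib, TensorProduct.tmul_sub, TensorProduct.tmul_add,
    TensorProduct.sub_tmul, TensorProduct.add_tmul, Finset.sum_sub_distrib, ← h4, h1,
    Bialgebra.comul_algebraMap, TensorProduct.sum_tmul, TensorProduct.smul_tmul']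
  simp only [Algebra.TensorProduct.algebraMap_apply]
  abel

end InhomData
end InhomQG

namespace InhomQG
namespace InhomData

variable {A I : Type*} [Ring A] [Bialgebra ℂ A] [Fintype I] [DecidableEq I] (D : InhomData A I)

/-! ### The elements `s_kl` and the filtration of the ideal they generate -/

section involutive

variable {M : Type*} [AddCommGroup M] [Module ℂ M]

/-- `R - 1` annihilates the image of `1 + R`, as `R² = 1`. -/
lemma sum_R_sub_one_smul_eq_zero (hR : D.R * D.R = 1) (K : I → I → M) (k l : I) :
    ∑ i, ∑ j, (D.R - 1) (k, l) (i, j) • (K i j + ∑ t, ∑ z, D.R (i, j) (t, z) • K t z) = 0 := by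
  have h := sum_smul_vecMul ((D.R - 1) (k, l)) (1 + D.R) fun x => K x.1 x.2
  have h0 : (D.R - 1) (k, l) ᵥ* (1 + D.R) = 0 := by
    have : (D.R - 1) * (1 + D.R) = 0 := by
      rw [sub_mul, mul_add, hR, one_mul, mul_one]; abel
    exact congrFun this (k, l)
  rw [h0] at h
  simp only [Matrix.add_apply, add_smul, Finset.sum_add_distrib, Pi.zero_apply, zero_smul,
    Finset.sum_const_zero, Matrix.one_apply, ite_smul, one_smul, Finset.sum_ite_eq,
    Finset.mem_univ, if_true] at h
  rw [← Fintype.sum_prod_type'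
    (f := fun i j => (D.R - 1) (k, l) (i, j) • (K i j + ∑ t, ∑ z, D.R (i, j) (t, z) • K t z))]
  rw [← h]
  refine Finset.sum_congr rfl fun x _ => ?_
  rw [Fintype.sum_prod_type]

/-- An antisymmetric row is a combination of the rows of `R - 1`. -/
lemma sum_antisymm_smul (y : I × I → ℂ) (hy : y ᵥ* D.R = -y)
    (G : I × I → M) :
    ∑ x, y x • G x = ∑ x, (-(1 / 2 : ℂ) * y x) • ∑ z, (D.R - 1) x z • G z := by
  have h := sum_smul_vecMul y (D.R - 1) G
  rw [Matrix.vecMul_sub, Matrix.vecMul_one, hy] at h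
  simp only [mul_smul, ← Finset.smul_sum, h, Pi.sub_apply, Pi.neg_apply]
  rw [Finset.smul_sum]
  refine Finset.sum_congr rfl fun x _ => ?_
  module

end involutive

lemma sum_antisymm_smul_quad (T : I × I → ℂ) (y : I × I → ℂ)
    (hy : y ᵥ* D.R = -y) : ∑ x, y x • D.quad T x.1 x.2 =
      ∑ x, (-(1 / 2 : ℂ) * y x) • D.s T x := by
  rw [D.sum_antisymm_smul y hy]
  rfl

/-- The terms of degree at most one in `Q_ij`. -/
def quadTail (T : I × I → ℂ) (i j : I) : D.Tilde := D.quad T i j - D.p i * D.p j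

lemma quadTail_mem (T : I × I → ℂ) (i j : I) : D.quadTail T i j ∈ D.filt 1 := by
  rw [quadTail, quad_eq]
  have h1 : ∑ s, D.Z (i, j) s • D.p s ∈ D.filt 1 :=
    sum_mem fun s _ => Submodule.smul_mem _ _ (D.p_mem_filt s le_rfl)
  have h2 : algebraMap ℂ D.Tilde (T (i, j)) ∈ D.filt 1 := by
    rw [← AlgHom.commutes D.ιAlg]
    exact D.ι_mem_filt _ 1
  have e : D.p i * D.p j - ∑ s, D.Z (i, j) s • D.p s + algebraMap ℂ D.Tilde (T (i, j)) -
      D.ι (D.ΛΛT T i j) - D.p i * D.p j =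
      -∑ s, D.Z (i, j) s • D.p s + algebraMap ℂ D.Tilde (T (i, j)) - D.ι (D.ΛΛT T i j) := by
    abel
  rw [e]
  exact sub_mem (add_mem (neg_mem h1) h2) (D.ι_mem_filt _ 1)

/-- The terms of degree at most one in `s_kl`. -/
def sTail (T : I × I → ℂ) (k l : I) : D.Tilde :=
  ∑ x : I × I, (D.R - 1) (k, l) x • D.quadTail T x.1 x.2

lemma sTail_mem (T : I × I → ℂ) (k l : I) : D.sTail T k l ∈ D.filt 1 :=
  sum_mem fun _ _ => Submodule.smul_mem _ _ (D.quadTail_mem T _ _)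

lemma p_mul_p_add_s (T : I × I → ℂ) (k l : I) : D.p k * D.p l + D.s T (k, l) =
    ∑ x : I × I, D.R (k, l) x • (D.p x.1 * D.p x.2) + D.sTail T k l := by
  have h : D.s T (k, l) = ∑ x : I × I, (D.R - 1) (k, l) x • (D.p x.1 * D.p x.2) +
      D.sTail T k l := by
    rw [sTail, ← Finset.sum_add_distrib]
    refine Finset.sum_congr rfl fun x _ => ?_
    rw [← smul_add, quadTail, add_sub_cancel]
    rfl
  rw [h, ← add_assoc]
  simp [sub_smul, Matrix.one_apply, ite_smul]

lemma s_mem_filt (T : I × I → ℂ) (kl : I × I) : D.s T kl ∈ D.filt 2 := by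
  have h := D.p_mul_p_add_s T kl.1 kl.2
  have hpp : ∀ i j, D.p i * D.p j ∈ D.filt 2 := fun i j =>
    D.mul_mem_filt (D.p_mem_filt i le_rfl) (D.p_mem_filt j le_rfl) (by norm_num)
  have e : D.s T kl = ∑ x : I × I, D.R (kl.1, kl.2) x • (D.p x.1 * D.p x.2) +
      D.sTail T kl.1 kl.2 - D.p kl.1 * D.p kl.2 := by
    rw [← h]; simp
  rw [e]
  exact sub_mem (add_mem (sum_mem fun x _ => Submodule.smul_mem _ _ (hpp _ _))
    (D.filt_mono one_le_two (D.sTail_mem T _ _))) (hpp _ _)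

/-- Right multiplication of `s_kl` by `b ∈ A`. -/
lemma s_mul_ι (hR : D.R * D.R = 1) (T : I × I → ℂ) (k l : I) (b : A) : D.s T (k, l) * D.ι b =
    ∑ m, ∑ n, D.ι (convL (conv (D.f l n) (D.f k m)) b) * D.s T (m, n) +
      D.ι (∑ i, ∑ j, (D.R - 1) (k, l) (i, j) • D.omega T i j b) := by
  obtain ⟨K, hK⟩ := D.quad_mul_ι T b
  have hC : ∀ r y, ∑ i, ∑ j, (D.R - 1) (k, l) (i, j) • convL (conv (D.f j y) (D.f i r)) b =
      ∑ z, ∑ t, (D.R - 1) (z, t) (r, y) • convL (conv (D.f l t) (D.f k z)) b := by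
    intro r y
    have h := D.convL_R_f_f k l r y b
    rw [Finset.sum_comm (f := fun t z => D.R (z, t) (r, y) • _)] at h
    simp only [Matrix.sub_apply, sub_smul, Finset.sum_sub_distrib, h]
    congr 1
    simp [Matrix.one_apply, Prod.mk.injEq, ite_and, ite_smul, Finset.sum_ite_irrel]
  have e1 : ∑ i, ∑ j, (D.R - 1) (k, l) (i, j) •
      ∑ m, ∑ n, D.ι (convL (conv (D.f j n) (D.f i m)) b) * D.quad T m n =
      ∑ m, ∑ n, D.ι (convL (conv (D.f l n) (D.f k m)) b) * D.s T (m, n) := by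
    simp only [s_eq, Finset.mul_sum, Finset.smul_sum, mul_smul_comm, ← smul_mul_assoc]
    rw [sum_comm_pairs]
    conv_rhs => rw [sum_comm_pairs]
    refine Finset.sum_congr rfl fun m _ => Finset.sum_congr rfl fun n _ => ?_
    simp only [← Finset.sum_mul, ← map_smul D.ι, ← map_sum, hC]
  rw [s_eq]
  simp only [Finset.sum_mul, smul_mul_assoc, hK]
  simp only [smul_add (_ : ℂ) (_ + _) (_ + _), Finset.sum_add_distrib]
  rw [D.sum_R_sub_one_smul_eq_zero hR, add_zero]
  simp only [smul_add, Finset.sum_add_distrib, e1, map_sum, map_smul]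

/-- The coproduct of `s_kl`. -/
lemma comul_s (hR : D.R * D.R = 1) (T : I × I → ℂ) (k l : I) :
    Coalgebra.comul (R := ℂ) (D.s T (k, l)) =
      ∑ m, ∑ n, D.ι (D.Λ k m * D.Λ l n) ⊗ₜ[ℂ] D.s T (m, n) + D.s T (k, l) ⊗ₜ[ℂ] 1 := by
  obtain ⟨Y, hY⟩ := D.comul_quad T
  have hC : ∀ r y, ∑ i, ∑ j, (D.R - 1) (k, l) (i, j) • (D.Λ i r * D.Λ j y) =
      ∑ m, ∑ n, (D.R - 1) (m, n) (r, y) • (D.Λ k m * D.Λ l n) := by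
    intro r y
    have h := D.R_ΛΛ_apply k l r y
    simp only [Matrix.sub_apply, sub_smul, Finset.sum_sub_distrib, h]
    congr 1
    simp [Matrix.one_apply, Prod.mk.injEq, ite_and, ite_smul, Finset.sum_ite_irrel]
  have e1 : ∑ i, ∑ j, (D.R - 1) (k, l) (i, j) •
      ∑ m, ∑ n, D.ι (D.Λ i m * D.Λ j n) ⊗ₜ[ℂ] D.quad T m n =
      ∑ m, ∑ n, D.ι (D.Λ k m * D.Λ l n) ⊗ₜ[ℂ] D.s T (m, n) := by
    simp only [s_eq, TensorProduct.tmul_sum, Finset.smul_sum, TensorProduct.tmul_smul,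
      TensorProduct.smul_tmul']
    rw [sum_comm_pairs]
    conv_rhs => rw [sum_comm_pairs]
    refine Finset.sum_congr rfl fun m _ => Finset.sum_congr rfl fun n _ => ?_
    simp only [← TensorProduct.sum_tmul, ← map_smul, ← map_sum, hC]
  rw [s_eq]
  simp only [map_sum, map_smul, hY]
  simp only [smul_add (_ : ℂ) (_ + _) (_ + _), Finset.sum_add_distrib]
  rw [D.sum_R_sub_one_smul_eq_zero hR, add_zero]
  simp only [smul_add, Finset.sum_add_distrib, e1, TensorProduct.sum_tmul,
    TensorProduct.smul_tmul']

/-- The part of degree at most `n` that is visible in the ideal generated by the `s_kl`: the span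
of the products `x s_kl y` with `deg x + deg y + 2 ≤ n`. -/
def jfilt (T : I × I → ℂ) (n : ℕ) : Submodule ℂ D.Tilde :=
  Submodule.span ℂ {z | ∃ (i j : ℕ) (x y : D.Tilde) (kl : I × I), i + j + 2 ≤ n ∧
    x ∈ D.filt i ∧ y ∈ D.filt j ∧ z = x * D.s T kl * y}

variable {D} {T : I × I → ℂ}

lemma mul_s_mul_mem_jfilt {i j n : ℕ} {x y : D.Tilde} (hx : x ∈ D.filt i) (hy : y ∈ D.filt j)
    (kl : I × I) (h : i + j + 2 ≤ n) : x * D.s T kl * y ∈ D.jfilt T n :=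
  Submodule.subset_span ⟨i, j, x, y, kl, h, hx, hy, rfl⟩

lemma s_mem_jfilt (kl : I × I) : D.s T kl ∈ D.jfilt T 2 := by
  simpa using mul_s_mul_mem_jfilt (T := T) (D.word_mem_filt [] (k := 0) le_rfl)
    (D.word_mem_filt [] (k := 0) le_rfl) kl le_rfl

lemma jfilt_mono {m n : ℕ} (h : m ≤ n) : D.jfilt T m ≤ D.jfilt T n :=
  Submodule.span_mono fun _ ⟨i, j, x, y, kl, hij, hx, hy, hz⟩ =>
    ⟨i, j, x, y, kl, hij.trans h, hx, hy, hz⟩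

lemma mul_mem_jfilt_left {m n k : ℕ} {x z : D.Tilde} (hx : x ∈ D.filt m) (hz : z ∈ D.jfilt T n)
    (h : m + n ≤ k) : x * z ∈ D.jfilt T k := by
  have : D.jfilt T n ≤ (D.jfilt T k).comap (LinearMap.mulLeft ℂ x) := by
    refine Submodule.span_le.2 ?_
    rintro _ ⟨i, j, u, v, kl, hij, hu, hv, rfl⟩
    simp only [SetLike.mem_coe, Submodule.mem_comap, LinearMap.mulLeft_apply, ← mul_assoc]
    exact mul_s_mul_mem_jfilt (D.mul_mem_filt hx hu le_rfl) hv kl (by omega)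
  exact this hz

lemma mul_mem_jfilt_right {m n k : ℕ} {x z : D.Tilde} (hz : z ∈ D.jfilt T n) (hx : x ∈ D.filt m)
    (h : n + m ≤ k) : z * x ∈ D.jfilt T k := by
  have : D.jfilt T n ≤ (D.jfilt T k).comap (LinearMap.mulRight ℂ x) := by
    refine Submodule.span_le.2 ?_
    rintro _ ⟨i, j, u, v, kl, hij, hu, hv, rfl⟩
    simp only [SetLike.mem_coe, Submodule.mem_comap, LinearMap.mulRight_apply, mul_assoc]
    rw [← mul_assoc]
    exact mul_s_mul_mem_jfilt hu (D.mul_mem_filt hv hx le_rfl) kl (by omega)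
  exact this hz

lemma jfilt_le_filt (n : ℕ) : D.jfilt T n ≤ D.filt n := by
  refine Submodule.span_le.2 ?_
  rintro _ ⟨i, j, u, v, kl, hij, hu, hv, rfl⟩
  exact D.mul_mem_filt (D.mul_mem_filt hu (D.s_mem_filt T kl) le_rfl) hv (by omega)

lemma jfilt_eq_bot {n : ℕ} (hn : n < 2) : D.jfilt T n = ⊥ := by
  rw [jfilt, Submodule.span_eq_bot]
  rintro _ ⟨i, j, u, v, kl, hij, hu, hv, rfl⟩
  omega

instance (T : I × I → ℂ) : (D.idealS T).IsTwoSided := by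
  unfold idealS
  infer_instance

lemma s_mem_idealS (kl : I × I) : D.s T kl ∈ D.idealS T :=
  TwoSidedIdeal.mem_asIdeal.2 (TwoSidedIdeal.subset_span ⟨kl, rfl⟩)

lemma idealS_le {J : Ideal D.Tilde} [J.IsTwoSided] (h : ∀ kl, D.s T kl ∈ J) : D.idealS T ≤ J := by
  intro x hx
  have : TwoSidedIdeal.span (Set.range (D.s T)) ≤ J.toTwoSided := by
    rw [TwoSidedIdeal.span_le]
    rintro _ ⟨kl, rfl⟩
    simpa using h kl
  simpa using this (TwoSidedIdeal.mem_asIdeal.1 hx)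

lemma jfilt_le_idealS (n : ℕ) : ∀ z ∈ D.jfilt T n, z ∈ D.idealS T := by
  have : D.jfilt T n ≤ (D.idealS T).restrictScalars ℂ := by
    refine Submodule.span_le.2 ?_
    rintro _ ⟨i, j, u, v, kl, hij, hu, hv, rfl⟩
    exact Ideal.mul_mem_right _ _ (Ideal.mul_mem_left _ _ (s_mem_idealS kl))
  exact this

lemma mem_idealS_iff {z : D.Tilde} : z ∈ D.idealS T ↔ ∃ n, z ∈ D.jfilt T n := by
  refine ⟨fun hz => ?_, fun ⟨n, hn⟩ => jfilt_le_idealS n z hn⟩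
  let K : Ideal D.Tilde :=
    { carrier := {z | ∃ n, z ∈ D.jfilt T n}
      add_mem' := by
        rintro x y ⟨k, hx⟩ ⟨l, hy⟩
        exact ⟨max k l, add_mem (jfilt_mono (le_max_left _ _) hx)
          (jfilt_mono (le_max_right _ _) hy)⟩
      zero_mem' := ⟨0, zero_mem _⟩
      smul_mem' := by
        rintro c x ⟨k, hx⟩
        obtain ⟨m, hm⟩ := D.exists_mem_filt c
        exact ⟨m + k, mul_mem_jfilt_left hm hx le_rfl⟩ }
  have : K.IsTwoSided := ⟨by
    rintro x c ⟨k, hx⟩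
    obtain ⟨m, hm⟩ := D.exists_mem_filt c
    exact ⟨k + m, mul_mem_jfilt_right hx hm le_rfl⟩⟩
  exact idealS_le (J := K) (fun kl => ⟨2, s_mem_jfilt kl⟩) hz

/-- If the `s_kl` span a right `A`-submodule modulo left multiplication by `A`, then the filtered
pieces of the ideal are spanned by the monomials in which one `s_kl` is inserted. -/
lemma jfilt_le_of_insert (hR : D.R * D.R = 1)
    (hΩ : ∀ k l b, ∑ i, ∑ j, (D.R - 1) (k, l) (i, j) • D.omega T i j b = 0) {n : ℕ}
    {N : Submodule ℂ D.Tilde}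
    (h : ∀ a u kl v, u.length + v.length + 2 ≤ n →
      D.ι a * (D.word u * D.s T kl * D.word v) ∈ N) : D.jfilt T n ≤ N := by
  have h1 : ∀ {i j : ℕ} {x : D.Tilde}, i + j + 2 ≤ n → x ∈ D.filt i →
      ∀ kl v, v.length ≤ j → x * D.s T kl * D.word v ∈ N := by
    intro i j x hij hx kl v hv
    have : D.filt i ≤ N.comap (LinearMap.mulRight ℂ (D.s T kl * D.word v)) := by
      refine D.filt_le fun a u hu => ?_
      have := h a u kl v (by omega)
      simpa only [Submodule.mem_comap, LinearMap.mulRight_apply, mul_assoc] using this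
    simpa only [Submodule.mem_comap, LinearMap.mulRight_apply, mul_assoc] using this hx
  refine Submodule.span_le.2 ?_
  rintro _ ⟨i, j, x, y, kl, hij, hx, hy, rfl⟩
  have : D.filt j ≤ N.comap (LinearMap.mulLeft ℂ (x * D.s T kl)) := by
    refine D.filt_le fun b v hv => ?_
    obtain ⟨k, l⟩ := kl
    have e : x * D.s T (k, l) * (D.ι b * D.word v) =
        ∑ m, ∑ n, x * D.ι (convL (conv (D.f l n) (D.f k m)) b) * D.s T (m, n) * D.word v := by
      rw [mul_assoc, ← mul_assoc _ (D.ι b), D.s_mul_ι hR, hΩ]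
      simp only [map_zero, add_zero, Finset.sum_mul, Finset.mul_sum, mul_assoc]
    rw [Submodule.mem_comap, LinearMap.mulLeft_apply, e]
    exact sum_mem fun m _ => sum_mem fun n _ =>
      h1 hij (D.mul_mem_filt hx (D.ι_mem_filt _ 0) (by omega)) _ v hv
  exact this hy

end InhomData
end InhomQG

namespace InhomQG

lemma exists_eq_append_cons_cons {I : Type*} {j : ℕ} {w : List I} (h : j + 2 ≤ w.length) :
    ∃ u k l v, w = u ++ k :: l :: v ∧ u.length = j := by
  have h1 : j < w.length := by omega
  have h2 : j + 1 < w.length := by omega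
  refine ⟨w.take j, w[j], w[j + 1], w.drop (j + 2), ?_, by simp; omega⟩
  rw [← List.drop_eq_getElem_cons h2, ← List.drop_eq_getElem_cons h1, List.take_append_drop]

namespace InhomData

variable {A I : Type*} [Ring A] [Bialgebra ℂ A] [Fintype I] [DecidableEq I] (D : InhomData A I)

/-! ### The Poincaré–Birkhoff–Witt property -/

/-- The correction `p̃_{w_1} ⋯ s_{w_{j+1} w_{j+2}} ⋯ p̃_{w_n}` of a word `w` of length `n` by the
relation at position `j`; zero for words of other lengths. -/
def swapTail (T : I × I → ℂ) (n j : ℕ) (w : List I) : D.Tilde :=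
  if w.length = n then
    match w.drop j with
    | k :: l :: v => D.word (w.take j) * D.s T (k, l) * D.word v
    | _ => 0
  else 0

/-- The transposition of the letters `j` and `j + 1` in the words of length `n`, by the relation
`p̃_k p̃_l ↦ p̃_k p̃_l + s_kl = R_{kl,mn} p̃_m p̃_n + ⋯`; words of other lengths are fixed. -/
def swap (T : I × I → ℂ) (n j : ℕ) : D.Tilde →ₗ[ℂ] D.Tilde :=
  D.wordLift fun w => LinearMap.mulRight ℂ (D.word w + D.swapTail T n j w) ∘ₗ D.ιAlg.toLinearMap

variable {D} {T : I × I → ℂ} {n : ℕ}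

lemma swap_ι_mul_word (j : ℕ) (a : A) (w : List I) :
    D.swap T n j (D.ι a * D.word w) = D.ι a * (D.word w + D.swapTail T n j w) := by
  rw [swap, wordLift_apply]
  rfl

lemma swap_ι_mul (j : ℕ) (a : A) (x : D.Tilde) :
    D.swap T n j (D.ι a * x) = D.ι a * D.swap T n j x := by
  induction x using D.word_induction with
  | h0 => simp
  | hadd x y hx hy => simp only [mul_add, map_add, hx, hy]
  | hw b w => rw [← mul_assoc, ← map_mul, swap_ι_mul_word, swap_ι_mul_word, map_mul, mul_assoc]

lemma swap_word_of_length_ne (j : ℕ) {w : List I} (hw : w.length ≠ n) :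
    D.swap T n j (D.word w) = D.word w := by
  have := D.swap_ι_mul_word (T := T) (n := n) j 1 w
  simpa [swapTail, hw] using this

lemma swap_of_mem_filt {m : ℕ} (hm : m < n) (j : ℕ) {x : D.Tilde} (hx : x ∈ D.filt m) :
    D.swap T n j x = x := by
  have : D.filt m ≤ LinearMap.eqLocus (D.swap T n j) LinearMap.id := by
    refine D.filt_le fun a w hw => ?_
    rw [LinearMap.mem_eqLocus, swap_ι_mul, swap_word_of_length_ne j (by omega)]
    rfl
  exact this hx

lemma swap_append {u v : List I} (h : u.length + v.length + 2 = n) (k l : I) :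
    D.swap T n u.length (D.word u * (D.p k * D.p l) * D.word v) =
      D.word u * (D.p k * D.p l + D.s T (k, l)) * D.word v := by
  have h1 := D.swap_ι_mul_word (T := T) (n := n) u.length 1 (u ++ k :: l :: v)
  have h2 : (u ++ k :: l :: v).length = n := by simp; omega
  rw [swapTail, if_pos h2] at h1
  simp only [map_one, one_mul, List.drop_left', List.take_left', word_append, word_cons] at h1
  simp only [mul_assoc, mul_add, add_mul] at h1 ⊢
  exact h1

lemma swap_append' {u v : List I} (h : u.length + v.length + 2 = n) (k l : I) :
    D.swap T n u.length (D.word u * (D.p k * D.p l) * D.word v) =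
      D.word u * (∑ x : I × I, D.R (k, l) x • (D.p x.1 * D.p x.2) + D.sTail T k l) * D.word v := by
  rw [swap_append h, p_mul_p_add_s]

lemma word_append_cons_cons (u : List I) (k l : I) (v : List I) :
    D.word (u ++ k :: l :: v) = D.word u * (D.p k * D.p l) * D.word v := by
  simp [mul_assoc]

lemma word_mul_mul_word_mem {u v : List I} {m k : ℕ} {x : D.Tilde} (hx : x ∈ D.filt m)
    (h : u.length + v.length + m ≤ k) : D.word u * x * D.word v ∈ D.filt k :=
  D.mul_mem_filt (D.mul_mem_filt (D.word_mem_filt u le_rfl) hx le_rfl) (D.word_mem_filt v le_rfl)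
    (by omega)

/-- Left `A`-linear endomorphisms agree modulo the ideal if they do so on words. -/
lemma sub_mem_jfilt_of_word {f g : D.Tilde →ₗ[ℂ] D.Tilde}
    (hf : ∀ a x, f (D.ι a * x) = D.ι a * f x) (hg : ∀ a x, g (D.ι a * x) = D.ι a * g x)
    (h : ∀ w, f (D.word w) - g (D.word w) ∈ D.jfilt T n) (x : D.Tilde) :
    f x - g x ∈ D.jfilt T n := by
  induction x using D.word_induction with
  | h0 => simp
  | hadd x y hx hy =>
    rw [map_add, map_add, add_sub_add_comm]
    exact add_mem hx hy
  | hw a w =>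
    rw [hf, hg, ← mul_sub]
    exact mul_mem_jfilt_left (D.ι_mem_filt a 0) (h w) (by omega)

lemma sTail_eq (k l : I) : D.sTail T k l =
    ∑ x : I × I, D.R (k, l) x • D.quadTail T x.1 x.2 - D.quadTail T k l := by
  simp [sTail, sub_smul, Matrix.one_apply, ite_smul]

lemma sum_R_smul_sTail (hR : D.R * D.R = 1) (k l : I) :
    ∑ x : I × I, D.R (k, l) x • D.sTail T x.1 x.2 = -D.sTail T k l := by
  have h := sum_smul_vecMul (D.R (k, l)) (D.R - 1) fun x => D.quadTail T x.1 x.2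
  have h0 : D.R (k, l) ᵥ* (D.R - 1) = -(D.R - 1) (k, l) := by
    have : D.R * (D.R - 1) = -(D.R - 1) := by rw [mul_sub, hR, mul_one, neg_sub]
    exact congrFun this (k, l)
  rw [h0] at h
  simp only [Pi.neg_apply, neg_smul, Finset.sum_neg_distrib] at h
  exact h

/-- `R² = 1` makes the transpositions involutive, without corrections since `R (R - 1) = -(R - 1)`. -/
lemma swap_swap (hR : D.R * D.R = 1) {j : ℕ} (hj : j + 2 ≤ n) (w : List I) :
    D.swap T n j (D.swap T n j (D.word w)) = D.word w := by
  by_cases hw : w.length = n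
  · obtain ⟨u, k, l, v, rfl, rfl⟩ := exists_eq_append_cons_cons (j := j) (w := w) (by omega)
    have hl : u.length + v.length + 2 = n := by
      simp only [List.length_append, List.length_cons] at hw
      omega
    have h1 : D.word u * D.sTail T k l * D.word v ∈ D.filt (n - 1) :=
      word_mul_mul_word_mem (D.sTail_mem T k l) (by omega)
    have hRR : ∑ x : I × I, D.R (k, l) x • ∑ y, D.R x y • (D.p y.1 * D.p y.2) =
        D.p k * D.p l := by
      have := sum_smul_vecMul (D.R (k, l)) D.R fun x => D.p x.1 * D.p x.2
      rw [show D.R (k, l) ᵥ* D.R = (1 : Matrix (I × I) (I × I) ℂ) (k, l) from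
        congrFun hR (k, l)] at this
      simpa [Matrix.one_apply, ite_smul] using this
    have hmid : D.swap T n u.length
        (D.word u * (∑ x : I × I, D.R (k, l) x • (D.p x.1 * D.p x.2)) * D.word v) =
        D.word u * (∑ x : I × I, D.R (k, l) x •
          (∑ y : I × I, D.R x y • (D.p y.1 * D.p y.2) + D.sTail T x.1 x.2)) * D.word v := by
      rw [Finset.mul_sum, Finset.sum_mul, Finset.mul_sum, Finset.sum_mul, map_sum]
      refine Finset.sum_congr rfl fun x _ => ?_
      rw [mul_smul_comm, smul_mul_assoc, map_smul, swap_append' hl, mul_smul_comm, smul_mul_assoc]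
    rw [word_append_cons_cons, swap_append' hl, mul_add, add_mul, map_add,
      swap_of_mem_filt (by omega) _ h1, hmid, ← add_mul, ← mul_add]
    simp only [smul_add, Finset.sum_add_distrib, hRR]
    rw [sum_R_smul_sTail hR, neg_add_cancel_right]
  · rw [swap_word_of_length_ne j hw, swap_word_of_length_ne j hw]

/-- Transpositions at distant places commute up to elements of lower degree in which one `s_kl` is
inserted. -/
lemma swap_comm {i j : ℕ} (hij : i + 2 ≤ j) (hj : j + 2 ≤ n + 1) (w : List I) :
    D.swap T (n + 1) i (D.swap T (n + 1) j (D.word w)) -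
      D.swap T (n + 1) j (D.swap T (n + 1) i (D.word w)) ∈ D.jfilt T n := by
  by_cases hw : w.length = n + 1
  · obtain ⟨u', c, d, t, rfl, rfl⟩ := exists_eq_append_cons_cons (j := j) (w := w) (by omega)
    obtain ⟨u, a, b, v, rfl, rfl⟩ := exists_eq_append_cons_cons (j := i) (w := u') (by omega)
    have hl : u.length + v.length + 2 + t.length + 2 = n + 1 := by
      simp only [List.length_append, List.length_cons] at hw
      omega
    have hl₁ : ∀ a b : I, (u ++ a :: b :: v).length + t.length + 2 = n + 1 := by
      intro a b
      simp only [List.length_append, List.length_cons]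
      omega
    have hl₂ : ∀ c d : I, u.length + (v ++ c :: d :: t).length + 2 = n + 1 := by
      intro c d
      simp only [List.length_append, List.length_cons]
      omega
    have hlen : ∀ a' b' : I, (u ++ a :: b :: v).length = (u ++ a' :: b' :: v).length := by
      simp
    have e₁ := D.p_mul_p_add_s T a b
    have e₂ := D.p_mul_p_add_s T c d
    have S₁ : ∀ c d, D.swap T (n + 1) u.length
        (D.word u * (D.p a * D.p b) * D.word v * (D.p c * D.p d) * D.word t) =
        D.word u * (D.p a * D.p b + D.s T (a, b)) * D.word v * (D.p c * D.p d) * D.word t := by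
      intro c d
      have := D.swap_append (T := T) (hl₂ c d) a b
      simp only [word_append_cons_cons, ← mul_assoc] at this ⊢
      exact this
    have S₂ : ∀ a' b', D.swap T (n + 1) (u ++ a :: b :: v).length
        (D.word u * (D.p a' * D.p b') * D.word v * (D.p c * D.p d) * D.word t) =
        D.word u * (D.p a' * D.p b') * D.word v * (D.p c * D.p d + D.s T (c, d)) * D.word t := by
      intro a' b'
      have := D.swap_append (T := T) (hl₁ a' b') c d
      rw [hlen a' b']
      simp only [word_append_cons_cons, ← mul_assoc] at this ⊢
      exact this
    have f₁ : D.word u * (D.p a * D.p b) * D.word v * D.sTail T c d * D.word t ∈ D.filt n := by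
      have h := word_mul_mul_word_mem (u := u ++ a :: b :: v) (v := t) (D.sTail_mem T c d)
        (k := n) (by have := hl₁ a b; omega)
      rwa [word_append_cons_cons] at h
    have f₂ : D.word u * D.sTail T a b * D.word v * (D.p c * D.p d) * D.word t ∈ D.filt n := by
      have h := word_mul_mul_word_mem (u := u) (v := v ++ c :: d :: t) (D.sTail_mem T a b)
        (k := n) (by have := hl₂ c d; omega)
      rw [word_append_cons_cons] at h
      simpa only [mul_assoc] using h
    have g₁ : D.word u * D.s T (a, b) * (D.word v * D.sTail T c d * D.word t) ∈ D.jfilt T n :=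
      mul_s_mul_mem_jfilt (D.word_mem_filt u le_rfl)
        (word_mul_mul_word_mem (D.sTail_mem T c d) le_rfl) _ (by omega)
    have g₂ : D.word u * D.sTail T a b * D.word v * D.s T (c, d) * D.word t ∈ D.jfilt T n :=
      mul_s_mul_mem_jfilt (D.mul_mem_filt (D.mul_mem_filt (D.word_mem_filt u le_rfl)
        (D.sTail_mem T a b) le_rfl) (D.word_mem_filt v le_rfl) le_rfl)
        (D.word_mem_filt t le_rfl) _ (by omega)
    set P' := ∑ x : I × I, D.R (a, b) x • (D.p x.1 * D.p x.2) with hP'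
    set Q' := ∑ x : I × I, D.R (c, d) x • (D.p x.1 * D.p x.2) with hQ'
    have S₁' : D.swap T (n + 1) u.length
        (D.word u * (D.p a * D.p b) * D.word v * Q' * D.word t) =
        D.word u * (D.p a * D.p b + D.s T (a, b)) * D.word v * Q' * D.word t := by
      simp only [hQ', Finset.mul_sum, Finset.sum_mul, mul_smul_comm, smul_mul_assoc, map_sum,
        map_smul, S₁]
    have S₂' : D.swap T (n + 1) (u ++ a :: b :: v).length
        (D.word u * P' * D.word v * (D.p c * D.p d) * D.word t) =
        D.word u * P' * D.word v * (D.p c * D.p d + D.s T (c, d)) * D.word t := by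
      simp only [hP', Finset.mul_sum, Finset.sum_mul, mul_smul_comm, smul_mul_assoc, map_sum,
        map_smul, S₂]
    have e : D.word ((u ++ a :: b :: v) ++ c :: d :: t) =
        D.word u * (D.p a * D.p b) * D.word v * (D.p c * D.p d) * D.word t := by
      simp only [word_append_cons_cons, mul_assoc]
    rw [e, S₂, S₁, e₁, e₂]
    have h₁ : D.swap T (n + 1) u.length
        (D.word u * (D.p a * D.p b) * D.word v * (Q' + D.sTail T c d) * D.word t) =
        D.word u * (D.p a * D.p b + D.s T (a, b)) * D.word v * Q' * D.word t +
        D.word u * (D.p a * D.p b) * D.word v * D.sTail T c d * D.word t := by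
      rw [mul_add, add_mul, map_add, S₁', swap_of_mem_filt (by omega) _ f₁]
    have h₂ : D.swap T (n + 1) (u ++ a :: b :: v).length
        (D.word u * (P' + D.sTail T a b) * D.word v * (D.p c * D.p d) * D.word t) =
        D.word u * P' * D.word v * (D.p c * D.p d + D.s T (c, d)) * D.word t +
        D.word u * D.sTail T a b * D.word v * (D.p c * D.p d) * D.word t := by
      rw [mul_add, add_mul, add_mul, add_mul, map_add, S₂', swap_of_mem_filt (by omega) _ f₂]
    rw [h₁, h₂]
    have hP : P' = D.p a * D.p b + D.s T (a, b) - D.sTail T a b := by rw [e₁]; abel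
    have hQ : Q' = D.p c * D.p d + D.s T (c, d) - D.sTail T c d := by rw [e₂]; abel
    have := sub_mem g₂ g₁
    rw [hP, hQ]
    convert this using 1
    noncomm_ring
  · rw [swap_word_of_length_ne j hw, swap_word_of_length_ne i hw, swap_word_of_length_ne j hw,
      sub_self]
    exact zero_mem _

/-- The words with three letters in the middle, as a function of the coefficients. -/
def midWord (G : I × I × I → D.Tilde) (u v : List I) : (I × I × I → ℂ) →ₗ[ℂ] D.Tilde :=
  Fintype.linearCombination ℂ fun x => D.word u * G x * D.word v

lemma midWord_apply (G : I × I × I → D.Tilde) (u v : List I) (y : I × I × I → ℂ) :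
    midWord G u v y = ∑ x, y x • (D.word u * G x * D.word v) := rfl

lemma midWord_vecMul (G : I × I × I → D.Tilde) (u v : List I) (y : I × I × I → ℂ)
    (X : Matrix (I × I × I) (I × I × I) ℂ) :
    midWord G u v (y ᵥ* X) = ∑ x, y x • (D.word u * (∑ z, X x z • G z) * D.word v) := by
  rw [midWord_apply, ← sum_smul_vecMul]
  simp only [Finset.mul_sum, Finset.sum_mul, mul_smul_comm, smul_mul_assoc]

lemma midWord_mem {G : I × I × I → D.Tilde} {m k : ℕ} (hG : ∀ x, G x ∈ D.filt m) {u v : List I}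
    (h : u.length + v.length + m ≤ k) (y : I × I × I → ℂ) : midWord G u v y ∈ D.filt k := by
  rw [midWord_apply]
  exact sum_mem fun x _ => Submodule.smul_mem _ _ (word_mul_mul_word_mem (hG x) h)

lemma R₁₂_smul_mul (H : I × I → D.Tilde) (g : I → D.Tilde) (i k l : I) :
    ∑ x, D.R₁₂ (i, k, l) x • (H (x.1, x.2.1) * g x.2.2) = (∑ z, D.R (i, k) z • H z) * g l := by
  rw [R₁₂_smul D fun x => H (x.1, x.2.1) * g x.2.2, Fintype.sum_prod_type]
  simp only [Finset.sum_mul, smul_mul_assoc]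

lemma R₂₃_smul_mul (H : I × I → D.Tilde) (g : I → D.Tilde) (i k l : I) :
    ∑ x, D.R₂₃ (i, k, l) x • (g x.1 * H (x.2.1, x.2.2)) = g i * ∑ z, D.R (k, l) z • H z := by
  rw [R₂₃_smul D fun x => g x.1 * H (x.2.1, x.2.2), Fintype.sum_prod_type]
  simp only [Finset.mul_sum, mul_smul_comm]

/-- The defect of the braid relation on a word is the overlap of the quadratic elements contracted with
a row of `A_3`. -/
lemma swap_braid {j : ℕ} (hj : j + 3 ≤ n + 1)
    (hO : ∀ y : I × I × I → ℂ, ∑ x : I × I × I, (y ᵥ* D.A₃) x •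
      (D.quad T x.1 x.2.1 * D.p x.2.2 - D.p x.1 * D.quad T x.2.1 x.2.2) ∈ D.jfilt T 2)
    (w : List I) :
    D.swap T (n + 1) j (D.swap T (n + 1) (j + 1) (D.swap T (n + 1) j (D.word w))) -
      D.swap T (n + 1) (j + 1) (D.swap T (n + 1) j (D.swap T (n + 1) (j + 1) (D.word w))) ∈
      D.jfilt T n := by
  by_cases hw : w.length = n + 1
  · obtain ⟨u, a, b, v', rfl, rfl⟩ := exists_eq_append_cons_cons (j := j) (w := w) (by omega)
    obtain ⟨c, v, rfl⟩ : ∃ c v, v' = c :: v := by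
      cases v' with
      | nil => simp at hw; omega
      | cons c v => exact ⟨c, v, rfl⟩
    have hl : u.length + v.length + 3 = n + 1 := by
      simp only [List.length_append, List.length_cons] at hw
      omega
    set S₁ := D.swap T (n + 1) u.length with hS₁
    set S₂ := D.swap T (n + 1) (u.length + 1) with hS₂
    set P := midWord (fun x : I × I × I => D.p x.1 * D.p x.2.1 * D.p x.2.2) u v with hP
    set M₁ := midWord (fun x : I × I × I => D.quadTail T x.1 x.2.1 * D.p x.2.2) u v with hM₁
    set M₂ := midWord (fun x : I × I × I => D.p x.1 * D.quadTail T x.2.1 x.2.2) u v with hM₂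
    have m₁ : ∀ y, M₁ y ∈ D.filt n := midWord_mem (fun x =>
      D.mul_mem_filt (D.quadTail_mem T _ _) (D.p_mem_filt _ le_rfl) le_rfl) (by omega)
    have m₂ : ∀ y, M₂ y ∈ D.filt n := midWord_mem (fun x =>
      D.mul_mem_filt (D.p_mem_filt _ le_rfl) (D.quadTail_mem T _ _) le_rfl) (by omega)
    have s₁₁ : ∀ y, S₁ (M₁ y) = M₁ y := fun y => swap_of_mem_filt (by omega) _ (m₁ y)
    have s₁₂ : ∀ y, S₁ (M₂ y) = M₂ y := fun y => swap_of_mem_filt (by omega) _ (m₂ y)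
    have s₂₁ : ∀ y, S₂ (M₁ y) = M₁ y := fun y => swap_of_mem_filt (by omega) _ (m₁ y)
    have s₂₂ : ∀ y, S₂ (M₂ y) = M₂ y := fun y => swap_of_mem_filt (by omega) _ (m₂ y)
    have p₁ : ∀ y, S₁ (P y) = P (y ᵥ* D.R₁₂) + (M₁ (y ᵥ* D.R₁₂) - M₁ y) := by
      intro y
      rw [hP, hM₁, midWord_vecMul, midWord_vecMul, midWord_apply, midWord_apply, map_sum,
        ← Finset.sum_sub_distrib, ← Finset.sum_add_distrib]
      refine Finset.sum_congr rfl fun x _ => ?_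
      obtain ⟨i, k, l⟩ := x
      rw [map_smul, ← smul_sub, ← smul_add]
      congr 1
      have := D.swap_append' (T := T) (u := u) (v := l :: v) (n := n + 1) (by simp; omega) i k
      rw [word_cons] at this
      have e₁ := R₁₂_smul_mul (fun z => D.p z.1 * D.p z.2) D.p i k l
      have e₂ := R₁₂_smul_mul (fun z => D.quadTail T z.1 z.2) D.p i k l
      rw [sTail_eq] at this
      simp only at e₁ e₂
      rw [e₁, e₂]
      simp only [mul_assoc, add_mul, mul_add, sub_mul, mul_sub] at this ⊢
      exact this
    have p₂ : ∀ y, S₂ (P y) = P (y ᵥ* D.R₂₃) + (M₂ (y ᵥ* D.R₂₃) - M₂ y) := by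
      intro y
      rw [hP, hM₂, midWord_vecMul, midWord_vecMul, midWord_apply, midWord_apply, map_sum,
        ← Finset.sum_sub_distrib, ← Finset.sum_add_distrib]
      refine Finset.sum_congr rfl fun x _ => ?_
      obtain ⟨i, k, l⟩ := x
      rw [map_smul, ← smul_sub, ← smul_add]
      congr 1
      have := D.swap_append' (T := T) (u := u ++ [i]) (v := v) (n := n + 1) (by simp; omega) k l
      rw [word_append, word_cons, word_nil, mul_one, List.length_append, List.length_singleton,
        ← hS₂] at this
      have e₁ := R₂₃_smul_mul (fun z => D.p z.1 * D.p z.2) D.p i k l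
      have e₂ := R₂₃_smul_mul (fun z => D.quadTail T z.1 z.2) D.p i k l
      rw [sTail_eq] at this
      simp only [← mul_assoc (D.p _) (D.p _) (D.p _)] at e₁ e₂
      rw [e₁, e₂]
      simp only [mul_assoc, add_mul, mul_add, sub_mul, mul_sub] at this ⊢
      exact this
    have key : ∀ y, S₁ (S₂ (S₁ (P y))) - S₂ (S₁ (S₂ (P y))) =
        M₂ (y ᵥ* D.A₃) - M₁ (y ᵥ* D.A₃) := by
      intro y
      simp only [p₁, p₂, map_add, map_sub, s₁₁, s₁₂, s₂₁, s₂₂]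
      have hA : y ᵥ* D.A₃ = y - y ᵥ* D.R₁₂ - y ᵥ* D.R₂₃ + y ᵥ* D.R₁₂ ᵥ* D.R₂₃ +
          y ᵥ* D.R₂₃ ᵥ* D.R₁₂ - y ᵥ* D.R₁₂ ᵥ* D.R₂₃ ᵥ* D.R₁₂ := by
        simp only [A₃, Matrix.vecMul_add, Matrix.vecMul_sub, Matrix.vecMul_one,
          Matrix.vecMul_vecMul, Matrix.mul_assoc]
      have hB : y ᵥ* D.R₁₂ ᵥ* D.R₂₃ ᵥ* D.R₁₂ = y ᵥ* D.R₂₃ ᵥ* D.R₁₂ ᵥ* D.R₂₃ := by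
        simp only [Matrix.vecMul_vecMul, R_braid]
      rw [hA]
      simp only [map_add, map_sub, hB]
      abel
    have hmem : ∀ y, M₂ (y ᵥ* D.A₃) - M₁ (y ᵥ* D.A₃) ∈ D.jfilt T n := by
      intro y
      have h := mul_mem_jfilt_right (mul_mem_jfilt_left (D.word_mem_filt u le_rfl) (hO y) le_rfl)
        (D.word_mem_filt v le_rfl) (k := n) (by omega)
      have e : M₂ (y ᵥ* D.A₃) - M₁ (y ᵥ* D.A₃) = -(D.word u * (∑ x : I × I × I, (y ᵥ* D.A₃) x •
          (D.quad T x.1 x.2.1 * D.p x.2.2 - D.p x.1 * D.quad T x.2.1 x.2.2)) * D.word v) := by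
        rw [hM₁, hM₂, midWord_apply, midWord_apply, Finset.mul_sum, Finset.sum_mul,
          ← Finset.sum_sub_distrib, ← Finset.sum_neg_distrib]
        refine Finset.sum_congr rfl fun x _ => ?_
        simp only [quadTail]
        rw [← smul_sub, mul_smul_comm, smul_mul_assoc, ← smul_neg]
        congr 1
        noncomm_ring
      rw [e]
      exact neg_mem h
    have e : D.word (u ++ a :: b :: c :: v) = P (Pi.single (a, b, c) 1) := by
      rw [hP, midWord_apply, Finset.sum_eq_single (a, b, c)]
      · simp [mul_assoc]
      · intro x _ hx; simp [hx]
      · simp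
    rw [e, key]
    exact hmem _
  · simp only [swap_word_of_length_ne _ hw, sub_self]
    exact zero_mem _

variable (D T n) in
/-- The operators `swap` for words of length `n + 1`, modulo the part of degree at most `n` of the
ideal. -/
def swapQ (j : ℕ) : Module.End ℂ (D.Tilde ⧸ D.jfilt T n) :=
  (D.jfilt T n).mapQ (D.jfilt T n) (D.swap T (n + 1) j) fun x hx => by
    rw [Submodule.mem_comap, swap_of_mem_filt (Nat.lt_succ_self n) _ (jfilt_le_filt n hx)]
    exact hx

lemma swapQ_mk (j : ℕ) (x : D.Tilde) : D.swapQ T n j (Submodule.Quotient.mk x) =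
    Submodule.Quotient.mk (D.swap T (n + 1) j x) := rfl

lemma coxeterRel_swapQ (hR : D.R * D.R = 1)
    (hO : ∀ y : I × I × I → ℂ, ∑ x : I × I × I, (y ᵥ* D.A₃) x •
      (D.quad T x.1 x.2.1 * D.p x.2.2 - D.p x.1 * D.quad T x.2.1 x.2.2) ∈ D.jfilt T 2) :
    CoxeterRel (D.swapQ T n) n := by
  refine ⟨fun i hi => ?_, fun i hi => ?_, fun i j hij hj => ?_⟩
  · refine LinearMap.ext fun x => ?_
    obtain ⟨x, rfl⟩ := Submodule.Quotient.mk_surjective _ x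
    have h := sub_mem_jfilt_of_word (T := T) (n := n)
      (f := D.swap T (n + 1) i ∘ₗ D.swap T (n + 1) i) (g := LinearMap.id)
      (fun a x => by simp only [LinearMap.comp_apply, swap_ι_mul]) (fun a x => rfl)
      (fun w => by
        rw [LinearMap.comp_apply, swap_swap hR (by omega), LinearMap.id_apply, sub_self]
        exact zero_mem _) x
    rw [Module.End.mul_apply, swapQ_mk, swapQ_mk]
    exact (Submodule.Quotient.eq _).2 h
  · refine LinearMap.ext fun x => ?_
    obtain ⟨x, rfl⟩ := Submodule.Quotient.mk_surjective _ x
    have h := sub_mem_jfilt_of_word (T := T) (n := n)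
      (f := D.swap T (n + 1) i ∘ₗ D.swap T (n + 1) (i + 1) ∘ₗ D.swap T (n + 1) i)
      (g := D.swap T (n + 1) (i + 1) ∘ₗ D.swap T (n + 1) i ∘ₗ D.swap T (n + 1) (i + 1))
      (fun a x => by simp only [LinearMap.comp_apply, swap_ι_mul])
      (fun a x => by simp only [LinearMap.comp_apply, swap_ι_mul])
      (fun w => by
        have := swap_braid (j := i) (n := n) (by omega) hO w
        simpa only [LinearMap.comp_apply] using this) x
    simp only [Module.End.mul_apply, swapQ_mk]
    exact (Submodule.Quotient.eq _).2 h
  · refine LinearMap.ext fun x => ?_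
    obtain ⟨x, rfl⟩ := Submodule.Quotient.mk_surjective _ x
    have h := sub_mem_jfilt_of_word (T := T) (n := n)
      (f := D.swap T (n + 1) i ∘ₗ D.swap T (n + 1) j)
      (g := D.swap T (n + 1) j ∘ₗ D.swap T (n + 1) i)
      (fun a x => by simp only [LinearMap.comp_apply, swap_ι_mul])
      (fun a x => by simp only [LinearMap.comp_apply, swap_ι_mul])
      (fun w => by
        have := swap_comm (D := D) (T := T) (n := n) hij (by omega) w
        simpa only [LinearMap.comp_apply] using this) x
    simp only [Module.End.mul_apply, swapQ_mk]
    exact (Submodule.Quotient.eq _).2 h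

/-- The step of the Poincaré–Birkhoff–Witt theorem: the symmetrizer of the operators `swap` is the
identity on `B̃^n`, and kills the products of degree `n + 1` containing some `s_kl`, which are of the
form `swap x - x`. -/
lemma mem_jfilt_of_mem_filt (hR : D.R * D.R = 1)
    (hΩ : ∀ k l b, ∑ i, ∑ j, (D.R - 1) (k, l) (i, j) • D.omega T i j b = 0)
    (hO : ∀ y : I × I × I → ℂ, ∑ x : I × I × I, (y ᵥ* D.A₃) x •
      (D.quad T x.1 x.2.1 * D.p x.2.2 - D.p x.1 * D.quad T x.2.1 x.2.2) ∈ D.jfilt T 2)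
    {x : D.Tilde} (hx : x ∈ D.jfilt T (n + 1)) (hx' : x ∈ D.filt n) : x ∈ D.jfilt T n := by
  set e := symmetrizer (D.swapQ T n) n with he
  have h1 : e (Submodule.Quotient.mk x) = Submodule.Quotient.mk x :=
    symmetrizer_apply_of_fixed fun i _ => by
      rw [swapQ_mk, swap_of_mem_filt (Nat.lt_succ_self n) _ hx']
  have h2 : D.jfilt T (n + 1) ≤ LinearMap.ker (e ∘ₗ (D.jfilt T n).mkQ) := by
    refine jfilt_le_of_insert hR hΩ fun a u kl v huv => ?_
    rw [LinearMap.mem_ker, LinearMap.comp_apply, Submodule.mkQ_apply]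
    rcases Nat.lt_or_ge (u.length + v.length + 2) (n + 1) with hlt | hge
    · have : D.ι a * (D.word u * D.s T kl * D.word v) ∈ D.jfilt T n :=
        mul_mem_jfilt_left (n := n) (D.ι_mem_filt a 0) (mul_s_mul_mem_jfilt
          (D.word_mem_filt u le_rfl) (D.word_mem_filt v le_rfl) kl (by omega)) (by omega)
      rw [(Submodule.Quotient.mk_eq_zero _).2 this, map_zero]
    · obtain ⟨k, l⟩ := kl
      have hs : e * D.swapQ T n u.length = e :=
        symmetrizer_mul (coxeterRel_swapQ hR hO) (by omega)
      have := congrArg (fun g => g (Submodule.Quotient.mk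
        (D.ι a * (D.word u * (D.p k * D.p l) * D.word v)))) hs
      simp only [Module.End.mul_apply, swapQ_mk, swap_ι_mul] at this
      have hl : u.length + v.length + 2 = n + 1 := by omega
      rw [swap_append hl, mul_add, add_mul, mul_add, Submodule.Quotient.mk_add, map_add,
        add_eq_left] at this
      exact this
  have h3 := h2 hx
  rw [LinearMap.mem_ker, LinearMap.comp_apply, Submodule.mkQ_apply, h1,
    Submodule.Quotient.mk_eq_zero] at h3
  exact h3

/-- The Poincaré–Birkhoff–Witt theorem: the ideal generated by the `s_kl` meets `B̃^n` only in the
part of degree at most `n`. -/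
lemma mem_jfilt_of_mem_idealS (hR : D.R * D.R = 1)
    (hΩ : ∀ k l b, ∑ i, ∑ j, (D.R - 1) (k, l) (i, j) • D.omega T i j b = 0)
    (hO : ∀ y : I × I × I → ℂ, ∑ x : I × I × I, (y ᵥ* D.A₃) x •
      (D.quad T x.1 x.2.1 * D.p x.2.2 - D.p x.1 * D.quad T x.2.1 x.2.2) ∈ D.jfilt T 2)
    {x : D.Tilde} (hx : x ∈ D.idealS T) (hx' : x ∈ D.filt n) : x ∈ D.jfilt T n := by
  obtain ⟨m, hm⟩ := mem_idealS_iff.1 hx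
  obtain ⟨d, hd⟩ : ∃ d, m ≤ n + d := ⟨m, by omega⟩
  have hm' := jfilt_mono hd hm
  clear hd
  induction d with
  | zero => exact hm'
  | succ d ih => exact ih (mem_jfilt_of_mem_filt hR hΩ hO hm' (D.filt_mono (by omega) hx'))

end InhomData
end InhomQG

namespace InhomQG

/-! ### The conditions on `T` in terms of the overlaps -/

section Reps

variable {C : Type*} [Ring C] [Bialgebra ℂ C]

lemma IsRep.kronecker {m n : Type*} [Fintype m] [DecidableEq m] [Fintype n] [DecidableEq n]
    {v : Matrix m m C} {w : Matrix n n C} (hv : IsRep v) (hw : IsRep w) : IsRep (v ⊗ₖ w) where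
  comul := by
    rintro ⟨i, j⟩ ⟨k, l⟩
    simp only [Matrix.kroneckerMap_apply, Bialgebra.comul_mul, hv.comul, hw.comul,
      Finset.sum_mul_sum, Algebra.TensorProduct.tmul_mul_tmul, Fintype.sum_prod_type]
  counit := by
    rintro ⟨i, j⟩ ⟨k, l⟩
    simp only [Matrix.kroneckerMap_apply, Bialgebra.counit_mul, hv.counit, hw.counit,
      Prod.mk.injEq]
    split_ifs <;> simp_all

lemma scal_mul_apply {l m n : Type*} [Fintype m] (X : Matrix l m ℂ) (v : Matrix m n C) (i : l)
    (j : n) : (scal C X * v) i j = ∑ p, X i p • v p j := by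
  simp only [Matrix.mul_apply, scal, Matrix.map_apply, ← Algebra.smul_def]

lemma mul_scal_apply {l m n : Type*} [Fintype m] (v : Matrix l m C) (X : Matrix m n ℂ) (i : l)
    (j : n) : (v * scal C X) i j = ∑ q, X q j • v i q := by
  simp only [Matrix.mul_apply, scal, Matrix.map_apply, ← Algebra.smul_def,
    ← Algebra.commutes (R := ℂ) (A := C)]

lemma scal_mul {l m n : Type*} [Fintype m] (X : Matrix l m ℂ) (Y : Matrix m n ℂ) :
    scal C (X * Y) = scal C X * scal C Y := Matrix.map_mul

/-- Compression of a representation to a quotient cut out by an intertwining matrix `a` with right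
inverse `B`. -/
lemma IsRep.compress {m n : Type*} [Fintype m] [DecidableEq m] [Fintype n] [DecidableEq n]
    {v : Matrix m m C} (hv : IsRep v) {a : Matrix n m ℂ} {B : Matrix m n ℂ} (hab : a * B = 1)
    (hg : scal C a * v = scal C a * v * scal C B * scal C a) :
    IsRep (scal C a * v * scal C B) := by
  have h1 : ∀ i j, (scal C a * v * scal C B) i j = ∑ q, ∑ p, (B q j * a i p) • v p q := by
    intro i j
    simp only [mul_scal_apply, scal_mul_apply, Finset.smul_sum, smul_smul]
  refine ⟨fun i j => ?_, fun i j => ?_⟩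
  · have h2 : ∀ k, (scal C a * v * scal C B) k j =
        ∑ p, a k p • (v * scal C B) p j := by
      intro k
      rw [Matrix.mul_assoc, scal_mul_apply]
    have h3 : ∀ p, ∑ k, a k p • (scal C a * v * scal C B) i k = ∑ q, a i q • v q p := by
      intro p
      rw [← mul_scal_apply, ← hg, scal_mul_apply]
    calc Coalgebra.comul (R := ℂ) ((scal C a * v * scal C B) i j)
        = ∑ q, ∑ p, (B q j * a i p) • ∑ k, v p k ⊗ₜ[ℂ] v k q := by
          rw [h1]; simp only [map_sum, map_smul, hv.comul]
      _ = ∑ k, (∑ q, a i q • v q k) ⊗ₜ[ℂ] (v * scal C B) k j := by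
          simp only [mul_scal_apply, TensorProduct.sum_tmul, TensorProduct.tmul_sum,
            Finset.smul_sum, TensorProduct.tmul_smul, TensorProduct.smul_tmul', smul_smul]
          rw [sum_rotate]
      _ = ∑ k, (scal C a * v * scal C B) i k ⊗ₜ[ℂ] (scal C a * v * scal C B) k j := by
          simp only [h2, ← h3, TensorProduct.sum_tmul, TensorProduct.tmul_sum,
            TensorProduct.tmul_smul, TensorProduct.smul_tmul']
          rw [Finset.sum_comm]
  · have h2 := congrFun (congrFun hab i) j
    rw [Matrix.one_apply, Matrix.mul_apply] at h2
    rw [h1]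
    simp only [map_sum, map_smul, hv.counit, smul_eq_mul, mul_ite, mul_one, mul_zero,
      Finset.sum_ite_eq', Finset.mem_univ, if_true, ← h2]
    exact Finset.sum_congr rfl fun _ _ => mul_comm _ _

end Reps

namespace InhomData

variable {A I : Type*} [Ring A] [Bialgebra ℂ A] [Fintype I] [DecidableEq I] {D : InhomData A I}
  {T : I × I → ℂ}

/-- `1` and the `p̃_l` are linearly independent over `A`. -/
lemma eq_zero_of_sum_ι_mul_p {c : I → A} {d : A} (h : ∑ l, D.ι (c l) * D.p l + D.ι d = 0) :
    (∀ l, c l = 0) ∧ d = 0 := by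
  have h1 := congrArg (D.wordLift fun w => Finsupp.lsingle w) h
  have h2 : ∀ (a : A) l, D.wordLift (M := List I →₀ A) (fun w => Finsupp.lsingle w)
      (D.ι a * D.p l) = Finsupp.single [l] a := by
    intro a l
    have := D.wordLift_apply (M := List I →₀ A) (fun w => Finsupp.lsingle w) a [l]
    simpa using this
  have h3 : D.wordLift (M := List I →₀ A) (fun w => Finsupp.lsingle w) (D.ι d) =
      Finsupp.single [] d := by
    have := D.wordLift_apply (M := List I →₀ A) (fun w => Finsupp.lsingle w) d []
    simpa using this
  simp only [map_add, map_sum, h2, h3, map_zero] at h1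
  constructor
  · intro l
    have := DFunLike.congr_fun h1 [l]
    simpa [Finsupp.single_apply, Finsupp.finsetSum_apply] using this
  · have := DFunLike.congr_fun h1 []
    simpa [Finsupp.single_apply, Finsupp.finsetSum_apply] using this

lemma ι_injective : Function.Injective D.ι := by
  rw [injective_iff_map_eq_zero]
  intro a ha
  exact (eq_zero_of_sum_ι_mul_p (c := 0) (d := a) (by simpa using ha)).2

/-- The defect in the bimodule condition is the contraction of `Ω` with the rows of `a`. -/
lemma sum_smul_omega_eq {N : Type*} [Fintype N] {a : Matrix N (I × I) ℂ} {g : Matrix N N A}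
    (hag : scal A a * (D.Λ ⊗ₖ D.Λ) = g * scal A a) (b : A) (α : N) :
    ∑ x : I × I, a α x • D.omega T x.1 x.2 b =
      convL (∑ ij, a α ij • D.τ T ij.1 ij.2) b -
        ∑ β, g α β * convR (∑ ij, a β ij • D.τ T ij.1 ij.2) b := by
  have h2 : ∀ β, convR (∑ ij, a β ij • D.τ T ij.1 ij.2) b =
      ∑ x : I × I, a β x • convR (D.τ T x.1 x.2) b := by
    intro β
    have := map_sum (convRHom b) (fun x : I × I => a β x • D.τ T x.1 x.2) Finset.univ
    simp only [map_smul] at this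
    exact this
  have h3 : convL (∑ ij, a α ij • D.τ T ij.1 ij.2) b =
      ∑ x : I × I, a α x • convL (D.τ T x.1 x.2) b := by
    have := map_sum (convLHom b) (fun x : I × I => a α x • D.τ T x.1 x.2) Finset.univ
    simp only [map_smul] at this
    exact this
  have h4 : ∀ z : I × I, ∑ x : I × I, a α x • (D.Λ x.1 z.1 * D.Λ x.2 z.2) =
      ∑ β, a β z • g α β := by
    intro z
    have := congrFun (congrFun hag α) z
    rwa [scal_mul_apply, mul_scal_apply] at this
  have h5 : ∀ x : I × I, ∑ s, ∑ t, D.Λ x.1 s * D.Λ x.2 t * convR (D.τ T s t) b =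
      ∑ z : I × I, D.Λ x.1 z.1 * D.Λ x.2 z.2 * convR (D.τ T z.1 z.2) b := by
    intro x
    rw [Fintype.sum_prod_type]
  simp only [omega, smul_sub, Finset.sum_sub_distrib, ← h3, h2, h5, Finset.smul_sum,
    Finset.mul_sum]
  congr 1
  rw [Finset.sum_comm]
  conv_rhs => rw [Finset.sum_comm]
  refine Finset.sum_congr rfl fun z _ => ?_
  have h6 := congrArg (fun w => w * convR (D.τ T z.1 z.2) b) (h4 z)
  simp only [Finset.sum_mul, smul_mul_assoc] at h6
  simpa only [mul_smul_comm, mul_assoc] using h6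

/-- The rows of `R - 1` are killed by `R + 1`, hence are combinations of the basis rows `a^α`. -/
lemma sum_smul_omega_of_condBimodule (hR : D.R * D.R = 1) (h : D.CondBimodule T) (k l : I) (b : A) :
    ∑ i, ∑ j, (D.R - 1) (k, l) (i, j) • D.omega T i j b = 0 := by
  obtain ⟨N, a, g, -, hspan, -, hag, hτ⟩ := h
  have hmem : (D.R - 1) (k, l) ∈ Submodule.span ℂ (Set.range a.row) := by
    rw [hspan]
    have : (D.R - 1) * (D.R + 1) = 0 := by
      rw [sub_mul, mul_add, hR, one_mul, mul_one]; abel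
    exact congrFun this (k, l)
  have hle : Submodule.span ℂ (Set.range a.row) ≤
      LinearMap.ker (Fintype.linearCombination ℂ fun x : I × I => D.omega T x.1 x.2 b) := by
    rw [Submodule.span_le]
    rintro _ ⟨α, rfl⟩
    change ∑ x : I × I, a α x • D.omega T x.1 x.2 b = 0
    rw [sum_smul_omega_eq hag, hτ, sub_self]
  have := hle hmem
  rw [LinearMap.mem_ker, Fintype.linearCombination_apply, Fintype.sum_prod_type] at this
  exact this

/-- The rows killed by `R + 1` are those of the projection `(1 - R) / 2`, an intertwiner of `Λ ⊤ Λ`; a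
basis of them therefore carries a representation `g`. -/
lemma condBimodule_of_sum_smul_omega (hR : D.R * D.R = 1)
    (h : ∀ k l b, ∑ i, ∑ j, (D.R - 1) (k, l) (i, j) • D.omega T i j b = 0) :
    D.CondBimodule T := by
  -- `P` is the projection onto the rows annihilated by `R + 1`.
  set P : Matrix (I × I) (I × I) ℂ := (-(1 / 2 : ℂ)) • (D.R - 1) with hP
  set K : Submodule ℂ (I × I → ℂ) := LinearMap.ker (D.R + 1).vecMulLinear with hK
  have hKR : ∀ x ∈ K, x ᵥ* D.R = -x := by
    intro x hx
    have : x ᵥ* (D.R + 1) = 0 := hx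
    rw [Matrix.vecMul_add, Matrix.vecMul_one] at this
    exact eq_neg_of_add_eq_zero_left this
  have hPK : ∀ z, P z ∈ K := by
    intro z
    have : P * (D.R + 1) = 0 := by
      rw [hP, Matrix.smul_mul, sub_mul, mul_add, hR, one_mul, mul_one, add_comm, sub_self,
        smul_zero]
    exact congrFun this z
  have hKP : ∀ x ∈ K, x ᵥ* P = x := by
    intro x hx
    rw [hP, Matrix.vecMul_smul, Matrix.vecMul_sub, Matrix.vecMul_one, hKR x hx]
    module
  let b := Module.finBasis ℂ K
  set a : Matrix (Fin (Module.finrank ℂ K)) (I × I) ℂ := Matrix.of fun α => (b α : I × I → ℂ)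
    with ha
  set B : Matrix (I × I) (Fin (Module.finrank ℂ K)) ℂ :=
    Matrix.of fun z α => b.repr ⟨P z, hPK z⟩ α with hB
  have hBa : B * a = P := by
    ext z x
    have h1 := congrArg K.subtype (b.sum_repr ⟨P z, hPK z⟩)
    rw [map_sum] at h1
    have h2 := congrFun h1 x
    rw [Finset.sum_apply] at h2
    rw [Matrix.mul_apply]
    exact h2
  have hab : a * B = 1 := by
    ext α β
    have h1 : ∑ z, a α z • (⟨P z, hPK z⟩ : K) = b α := by
      apply Subtype.ext
      rw [← hKP _ (b α).2]
      ext x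
      simp [Matrix.vecMul, dotProduct, ha]
    have h2 := congrArg (fun y => b.repr y β) h1
    simp only [map_sum, map_smul, Finsupp.finsetSum_apply, Finsupp.smul_apply, b.repr_self] at h2
    rw [Matrix.mul_apply, Matrix.one_apply]
    simpa [hB, Finsupp.single_apply] using h2
  have hPΛ : scal A P * (D.Λ ⊗ₖ D.Λ) = (D.Λ ⊗ₖ D.Λ) * scal A P := by
    have e : scal A P = (-(1 / 2 : ℂ)) • (scal A D.R - 1) := by
      ext x y
      simp only [hP, scal, Matrix.map_apply, Matrix.smul_apply, Matrix.sub_apply, smul_eq_mul,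
        Matrix.one_apply, map_mul, map_sub]
      rw [Algebra.smul_def]
      split_ifs <;> simp
    rw [e, Matrix.smul_mul, Matrix.mul_smul, sub_mul, mul_sub, D.R_mul_ΛΛ, one_mul, mul_one]
  have haP : a * P = a := by
    ext α x
    exact congrFun (hKP _ (b α).2) x
  have hg : scal A a * (D.Λ ⊗ₖ D.Λ) = scal A a * (D.Λ ⊗ₖ D.Λ) * scal A B * scal A a := by
    calc scal A a * (D.Λ ⊗ₖ D.Λ) = scal A (a * P) * (D.Λ ⊗ₖ D.Λ) := by rw [haP]
      _ = scal A a * ((D.Λ ⊗ₖ D.Λ) * scal A P) := by rw [scal_mul, Matrix.mul_assoc, hPΛ]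
      _ = scal A a * (D.Λ ⊗ₖ D.Λ) * scal A B * scal A a := by
        simp only [← hBa, scal_mul, Matrix.mul_assoc]
  refine ⟨_, a, scal A a * (D.Λ ⊗ₖ D.Λ) * scal A B, ?_, ?_, (D.isRep.kronecker D.isRep).compress hab hg,
    hg, ?_⟩
  · exact b.linearIndependent.map' K.subtype (Submodule.ker_subtype K)
  · intro x
    have : Submodule.span ℂ (Set.range a.row) = K := by
      have h1 : Set.range a.row = K.subtype '' Set.range b := by
        rw [← Set.range_comp]; rfl
      rw [h1, ← Submodule.map_span, b.span_eq, Submodule.map_subtype_top]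
    rw [this]
    rfl
  · intro c α
    have h1 := sum_smul_omega_eq (T := T) hg c α
    rw [D.sum_antisymm_smul (a α) (hKR _ (b α).2), Finset.sum_eq_zero] at h1
    · exact (sub_eq_zero.1 h1.symm).symm
    · intro x _
      have := h x.1 x.2 c
      rw [← Fintype.sum_prod_type'
        (f := fun i j => (D.R - 1) (x.1, x.2) (i, j) • D.omega T i j c)] at this
      rw [this, smul_zero]

/-- The constant term of the overlap associated with the vector `u`. -/
def overlapConst (D : InhomData A I) (u : I × I × I → ℂ) (x : I × I × I) : A :=
  algebraMap ℂ A (u x) - D.ΛΛΛvec u x.1 x.2.1 x.2.2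

lemma overlapConst_eq (u : I × I × I → ℂ) (x : I × I × I) : D.overlapConst u x =
    algebraMap ℂ A (u x) - ∑ z, u z • (D.Λ ⊗ₖ (D.Λ ⊗ₖ D.Λ)) x z := by
  simp only [overlapConst, ΛΛΛvec, Fintype.sum_prod_type, Matrix.kroneckerMap_apply, mul_assoc]

/-- `A_3` is an intertwiner of `Λ ⊤ Λ ⊤ Λ`, so that it can be moved to the vector. -/
lemma sum_A₃_smul_overlapConst (u : I × I × I → ℂ) (r : I × I × I) :
    ∑ x, D.A₃ r x • D.overlapConst u x = D.overlapConst (D.A₃ *ᵥ u) r := by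
  have h1 : ∑ x, D.A₃ r x • ∑ z, u z • (D.Λ ⊗ₖ (D.Λ ⊗ₖ D.Λ)) x z =
      ∑ z, (D.A₃ *ᵥ u) z • (D.Λ ⊗ₖ (D.Λ ⊗ₖ D.Λ)) r z := by
    have h2 : ∀ z, ∑ x, D.A₃ r x • (D.Λ ⊗ₖ (D.Λ ⊗ₖ D.Λ)) x z =
        ∑ q, D.A₃ q z • (D.Λ ⊗ₖ (D.Λ ⊗ₖ D.Λ)) r q := by
      intro z
      rw [← scal_mul_apply, ← mul_scal_apply, D.A₃_mul_ΛΛΛ]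
    have h3 : ∑ x, D.A₃ r x • ∑ z, u z • (D.Λ ⊗ₖ (D.Λ ⊗ₖ D.Λ)) x z =
        ∑ z, u z • ∑ x, D.A₃ r x • (D.Λ ⊗ₖ (D.Λ ⊗ₖ D.Λ)) x z := by
      simp only [Finset.smul_sum, smul_smul]
      rw [Finset.sum_comm]
      refine Finset.sum_congr rfl fun z _ => Finset.sum_congr rfl fun x _ => ?_
      rw [mul_comm]
    rw [h3]
    simp only [h2, Finset.smul_sum, smul_smul, Matrix.mulVec, dotProduct, Finset.sum_smul]
    rw [Finset.sum_comm]
    refine Finset.sum_congr rfl fun z _ => Finset.sum_congr rfl fun x _ => ?_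
    rw [mul_comm]
  simp only [overlapConst_eq, smul_sub, Finset.sum_sub_distrib, h1]
  congr 1
  simp only [Matrix.mulVec, dotProduct, map_sum, map_mul, ← Algebra.smul_def]

lemma replicateCol_mem_Mor_iff (u : I × I × I → ℂ) :
    Matrix.replicateCol Unit u ∈ Mor (trivialRep A) (D.Λ ⊗ₖ (D.Λ ⊗ₖ D.Λ)) ↔
      ∀ x, D.overlapConst u x = 0 := by
  simp only [overlapConst_eq, sub_eq_zero]
  have h1 : ∀ x (i : Unit), ((D.Λ ⊗ₖ (D.Λ ⊗ₖ D.Λ)) * scal A (Matrix.replicateCol Unit u)) x i =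
      ∑ z, u z • (D.Λ ⊗ₖ (D.Λ ⊗ₖ D.Λ)) x z := fun x i => mul_scal_apply _ _ _ _
  have h2 : ∀ x (i : Unit), (scal A (Matrix.replicateCol Unit u) * trivialRep A) x i =
      algebraMap ℂ A (u x) := by
    intro x i
    rw [trivialRep, Matrix.mul_one]
    rfl
  constructor
  · intro h x
    rw [← h1 x (), ← h2 x ()]
    exact congrFun (congrFun h x) ()
  · intro h
    refine Matrix.ext fun x i => ?_
    rw [h1, h2, h]

lemma antisymm_row₁₂ {y : I × I × I → ℂ} (h : y ᵥ* D.R₁₂ = -y) (k : I) :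
    (fun x : I × I => y (x.1, x.2, k)) ᵥ* D.R = -fun x : I × I => y (x.1, x.2, k) := by
  ext ⟨a, b⟩
  have := congrFun h (a, b, k)
  simpa [Matrix.vecMul, dotProduct, Fintype.sum_prod_type, R₁₂_apply] using this

lemma antisymm_row₂₃ {y : I × I × I → ℂ} (h : y ᵥ* D.R₂₃ = -y) (i : I) :
    (fun x : I × I => y (i, x.1, x.2)) ᵥ* D.R = -fun x : I × I => y (i, x.1, x.2) := by
  ext ⟨a, b⟩
  refine Eq.trans ?_ (congrFun h (i, a, b))
  simp only [Matrix.vecMul, dotProduct, Fintype.sum_prod_type, R₂₃_apply]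
  symm
  rw [Finset.sum_eq_single i]
  · simp
  · intro c _ hc; simp [hc]
  · simp

lemma vecMul_A₃_R₁₂ (hR : D.R * D.R = 1) (y : I × I × I → ℂ) :
    (y ᵥ* D.A₃) ᵥ* D.R₁₂ = -(y ᵥ* D.A₃) := by
  rw [Matrix.vecMul_vecMul, D.A₃_mul_R₁₂ hR, Matrix.vecMul_neg]

lemma vecMul_A₃_R₂₃ (hR : D.R * D.R = 1) (y : I × I × I → ℂ) :
    (y ᵥ* D.A₃) ᵥ* D.R₂₃ = -(y ᵥ* D.A₃) := by
  rw [Matrix.vecMul_vecMul, D.A₃_mul_R₂₃ hR, Matrix.vecMul_neg]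

lemma vecMul_A₃_Z_R (hR : D.R * D.R = 1) (y : I × I × I → ℂ) :
    ((y ᵥ* D.A₃) ᵥ* (oneTens D.Z - tensOne D.Z)) ᵥ* D.R =
      -((y ᵥ* D.A₃) ᵥ* (oneTens D.Z - tensOne D.Z)) := by
  have h : oneTens D.Z - tensOne D.Z = -(tensOne D.Z - oneTens D.Z) := by rw [neg_sub]
  rw [h, Matrix.vecMul_neg, Matrix.neg_vecMul, Matrix.vecMul_vecMul, Matrix.vecMul_vecMul,
    ← Matrix.mul_assoc,
    D.A₃_mul_Z_mul_R hR, Matrix.vecMul_neg, Matrix.vecMul_vecMul]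

lemma sum_vecMul_A₃_smul_overlapConst (u : I × I × I → ℂ) (y : I × I × I → ℂ) :
    ∑ x, (y ᵥ* D.A₃) x • D.overlapConst u x = ∑ r, y r • D.overlapConst (D.A₃ *ᵥ u) r := by
  simp only [← sum_A₃_smul_overlapConst]
  exact (sum_smul_vecMul y D.A₃ _).symm

/-- If `T` satisfies the last two conditions, then the overlaps are resolved by the `s_kl`. -/
lemma CondT.overlap_mem_jfilt (hR : D.R * D.R = 1) (hT : D.CondT T) (y : I × I × I → ℂ) :
    ∑ x : I × I × I, (y ᵥ* D.A₃) x •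
      (D.quad T x.1 x.2.1 * D.p x.2.2 - D.p x.1 * D.quad T x.2.1 x.2.2) ∈ D.jfilt T 2 := by
  rw [D.antisymm_overlap T _ (vecMul_A₃_R₁₂ hR y) (vecMul_A₃_R₂₃ hR y)]
  have hF : (y ᵥ* D.A₃) ᵥ* D.F T = 0 := by
    rw [Matrix.vecMul_vecMul, hT.A₃_mul_F, Matrix.vecMul_zero]
  have hc := sum_vecMul_A₃_smul_overlapConst (D := D) ((tensOne D.Z - oneTens D.Z) *ᵥ T) y
  have hm := (replicateCol_mem_Mor_iff (D := D) _).1 hT.mor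
  rw [← Matrix.mulVec_mulVec] at hm
  simp only [hm, smul_zero, Finset.sum_const_zero] at hc
  simp only [overlapConst] at hc
  rw [hF, hc, D.sum_antisymm_smul_quad T _ (vecMul_A₃_Z_R hR y)]
  simp only [Pi.zero_apply, zero_smul, Finset.sum_const_zero, map_zero, add_zero]
  exact sum_mem fun x _ => Submodule.smul_mem _ _ (s_mem_jfilt x)

lemma CondT.omega_eq_zero (hR : D.R * D.R = 1) (hT : D.CondT T) (k l : I) (b : A) :
    ∑ i, ∑ j, (D.R - 1) (k, l) (i, j) • D.omega T i j b = 0 :=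
  sum_smul_omega_of_condBimodule hR hT.bimodule k l b

/-- A two-sided ideal that contains the `s_kl` and meets `B̃¹` trivially forces the conditions
on `T`: compare the two ways of rewriting `s_kl b` and the two ways of rewriting the overlaps. -/
lemma condT_of_s_mem (hR : D.R * D.R = 1) {J : Ideal D.Tilde} [J.IsTwoSided]
    (hJ : J.restrictScalars ℂ ⊓ D.filt 1 = ⊥) (hs : ∀ kl, D.s T kl ∈ J) : D.CondT T := by
  have h0 : ∀ x ∈ J, x ∈ D.filt 1 → x = 0 := by
    intro x hx hx'
    have : x ∈ J.restrictScalars ℂ ⊓ D.filt 1 := ⟨hx, hx'⟩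
    rwa [hJ] at this
  have hsmul : ∀ (c : ℂ) x, x ∈ J → c • x ∈ J := fun c x hx =>
    (J.restrictScalars ℂ).smul_mem c hx
  have hquad : ∀ y : I × I → ℂ, y ᵥ* D.R = -y → ∑ x, y x • D.quad T x.1 x.2 ∈ J := by
    intro y hy
    rw [D.sum_antisymm_smul_quad T y hy]
    exact sum_mem fun x _ => hsmul _ _ (hs x)
  have hov : ∀ r : I × I × I, D.A₃ r ᵥ* D.F T = 0 ∧
      D.overlapConst (D.A₃ *ᵥ ((tensOne D.Z - oneTens D.Z) *ᵥ T)) r = 0 := by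
    intro r
    have hr : Pi.single r (1 : ℂ) ᵥ* D.A₃ = D.A₃ r := by simp; rfl
    have h₁ := vecMul_A₃_R₁₂ hR (Pi.single r (1 : ℂ))
    have h₂ := vecMul_A₃_R₂₃ hR (Pi.single r (1 : ℂ))
    have h₃ := vecMul_A₃_Z_R hR (Pi.single r (1 : ℂ))
    rw [hr] at h₁ h₂ h₃
    have key := D.antisymm_overlap T _ h₁ h₂
    have hl : ∑ x : I × I × I, D.A₃ r x •
        (D.quad T x.1 x.2.1 * D.p x.2.2 - D.p x.1 * D.quad T x.2.1 x.2.2) ∈ J := by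
      simp only [smul_sub, Finset.sum_sub_distrib]
      refine sub_mem ?_ ?_
      · have e : ∑ x : I × I × I, D.A₃ r x • (D.quad T x.1 x.2.1 * D.p x.2.2) =
            ∑ k, (∑ x : I × I, D.A₃ r (x.1, x.2, k) • D.quad T x.1 x.2) * D.p k := by
          simp only [Fintype.sum_prod_type, Finset.sum_mul, smul_mul_assoc]
          exact sum_rotate _
        rw [e]
        exact sum_mem fun k _ => J.mul_mem_right _ (hquad _ (antisymm_row₁₂ h₁ k))
      · have e : ∑ x : I × I × I, D.A₃ r x • (D.p x.1 * D.quad T x.2.1 x.2.2) =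
            ∑ k, D.p k * ∑ x : I × I, D.A₃ r (k, x.1, x.2) • D.quad T x.1 x.2 := by
          simp only [Fintype.sum_prod_type, Finset.mul_sum, mul_smul_comm]
        rw [e]
        exact sum_mem fun k _ => J.mul_mem_left _ (hquad _ (antisymm_row₂₃ h₂ k))
    rw [key, add_assoc] at hl
    have hl' := (Submodule.add_mem_iff_right _ (hquad _ h₃)).1 hl
    have h4 := h0 _ hl' (add_mem (sum_mem fun l _ => Submodule.smul_mem _ _
      (D.p_mem_filt l le_rfl)) (D.ι_mem_filt _ 1))
    have h5 : ∑ l, D.ι (algebraMap ℂ A ((D.A₃ r ᵥ* D.F T) l)) * D.p l +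
        D.ι (∑ x, D.A₃ r x • D.overlapConst ((tensOne D.Z - oneTens D.Z) *ᵥ T) x) = 0 := by
      rw [← h4]
      simp only [AlgHomClass.commutes, ← Algebra.smul_def, overlapConst]
    replace h5 := eq_zero_of_sum_ι_mul_p h5
    refine ⟨?_, ?_⟩
    · ext l
      exact (map_eq_zero_iff _ algebraMap_injective_of_bialgebra).1 (h5.1 l)
    · rw [← sum_A₃_smul_overlapConst]
      exact h5.2
  refine ⟨condBimodule_of_sum_smul_omega hR fun k l b => ?_, ?_, ?_⟩
  · have h1 := D.s_mul_ι hR T k l b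
    have h2 : D.ι (∑ i, ∑ j, (D.R - 1) (k, l) (i, j) • D.omega T i j b) ∈ J := by
      refine (Submodule.add_mem_iff_right J ?_).1 (h1 ▸ J.mul_mem_right _ (hs (k, l)))
      exact sum_mem fun m _ => sum_mem fun n _ => J.mul_mem_left _ (hs _)
    exact (map_eq_zero_iff D.ι ι_injective).1 (h0 _ h2 (D.ι_mem_filt _ 1))
  · ext r l
    exact congrFun (hov r).1 l
  · rw [replicateCol_mem_Mor_iff, ← Matrix.mulVec_mulVec]
    exact fun r => (hov r).2

end InhomData
end InhomQG

namespace InhomQG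
namespace InhomData

variable {A I : Type*} [Ring A] [Bialgebra ℂ A] [Fintype I] [DecidableEq I] {D : InhomData A I}
  {T : I × I → ℂ}

/-! ### The ideal generated by the `s_kl` satisfies the intrinsic condition -/

lemma CondT.mem_jfilt (hR : D.R * D.R = 1) (hT : D.CondT T) {n : ℕ} {x : D.Tilde}
    (hx : x ∈ D.idealS T) (hx' : x ∈ D.filt n) : x ∈ D.jfilt T n :=
  mem_jfilt_of_mem_idealS hR (hT.omega_eq_zero hR) (hT.overlap_mem_jfilt hR) hx hx'

lemma CondT.idealS_inf_filt_one (hR : D.R * D.R = 1) (hT : D.CondT T) :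
    (D.idealS T).restrictScalars ℂ ⊓ D.filt 1 = ⊥ := by
  rw [eq_bot_iff, ← jfilt_eq_bot (D := D) (T := T) one_lt_two]
  exact fun x hx => hT.mem_jfilt hR hx.1 hx.2

lemma CondT.J₂_idealS (hR : D.R * D.R = 1) (hT : D.CondT T) : D.J₂ (D.idealS T) =
    Submodule.span ℂ {x | ∃ (a : A) (kl : I × I), x = D.ι a * D.s T kl} := by
  apply le_antisymm
  · intro x hx
    refine jfilt_le_of_insert hR (hT.omega_eq_zero hR) ?_ (hT.mem_jfilt hR hx.1 hx.2)
    intro a u kl v h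
    obtain rfl : u = [] := List.eq_nil_of_length_eq_zero (by omega)
    obtain rfl : v = [] := List.eq_nil_of_length_eq_zero (by omega)
    simp only [word_nil, one_mul, mul_one]
    exact Submodule.subset_span ⟨a, kl, rfl⟩
  · refine Submodule.span_le.2 ?_
    rintro _ ⟨a, kl, rfl⟩
    exact ⟨Ideal.mul_mem_left _ _ (s_mem_idealS kl), D.ι_mul_mem_filt a (D.s_mem_filt T kl)⟩

lemma idealS_induction {P : D.Tilde → Prop} (J : Ideal D.Tilde) [J.IsTwoSided]
    (hJ : ∀ x, x ∈ J ↔ P x) (h : ∀ kl, P (D.s T kl)) {x : D.Tilde} (hx : x ∈ D.idealS T) : P x :=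
  (hJ x).1 (idealS_le (fun kl => (hJ _).2 (h kl)) hx)

lemma counit_p (i : I) : Coalgebra.counit (R := ℂ) (D.p i) = 0 := D.counitTilde_p i

lemma counit_s (kl : I × I) : Coalgebra.counit (R := ℂ) (D.s T kl) = 0 := by
  simp [s, Bialgebra.counit_mul, counit_p, D.isRep.counit]

lemma isCoideal_idealS (hR : D.R * D.R = 1) : ((D.idealS T).restrictScalars ℂ).IsCoideal where
  counit_eq_zero := by
    intro x hx
    refine idealS_induction (RingHom.ker (Bialgebra.counitAlgHom ℂ D.Tilde))
      (P := fun x => Coalgebra.counit (R := ℂ) x = 0) (fun x => ?_) counit_s hx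
    exact Iff.rfl
  map_mkQ_comul_eq_zero := by
    intro x hx
    refine idealS_induction (RingHom.ker ((Algebra.TensorProduct.map
      (Ideal.Quotient.mkₐ ℂ (D.idealS T)) (Ideal.Quotient.mkₐ ℂ (D.idealS T))).comp
        (Bialgebra.comulAlgHom ℂ D.Tilde)))
      (P := fun x => TensorProduct.map ((D.idealS T).restrictScalars ℂ).mkQ
        ((D.idealS T).restrictScalars ℂ).mkQ (Coalgebra.comul (R := ℂ) x) = 0)
      (fun x => Iff.rfl) (fun kl => ?_) hx
    have h0 : ∀ kl, ((D.idealS T).restrictScalars ℂ).mkQ (D.s T kl) = 0 := fun kl =>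
      (Submodule.Quotient.mk_eq_zero _).2 (s_mem_idealS kl)
    rw [← Prod.mk.eta (p := kl), D.comul_s hR]
    simp only [map_add, map_sum, TensorProduct.map_tmul, h0, TensorProduct.tmul_zero,
      TensorProduct.zero_tmul, Finset.sum_const_zero, add_zero]

lemma toGamma₂_apply (c : I × I → A) :
    D.toGamma₂ c = (D.filt 1).mkQ (∑ x : I × I, D.ι (c x) * (D.p x.1 * D.p x.2)) := by
  simp [toGamma₂, ι_eq, mul_assoc]

/-- The leading part of `s` is `(R - 1) (p̃ ⊗ p̃)`. -/
lemma mkQ_sum_ι_mul_s (c : I × I → A) :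
    (D.filt 1).mkQ (∑ x, D.ι (c x) * D.s T x) = D.toGamma₂ (c ᵥ* scal A (D.R - 1)) := by
  have h1 : ∀ x : I × I, D.s T x =
      ∑ z : I × I, (D.R - 1) x z • (D.p z.1 * D.p z.2) + D.sTail T x.1 x.2 := by
    intro x
    have := D.p_mul_p_add_s T x.1 x.2
    rw [← eq_sub_iff_add_eq'] at this
    rw [← Prod.mk.eta (p := x), this]
    simp only [Matrix.sub_apply, sub_smul, Finset.sum_sub_distrib, Matrix.one_apply, ite_smul,
      one_smul, zero_smul, Finset.sum_ite_eq, Finset.mem_univ, if_true]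
    abel
  have h2 : ∑ x : I × I, D.ι (c x) * D.s T x =
      ∑ z : I × I, D.ι ((c ᵥ* scal A (D.R - 1)) z) * (D.p z.1 * D.p z.2) +
        ∑ x : I × I, D.ι (c x) * D.sTail T x.1 x.2 := by
    simp only [h1, mul_add, Finset.sum_add_distrib]
    congr 1
    simp only [Matrix.vecMul, dotProduct, map_sum, Finset.sum_mul, Finset.mul_sum, scal,
      Matrix.map_apply]
    rw [Finset.sum_comm]
    refine Finset.sum_congr rfl fun z _ => Finset.sum_congr rfl fun x _ => ?_
    rw [← Algebra.commutes, ← Algebra.smul_def, map_smul, smul_mul_assoc, mul_smul_comm]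
  have h3 : (D.filt 1).mkQ (∑ x : I × I, D.ι (c x) * D.sTail T x.1 x.2) = 0 :=
    (Submodule.Quotient.mk_eq_zero _).2
      (sum_mem fun x _ => D.ι_mul_mem_filt _ (D.sTail_mem T x.1 x.2))
  rw [h2, map_add, h3, add_zero, toGamma₂_apply]

lemma mem_ker_braiding_add_id {c : I × I → A} :
    c ∈ LinearMap.ker (D.braiding + LinearMap.id) ↔ c ᵥ* scal A D.R = -c := by
  rw [LinearMap.mem_ker, eq_neg_iff_add_eq_zero]
  rfl

lemma scal_sub_one : scal A (D.R - 1) = scal A D.R - 1 := by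
  ext x y
  simp [scal, Matrix.one_apply]

/-- Whatever `T` is, the image of `A · span {s_kl}` in `B̃²/B̃¹` is `ker (ρ + id)`: both are the range of
`ρ - id`, as `ρ² = id`. -/
lemma map_span_ι_mul_s (hR : D.R * D.R = 1) :
    (Submodule.span ℂ {x | ∃ (a : A) (kl : I × I), x = D.ι a * D.s T kl}).map (D.filt 1).mkQ =
      ((LinearMap.ker (D.braiding + LinearMap.id)).restrictScalars ℂ).map D.toGamma₂ := by
  have hRA : scal A D.R * scal A D.R = 1 := by
    rw [← scal_mul, hR]; simp [scal]
  apply le_antisymm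
  · rw [Submodule.map_span_le]
    rintro _ ⟨a, kl, rfl⟩
    have h := mkQ_sum_ι_mul_s (T := T) (D := D) (Pi.single kl a)
    rw [Finset.sum_eq_single kl (fun x _ hx => by simp [hx]) (by simp), Pi.single_eq_same] at h
    rw [h]
    refine ⟨_, mem_ker_braiding_add_id.2 ?_, rfl⟩
    rw [Matrix.vecMul_vecMul, scal_sub_one, sub_mul, hRA, one_mul, ← Matrix.vecMul_neg, neg_sub]
  · rintro _ ⟨c, hc, rfl⟩
    have hc' := mem_ker_braiding_add_id.1 hc
    refine ⟨∑ x, D.ι ((-(1 / 2 : ℂ)) • c x) * D.s T x, ?_, ?_⟩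
    · exact sum_mem fun x _ => Submodule.subset_span ⟨_, x, rfl⟩
    · have h := mkQ_sum_ι_mul_s (T := T) (D := D) ((-(1 / 2 : ℂ)) • c)
      refine h.trans (congrArg _ ?_)
      rw [scal_sub_one, Matrix.vecMul_sub, Matrix.vecMul_one, Matrix.smul_vecMul, hc']
      module

theorem CondT.condI (hR : D.R * D.R = 1) (hT : D.CondT T) : D.CondI (D.idealS T) where
  isTwoSided := inferInstance
  isCoideal := isCoideal_idealS hR
  inf_filt_one := hT.idealS_inf_filt_one hR
  eq_ker := by rw [hT.J₂_idealS hR, map_span_ι_mul_s hR]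

/-! ### The quotient bialgebra -/

lemma map_mem_adjoin_ι_p {B : Type*} [Ring B] [Algebra ℂ B] (g : D.Tilde →ₐ[ℂ] B)
    (x : D.Tilde) :
    g x ∈ Algebra.adjoin ℂ (Set.range (fun a => g (D.ι a)) ∪ Set.range fun i => g (D.p i)) := by
  obtain ⟨k, hk⟩ := D.exists_mem_filt x
  refine D.filt_induction (P := fun x => g x ∈ Algebra.adjoin ℂ
    (Set.range (fun a => g (D.ι a)) ∪ Set.range fun i => g (D.p i))) ?_ ?_ ?_ hk
  · simp
  · intro x y hx hy
    rw [map_add]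
    exact add_mem hx hy
  · intro a l h
    clear h
    rw [map_mul]
    refine mul_mem (Algebra.subset_adjoin (Or.inl ⟨a, rfl⟩)) ?_
    induction l with
    | nil => simp
    | cons i l ih =>
      rw [word_cons, map_mul]
      exact mul_mem (Algebra.subset_adjoin (Or.inr ⟨i, rfl⟩)) ih

theorem CondI.quotientIsInhomogeneous [Nonempty I] {J : Ideal D.Tilde} (hJ : D.CondI J) :
    D.QuotientIsInhomogeneous J := by
  have := hJ.isTwoSided
  have := hJ.isCoideal
  have h0 : ∀ x ∈ J, x ∈ D.filt 1 → x = 0 := by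
    intro x hx hx'
    have : x ∈ J.restrictScalars ℂ ⊓ D.filt 1 := ⟨hx, hx'⟩
    rwa [hJ.inf_filt_one] at this
  refine ⟨inferInstance, inferInstance, ?_⟩
  set π : D.Tilde →ₐc[ℂ] D.Tilde ⧸ J := Bialgebra.Quotient.mkBialgHom (R := ℂ) J with hπ
  have hπ0 : ∀ x, π x = 0 ↔ x ∈ J := fun x => Ideal.Quotient.eq_zero_iff_mem
  have hcomul : ∀ x, Coalgebra.comul (R := ℂ) (π x) =
      TensorProduct.map (π : D.Tilde →ₗ[ℂ] D.Tilde ⧸ J) (π : D.Tilde →ₗ[ℂ] D.Tilde ⧸ J)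
        (Coalgebra.comul (R := ℂ) x) := fun x => (CoalgHomClass.map_comp_comul_apply π x).symm
  have hcounit : ∀ x, Coalgebra.counit (R := ℂ) (π x) = Coalgebra.counit (R := ℂ) x := fun x =>
    CoalgHomClass.counit_comp_apply π x
  change IsInhomogeneous D.Λ (π.comp D.ι) (fun s => π (D.p s))
  refine ⟨?_, ?_, ⟨?_, ?_⟩, ?_, ?_⟩
  · rw [eq_top_iff]
    rintro y -
    obtain ⟨x, rfl⟩ := Ideal.Quotient.mk_surjective y
    exact map_mem_adjoin_ι_p (π : D.Tilde →ₐ[ℂ] D.Tilde ⧸ J) x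
  · rw [injective_iff_map_eq_zero]
    intro a ha
    exact (map_eq_zero_iff D.ι ι_injective).1 (h0 _ ((hπ0 _).1 ha) (D.ι_mem_filt a 1))
  · rintro (i | i) (j | j)
    · simp [Matrix.fromBlocks, hcomul, comul_ι_Λ]
    · simp [Matrix.fromBlocks, hcomul, comul_p]
    · simp [Matrix.fromBlocks]
    · simp [Matrix.fromBlocks, Algebra.TensorProduct.one_def]
  · rintro (i | i) (j | j)
    · simp [Matrix.fromBlocks, hcounit, D.isRep.counit]
    · simp [Matrix.fromBlocks, hcounit, counit_p]
    · simp [Matrix.fromBlocks]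
    · simp [Matrix.fromBlocks]
  · obtain ⟨s⟩ := ‹Nonempty I›
    refine ⟨s, ?_⟩
    rintro ⟨a, ha⟩
    have h1 : D.p s - D.ι a ∈ J := by
      rw [← hπ0, map_sub, sub_eq_zero]
      exact ha.symm
    have h2 := h0 _ h1 (sub_mem (D.p_mem_filt s le_rfl) (D.ι_mem_filt a 1))
    have h3 : ∑ l, D.ι (Pi.single (M := fun _ => A) s 1 l) * D.p l + D.ι (-a) = 0 := by
      rw [Finset.sum_eq_single s (fun x _ hx => by simp [hx]) (by simp), ← h2]
      simp [sub_eq_add_neg]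
    have h4 := (eq_zero_of_sum_ι_mul_p h3).1 s
    rw [Pi.single_eq_same] at h4
    have := congrArg (Coalgebra.counit (R := ℂ)) h4
    simp at this
  · intro x hx a
    have hle : Gamma (π.comp D.ι) (fun s => π (D.p s)) ≤
        (Gamma (π.comp D.ι) (fun s => π (D.p s))).comap
          (LinearMap.mulRight ℂ ((π.comp D.ι) a)) := by
      have hι : ∀ b, π (D.ι b) ∈ Gamma (π.comp D.ι) (fun s => π (D.p s)) := fun b =>
        Submodule.mem_sup_right (Submodule.subset_span ⟨b, rfl⟩)
      refine sup_le (Submodule.span_le.2 ?_) (Submodule.span_le.2 ?_)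
      · rintro _ ⟨b, s, rfl⟩
        change π (D.ι b) * π (D.p s) * π (D.ι a) ∈ Gamma (π.comp D.ι) (fun s => π (D.p s))
        rw [← map_mul, ← map_mul, mul_assoc, D.p_mul_ι']
        simp only [mul_add, Finset.mul_sum, ← mul_assoc, ← map_mul, map_add, map_sum]
        refine add_mem (sum_mem fun t _ => ?_) (hι _)
        rw [map_mul π]
        exact Submodule.mem_sup_left (Submodule.subset_span ⟨_, t, rfl⟩)
      · rintro _ ⟨b, rfl⟩
        change π (D.ι b) * π (D.ι a) ∈ Gamma (π.comp D.ι) (fun s => π (D.p s))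
        rw [← map_mul, ← map_mul]
        exact hι _
    exact hle hx

end InhomData
end InhomQG

namespace InhomQG
namespace InhomData

variable {A I : Type*} [Ring A] [Bialgebra ℂ A] [Fintype I] [DecidableEq I] {D : InhomData A I}
  {T : I × I → ℂ}

/-! ### Coefficient functionals and the lower-order terms of quadratic elements of `J` -/

lemma exists_of_mem_filt_one {x : D.Tilde} (hx : x ∈ D.filt 1) :
    ∃ (c : I → A) (d : A), x = ∑ l, D.ι (c l) * D.p l + D.ι d := by
  refine D.filt_induction (P := fun x => ∃ (c : I → A) (d : A),
    x = ∑ l, D.ι (c l) * D.p l + D.ι d) ⟨0, 0, by simp⟩ ?_ ?_ hx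
  · rintro x y ⟨c, d, rfl⟩ ⟨c', d', rfl⟩
    refine ⟨c + c', d + d', ?_⟩
    simp only [Pi.add_apply, map_add, add_mul, Finset.sum_add_distrib]
    abel
  · intro a l hl
    match l, hl with
    | [], _ => exact ⟨0, a, by simp⟩
    | [i], _ =>
      refine ⟨Pi.single i a, 0, ?_⟩
      rw [Finset.sum_eq_single i (fun x _ hx => by simp [hx]) (by simp)]
      simp
    | _ :: _ :: _, h => simp at h

/-- As `J` meets `B̃¹` trivially, the coefficients of an element of `B̃¹` extend to linear maps on
`B̃` that vanish on `J`. -/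
lemma exists_coeff {J : Ideal D.Tilde} (hJ : J.restrictScalars ℂ ⊓ D.filt 1 = ⊥) :
    ∃ (μ : I → D.Tilde →ₗ[ℂ] A) (μ₀ : D.Tilde →ₗ[ℂ] A),
      (∀ t, ∀ x ∈ J, μ t x = 0) ∧ (∀ x ∈ J, μ₀ x = 0) ∧
      (∀ t a, μ t (D.ι a) = 0) ∧ (∀ t a s, μ t (D.ι a * D.p s) = if s = t then a else 0) ∧
      (∀ a, μ₀ (D.ι a) = a) ∧ ∀ a s, μ₀ (D.ι a * D.p s) = 0 := by
  let G₀ : (I → A) × A →ₗ[ℂ] D.Tilde := LinearMap.coprod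
    (∑ l, (LinearMap.mulRight ℂ (D.p l) ∘ₗ D.ιAlg.toLinearMap) ∘ₗ LinearMap.proj l)
    D.ιAlg.toLinearMap
  have hG₀ : ∀ c d, G₀ (c, d) = ∑ l, D.ι (c l) * D.p l + D.ι d := by
    intro c d
    simp [G₀, ι_eq]
  let G : (I → A) × A →ₗ[ℂ] D.Tilde ⧸ J.restrictScalars ℂ := (J.restrictScalars ℂ).mkQ ∘ₗ G₀
  have hG : LinearMap.ker G = ⊥ := by
    rw [LinearMap.ker_eq_bot']
    rintro ⟨c, d⟩ h
    have h1 : G₀ (c, d) ∈ J.restrictScalars ℂ := (Submodule.Quotient.mk_eq_zero _).1 h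
    have h2 : G₀ (c, d) ∈ J.restrictScalars ℂ ⊓ D.filt 1 := by
      refine ⟨h1, ?_⟩
      rw [hG₀]
      exact add_mem (sum_mem fun l _ => D.ι_mul_mem_filt _ (D.p_mem_filt l le_rfl))
        (D.ι_mem_filt d 1)
    rw [hJ, Submodule.mem_bot, hG₀] at h2
    obtain ⟨h3, h4⟩ := eq_zero_of_sum_ι_mul_p h2
    exact Prod.ext (funext h3) h4
  obtain ⟨L, hL⟩ := LinearMap.exists_leftInverse_of_injective G hG
  have hL' : ∀ c d, L ((J.restrictScalars ℂ).mkQ (∑ l, D.ι (c l) * D.p l + D.ι d)) = (c, d) := by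
    intro c d
    rw [← hG₀]
    exact LinearMap.congr_fun hL (c, d)
  have hι : ∀ a, L ((J.restrictScalars ℂ).mkQ (D.ι a)) = (0, a) := by
    intro a
    rw [← hL' 0 a]; simp
  have hp : ∀ a s, L ((J.restrictScalars ℂ).mkQ (D.ι a * D.p s)) = (Pi.single s a, 0) := by
    intro a s
    rw [← hL' _ 0, Finset.sum_eq_single s (fun x _ hx => by simp [hx]) (by simp)]
    simp
  have h0 : ∀ x ∈ J, (J.restrictScalars ℂ).mkQ x = 0 := fun x hx =>
    (Submodule.Quotient.mk_eq_zero _).2 hx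
  refine ⟨fun t => LinearMap.proj t ∘ₗ LinearMap.fst ℂ (I → A) A ∘ₗ L ∘ₗ (J.restrictScalars ℂ).mkQ,
    LinearMap.snd ℂ (I → A) A ∘ₗ L ∘ₗ (J.restrictScalars ℂ).mkQ, ?_, ?_, ?_, ?_, ?_, ?_⟩
  · intro t x hx
    simp only [LinearMap.comp_apply, h0 x hx, map_zero]
  · intro x hx
    simp only [LinearMap.comp_apply, h0 x hx, map_zero]
  · intro t a
    simp only [LinearMap.comp_apply, hι]
    simp
  · intro t a s
    simp only [LinearMap.comp_apply, hp]
    simp [Pi.single_apply, eq_comm]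
  · intro a
    simp only [LinearMap.comp_apply, hι]
    simp
  · intro a s
    simp only [LinearMap.comp_apply, hp]
    simp

/-- Linear maps that vanish on a coideal pair to zero on its coproducts. -/
lemma map_comul_eq_zero {J : Ideal D.Tilde} (hJ : (J.restrictScalars ℂ).IsCoideal)
    {M N : Type*} [AddCommGroup M] [Module ℂ M] [AddCommGroup N] [Module ℂ N]
    (μ : D.Tilde →ₗ[ℂ] M) (ν : D.Tilde →ₗ[ℂ] N) (hμ : ∀ x ∈ J, μ x = 0) (hν : ∀ x ∈ J, ν x = 0)
    {x : D.Tilde} (hx : x ∈ J) : TensorProduct.map μ ν (Coalgebra.comul (R := ℂ) x) = 0 := by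
  have h := hJ.map_mkQ_comul_eq_zero (x := x) hx
  have hμ' : μ = (J.restrictScalars ℂ).liftQ μ hμ ∘ₗ (J.restrictScalars ℂ).mkQ :=
    ((J.restrictScalars ℂ).liftQ_mkQ μ hμ).symm
  have hν' : ν = (J.restrictScalars ℂ).liftQ ν hν ∘ₗ (J.restrictScalars ℂ).mkQ :=
    ((J.restrictScalars ℂ).liftQ_mkQ ν hν).symm
  rw [hμ', hν', TensorProduct.map_comp, LinearMap.comp_apply, h, map_zero]

lemma map_ι_mul_tmul {M N : Type*} [AddCommGroup M] [Module ℂ M] [AddCommGroup N] [Module ℂ N]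
    {μ : D.Tilde →ₗ[ℂ] M} {ν : D.Tilde →ₗ[ℂ] N} {x y : D.Tilde} (f : A →ₗ[ℂ] M) (g : A →ₗ[ℂ] N)
    (hf : ∀ a, μ (D.ι a * x) = f a) (hg : ∀ a, ν (D.ι a * y) = g a) (w : A ⊗[ℂ] A) :
    TensorProduct.map μ ν (Algebra.TensorProduct.map D.ιAlg D.ιAlg w * x ⊗ₜ[ℂ] y) =
      TensorProduct.map f g w := by
  induction w with
  | zero => simp
  | add u v hu hv => simp only [map_add, add_mul, hu, hv]
  | tmul a b =>
    rw [Algebra.TensorProduct.map_tmul, Algebra.TensorProduct.tmul_mul_tmul,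
      TensorProduct.map_tmul, TensorProduct.map_tmul, ← hf, ← hg]
    rfl

lemma map_comul_ι {M N : Type*} [AddCommGroup M] [Module ℂ M] [AddCommGroup N] [Module ℂ N]
    {μ : D.Tilde →ₗ[ℂ] M} {ν : D.Tilde →ₗ[ℂ] N} (f : A →ₗ[ℂ] M) (g : A →ₗ[ℂ] N)
    (hf : ∀ a, μ (D.ι a) = f a) (hg : ∀ a, ν (D.ι a) = g a) (a : A) :
    TensorProduct.map μ ν (Coalgebra.comul (R := ℂ) (D.ι a)) =
      TensorProduct.map f g (Coalgebra.comul (R := ℂ) a) := by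
  rw [comul_ι, ← map_ι_mul_tmul (D := D) (μ := μ) (ν := ν) (x := 1) (y := 1) f g
    (by simpa using hf) (by simpa using hg), ← Algebra.TensorProduct.one_def, mul_one]

lemma comul_ι_mul_p (a : A) (i : I) : Coalgebra.comul (R := ℂ) (D.ι a * D.p i) =
    ∑ t, Algebra.TensorProduct.map D.ιAlg D.ιAlg (Coalgebra.comul (R := ℂ) a) *
      D.ι (D.Λ i t) ⊗ₜ[ℂ] D.p t +
    Algebra.TensorProduct.map D.ιAlg D.ιAlg (Coalgebra.comul (R := ℂ) a) * D.p i ⊗ₜ[ℂ] 1 := by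
  rw [Bialgebra.comul_mul, comul_ι, comul_p, mul_add, Finset.mul_sum]

/-- The coideal condition determines the coproducts of the coefficients of the lower-order terms
of the quadratic elements of `J`. -/
lemma comul_lower_terms (hR : D.R * D.R = 1) {J : Ideal D.Tilde}
    (hJ : J.restrictScalars ℂ ⊓ D.filt 1 = ⊥) (hJ' : (J.restrictScalars ℂ).IsCoideal)
    {c : I × I → I → A} {d : I × I → A}
    (h : ∀ x, D.s 0 x + (∑ l, D.ι (c x l) * D.p l + D.ι (d x)) ∈ J) :
    (∀ x t, Coalgebra.comul (R := ℂ) (c x t) = c x t ⊗ₜ[ℂ] (1 : A)) ∧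
    (∀ x r, ∑ t, Coalgebra.comul (R := ℂ) (c x t) * D.Λ t r ⊗ₜ[ℂ] (1 : A) =
      ∑ z, (D.Λ ⊗ₖ D.Λ) x z ⊗ₜ[ℂ] c z r) ∧
    ∀ x, Coalgebra.comul (R := ℂ) (d x) =
      ∑ z, (D.Λ ⊗ₖ D.Λ) x z ⊗ₜ[ℂ] d z + d x ⊗ₜ[ℂ] (1 : A) := by
  obtain ⟨μ, μ₀, hμJ, hμ₀J, hμι, hμp, hμ₀ι, hμ₀p⟩ := exists_coeff hJ
  have key : ∀ (α β : D.Tilde →ₗ[ℂ] A), (∀ x ∈ J, α x = 0) → (∀ x ∈ J, β x = 0) → ∀ x,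
      TensorProduct.map α β (Coalgebra.comul (R := ℂ) (∑ l, D.ι (c x l) * D.p l + D.ι (d x))) =
      ∑ z, α (D.ι ((D.Λ ⊗ₖ D.Λ) x z)) ⊗ₜ[ℂ] β (∑ l, D.ι (c z l) * D.p l + D.ι (d z)) +
        α (∑ l, D.ι (c x l) * D.p l + D.ι (d x)) ⊗ₜ[ℂ] β 1 := by
    intro α β hα hβ x
    have h1 := map_comul_eq_zero hJ' α β hα hβ (h x)
    have hα' : ∀ x, α (D.s 0 x) = -α (∑ l, D.ι (c x l) * D.p l + D.ι (d x)) := fun x =>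
      eq_neg_of_add_eq_zero_left (by rw [← map_add]; exact hα _ (h x))
    have hβ' : ∀ x, β (D.s 0 x) = -β (∑ l, D.ι (c x l) * D.p l + D.ι (d x)) := fun x =>
      eq_neg_of_add_eq_zero_left (by rw [← map_add]; exact hβ _ (h x))
    rw [map_add, map_add, ← Prod.mk.eta (p := x), D.comul_s hR, Prod.mk.eta] at h1
    simp only [map_add, map_sum (TensorProduct.map α β), TensorProduct.map_tmul] at h1
    rw [hα'] at h1
    simp only [hβ', TensorProduct.tmul_neg, TensorProduct.neg_tmul, Finset.sum_neg_distrib] at h1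
    rw [← neg_add, neg_add_eq_zero] at h1
    rw [map_add, map_add, ← h1, Fintype.sum_prod_type]
    simp only [Matrix.kroneckerMap_apply, map_add, map_sum]
  -- `μ_t` extracts the coefficient of `p̃_t` and `μ₀` the constant term; the three claims come from
  -- the pairs `(μ_t, μ₀)`, `(μ₀, μ_r)` and `(μ₀, μ₀)`.
  have h1 : ∀ (f : D.Tilde →ₗ[ℂ] A), f 1 = f (D.ι 1) := fun f => by rw [map_one D.ι]
  refine ⟨fun x t => ?_, fun x r => ?_, fun x => ?_⟩
  · have e := key (μ t) μ₀ (hμJ t) hμ₀J x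
    simp only [map_add, map_sum, comul_ι_mul_p, h1 μ₀, hμι, hμp, hμ₀ι, hμ₀p,
      map_comul_ι (D := D) (μ := μ t) (ν := μ₀) 0 LinearMap.id (hμι t) hμ₀ι] at e
    have e1 : ∀ l w, TensorProduct.map (μ t) μ₀ (Algebra.TensorProduct.map D.ιAlg D.ιAlg w *
        D.p l ⊗ₜ[ℂ] 1) = if l = t then w else 0 := by
      intro l w
      rw [map_ι_mul_tmul (if l = t then LinearMap.id else 0) LinearMap.id]
      · split_ifs <;> simp
      · intro a
        rw [hμp]
        split_ifs <;> rfl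
      · simpa using hμ₀ι
    have e2 : ∀ l r w, TensorProduct.map (μ t) μ₀ (Algebra.TensorProduct.map D.ιAlg D.ιAlg w *
        D.ι (D.Λ l r) ⊗ₜ[ℂ] D.p r) = 0 := by
      intro l r w
      rw [map_ι_mul_tmul 0 0]
      · simp
      · intro a
        rw [← map_mul, hμι]
        rfl
      · intro a
        rw [hμ₀p]
        rfl
    simpa [e1, e2] using e
  · have e := key μ₀ (μ r) hμ₀J (hμJ r) x
    simp only [map_add, map_sum, comul_ι_mul_p, h1 (μ r), hμι, hμp, hμ₀ι, hμ₀p,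
      map_comul_ι (D := D) (μ := μ₀) (ν := μ r) LinearMap.id 0 hμ₀ι (hμι r)] at e
    have e1 : ∀ l w, TensorProduct.map μ₀ (μ r) (Algebra.TensorProduct.map D.ιAlg D.ιAlg w *
        D.p l ⊗ₜ[ℂ] 1) = 0 := by
      intro l w
      rw [map_ι_mul_tmul 0 0]
      · simp
      · intro a
        rw [hμ₀p]
        rfl
      · intro a
        rw [mul_one, hμι]
        rfl
    have e2 : ∀ l q w, TensorProduct.map μ₀ (μ r) (Algebra.TensorProduct.map D.ιAlg D.ιAlg w *
        D.ι (D.Λ l q) ⊗ₜ[ℂ] D.p q) = if q = r then w * D.Λ l r ⊗ₜ[ℂ] (1 : A) else 0 := by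
      intro l q w
      rw [map_ι_mul_tmul (LinearMap.mulRight ℂ (D.Λ l q)) (if q = r then LinearMap.id else 0)]
      · split_ifs with hq
        · subst hq
          induction w with
          | zero => simp
          | add u v hu hv => simp only [map_add, add_mul, hu, hv]
          | tmul a b => simp
        · simp
      · intro a
        rw [← map_mul, hμ₀ι]
        rfl
      · intro a
        rw [hμp]
        split_ifs <;> rfl
    simpa [e1, e2] using e
  · have e := key μ₀ μ₀ hμ₀J hμ₀J x
    simp only [map_add, map_sum, comul_ι_mul_p, h1 μ₀, hμ₀ι, hμ₀p,
      map_comul_ι (D := D) (μ := μ₀) (ν := μ₀) LinearMap.id LinearMap.id hμ₀ι hμ₀ι] at e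
    have e1 : ∀ l w, TensorProduct.map μ₀ μ₀ (Algebra.TensorProduct.map D.ιAlg D.ιAlg w *
        D.p l ⊗ₜ[ℂ] 1) = 0 := by
      intro l w
      rw [map_ι_mul_tmul 0 LinearMap.id]
      · simp
      · intro a
        rw [hμ₀p]
        rfl
      · simpa using hμ₀ι
    have e2 : ∀ l q w, TensorProduct.map μ₀ μ₀ (Algebra.TensorProduct.map D.ιAlg D.ιAlg w *
        D.ι (D.Λ l q) ⊗ₜ[ℂ] D.p q) = 0 := by
      intro l q w
      rw [map_ι_mul_tmul (LinearMap.mulRight ℂ (D.Λ l q)) 0]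
      · simp
      · intro a
        rw [← map_mul, hμ₀ι]
        rfl
      · intro a
        rw [hμ₀p]
        rfl
    simpa [e1, e2] using e

end InhomData
end InhomQG

namespace InhomQG

/-! ### Consequences of complete reducibility and of the vanishing of intertwiners -/

section Reps

variable {C : Type*} [Ring C] [Bialgebra ℂ C]

lemma eq_algebraMap_of_comul_eq {c : C} (h : Coalgebra.comul (R := ℂ) c = c ⊗ₜ[ℂ] (1 : C)) :
    c = algebraMap ℂ C (Coalgebra.counit (R := ℂ) c) := by
  have h1 := congrArg (fun z => TensorProduct.lid ℂ C (Coalgebra.counit.rTensor C z)) h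
  simpa [Algebra.algebraMap_eq_smul_one] using h1

lemma IsRep.submatrix {m n : Type*} [Fintype m] [DecidableEq m] [Fintype n] [DecidableEq n]
    {v : Matrix n n C} (hv : IsRep v) (e : m ≃ n) : IsRep (v.submatrix e e) where
  comul i j := by
    simp only [Matrix.submatrix_apply, hv.comul]
    exact (Equiv.sum_comp e fun k => v (e i) k ⊗ₜ[ℂ] v k (e j)).symm
  counit i j := by simp [hv.counit]

lemma IsIrreducible.submatrix {m n : Type*} [Fintype m] [DecidableEq m] [Fintype n]
    [DecidableEq n] {v : Matrix n n C} (hv : IsIrreducible v) (e : m ≃ n) :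
    IsIrreducible (v.submatrix e e) := by
  obtain ⟨h1, ⟨i⟩, h3⟩ := hv
  refine ⟨h1.submatrix e, ⟨e.symm i⟩, fun W hW => ?_⟩
  let E := LinearEquiv.funCongrLeft ℂ ℂ e
  have hE : W = (W.comap (E : (n → ℂ) →ₗ[ℂ] m → ℂ)).map (E : (n → ℂ) →ₗ[ℂ] m → ℂ) :=
    (Submodule.map_comap_eq_of_surjective E.surjective W).symm
  have hW' : IsInvariant v (W.comap (E : (n → ℂ) →ₗ[ℂ] m → ℂ)) := by
    intro φ x hx
    have := hW φ _ hx
    have e1 : ((v.submatrix e e).map φ) *ᵥ (E x) = E ((v.map φ) *ᵥ x) := by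
      ext k
      simp only [Matrix.mulVec, dotProduct, Matrix.map_apply, Matrix.submatrix_apply]
      exact Equiv.sum_comp e fun l => φ (v (e k) l) * x l
    rw [Submodule.mem_comap]
    exact e1 ▸ this
  rcases h3 _ hW' with h | h
  · left; rw [hE, h, Submodule.map_bot]
  · right; rw [hE, h, Submodule.map_top, LinearMap.range_eq_top]; exact E.surjective

lemma isIrreducible_one : IsIrreducible (1 : Matrix (Fin 1) (Fin 1) C) := by
  refine ⟨⟨fun i j => ?_, fun i j => ?_⟩, ⟨0⟩, fun W _ => ?_⟩
  · rw [Subsingleton.elim i 0, Subsingleton.elim j 0]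
    simp [Algebra.TensorProduct.one_def]
  · rw [Subsingleton.elim i 0, Subsingleton.elim j 0]
    simp
  · refine (eq_or_ne W ⊥).imp_right fun hW => ?_
    obtain ⟨x, hx, hx0⟩ := (Submodule.ne_bot_iff W).1 hW
    have hx0' : x 0 ≠ 0 := fun h => hx0 (by ext i; fin_cases i; exact h)
    rw [eq_top_iff]
    intro y _
    have : y = (y 0 / x 0) • x := by
      ext i
      fin_cases i
      simp [hx0']
    rw [this]
    exact W.smul_mem _ hx

/-- A one-cocycle with values in a representation is a coboundary: split the extension of the
trivial representation that it defines. -/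
lemma IsRep.exists_coboundary
    (ha : ∀ (n : ℕ) (v : Matrix (Fin n) (Fin n) C), IsRep v → IsCompletelyReducible v)
    {n : Type*} [Fintype n] [DecidableEq n] {v : Matrix n n C} (hv : IsRep v) {d : n → C}
    (hd : ∀ k, Coalgebra.comul (R := ℂ) (d k) = ∑ m, v k m ⊗ₜ[ℂ] d m + d k ⊗ₜ[ℂ] (1 : C)) :
    ∃ u : n → ℂ, ∀ k, d k = algebraMap ℂ C (u k) - ∑ m, u m • v k m := by
  have hε : ∀ k, Coalgebra.counit (R := ℂ) (d k) = 0 := by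
    intro k
    have h := congrArg (fun z => Coalgebra.counit (R := ℂ)
      (TensorProduct.lid ℂ C (Coalgebra.counit.rTensor C z))) (hd k)
    simpa [hv.counit] using h
  let V : Matrix (n ⊕ Unit) (n ⊕ Unit) C :=
    Matrix.fromBlocks v (Matrix.replicateCol Unit d) 0 1
  have hV : IsRep V := by
    refine ⟨?_, ?_⟩
    · rintro (i | i) (j | j) <;> simp [V, hv.comul, hd, Algebra.TensorProduct.one_def]
    · rintro (i | i) (j | j) <;> simp [V, hv.counit, hε]
  let e : Fin (Fintype.card (n ⊕ Unit)) ≃ n ⊕ Unit := (Fintype.equivFin _).symm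
  have hmul : ∀ (φ : C →ₗ[ℂ] ℂ) (y : Fin (Fintype.card (n ⊕ Unit)) → ℂ) k,
      (((V.submatrix e e).map φ) *ᵥ y) (e.symm k) =
        ∑ l, φ (V k l) * y (e.symm l) := by
    intro φ y k
    simp only [Matrix.mulVec, dotProduct, Matrix.map_apply, Matrix.submatrix_apply,
      Equiv.apply_symm_apply]
    rw [← Equiv.sum_comp e fun l => φ (V k l) * y (e.symm l)]
    simp
  let W : Submodule ℂ (Fin (Fintype.card (n ⊕ Unit)) → ℂ) :=
    LinearMap.ker (LinearMap.proj (e.symm (Sum.inr ())))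
  have hW : IsInvariant (V.submatrix e e) W := by
    intro φ x hx
    have hx' : x (e.symm (Sum.inr ())) = 0 := hx
    change (((V.submatrix e e).map φ) *ᵥ x) (e.symm (Sum.inr ())) = 0
    rw [hmul]
    simp [V, hx']
  obtain ⟨W', hW', hcompl⟩ := ha _ _ (hV.submatrix e) W hW
  have htop : Pi.single (e.symm (Sum.inr ())) (1 : ℂ) ∈ W ⊔ W' := by
    rw [hcompl.sup_eq_top]; trivial
  obtain ⟨w, hw, w', hw', hsum⟩ := Submodule.mem_sup.1 htop
  have hw0 : w (e.symm (Sum.inr ())) = 0 := hw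
  have hw1 : w' (e.symm (Sum.inr ())) = 1 := by
    have := congrFun hsum (e.symm (Sum.inr ()))
    simpa [hw0] using this
  refine ⟨fun k => w' (e.symm (Sum.inl k)), fun k => ?_⟩
  rw [← sub_eq_zero, ← Module.forall_dual_apply_eq_zero_iff ℂ]
  intro φ
  have h1 : ((V.submatrix e e).map φ) *ᵥ w' - φ 1 • w' ∈ W' :=
    sub_mem (hW' φ w' hw') (W'.smul_mem _ hw')
  have h2 : ((V.submatrix e e).map φ) *ᵥ w' - φ 1 • w' ∈ W := by
    change (((V.submatrix e e).map φ) *ᵥ w' - φ 1 • w') (e.symm (Sum.inr ())) = 0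
    rw [Pi.sub_apply, hmul]
    simp [V, hw1]
  have h3 := congrFun ((Submodule.disjoint_def.1 hcompl.disjoint) _ h2 h1) (e.symm (Sum.inl k))
  rw [Pi.sub_apply, hmul] at h3
  simp only [Fintype.sum_sum_type, V, Matrix.fromBlocks_apply₁₁, Matrix.fromBlocks_apply₁₂,
    Matrix.replicateCol_apply, Finset.univ_unique, Finset.sum_singleton, PUnit.default_eq_unit,
    hw1, mul_one, Pi.smul_apply, smul_eq_mul, Pi.zero_apply] at h3
  simp only [map_sub, map_sum, map_smul, smul_eq_mul, Algebra.algebraMap_eq_smul_one]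
  rw [← h3]
  have : ∑ x, φ (v k x) * w' (e.symm (Sum.inl x)) = ∑ x, w' (e.symm (Sum.inl x)) * φ (v k x) :=
    Finset.sum_congr rfl fun _ _ => mul_comm _ _
  rw [this]
  ring

end Reps

namespace InhomData

variable {A I : Type*} [Ring A] [Bialgebra ℂ A] [Fintype I] [DecidableEq I] {D : InhomData A I}
  {T : I × I → ℂ}

/-- The case `v = Λ`, `w = I` of the vanishing of intertwiners. -/
lemma eq_zero_of_mem_Mor (hb : IsIrreducible D.Λ)
    (hc : ∀ (m n : ℕ) (v : Matrix (Fin m) (Fin m) A) (w : Matrix (Fin n) (Fin n) A),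
      IsIrreducible v → IsIrreducible w →
        Mor (Matrix.kronecker v w) (Matrix.kronecker D.Λ (Matrix.kronecker v w)) = {0})
    {X : Matrix (I × I) I ℂ} (hX : X ∈ Mor D.Λ (D.Λ ⊗ₖ D.Λ)) : X = 0 := by
  let e : Fin (Fintype.card I) ≃ I := (Fintype.equivFin I).symm
  have h0 := hc _ _ _ _ (hb.submatrix e) isIrreducible_one
  let Y : Matrix (I × (Fin (Fintype.card I) × Fin 1)) (Fin (Fintype.card I) × Fin 1) ℂ :=
    Matrix.of fun a b => X (a.1, e a.2.1) (e b.1)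
  have hY : Y ∈ Mor (Matrix.kronecker (D.Λ.submatrix e e) (1 : Matrix (Fin 1) (Fin 1) A))
      (Matrix.kronecker D.Λ (Matrix.kronecker (D.Λ.submatrix e e)
        (1 : Matrix (Fin 1) (Fin 1) A))) := by
    refine Matrix.ext fun a b => ?_
    obtain ⟨i, j, x⟩ := a
    obtain ⟨k, y⟩ := b
    have h1 := congrFun (congrFun hX (i, e j)) (e k)
    rw [scal_mul_apply, mul_scal_apply] at h1
    refine (scal_mul_apply _ _ _ _).trans (Eq.trans ?_ (mul_scal_apply _ _ _ _).symm)
    simp only [Matrix.kronecker, Fintype.sum_prod_type, Matrix.kroneckerMap_apply,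
      Matrix.submatrix_apply, Y, Matrix.of_apply, Fin.isValue, Finset.univ_unique,
      Finset.sum_singleton, Subsingleton.elim x 0, Subsingleton.elim y 0, Fin.default_eq_zero,
      Matrix.one_apply_eq, mul_one] at h1 ⊢
    rw [Equiv.sum_comp e fun l => X (i, e j) l • D.Λ l (e k), h1]
    refine Finset.sum_congr rfl fun l _ => ?_
    exact (Equiv.sum_comp e fun z => X (l, z) (e k) • (D.Λ i l * D.Λ (e j) z)).symm
  rw [h0] at hY
  ext ⟨i, j⟩ k
  have := congrFun (congrFun (Set.mem_singleton_iff.1 hY) (i, (e.symm j, 0))) (e.symm k, 0)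
  simpa [Y] using this

/-- The quadratic elements of an ideal satisfying the intrinsic condition are the `s_kl` for
suitable constants `T`. -/
lemma CondI.exists_s_mem (hR : D.R * D.R = 1)
    (ha : ∀ (n : ℕ) (v : Matrix (Fin n) (Fin n) A), IsRep v → IsCompletelyReducible v)
    (hb : IsIrreducible D.Λ)
    (hc : ∀ (m n : ℕ) (v : Matrix (Fin m) (Fin m) A) (w : Matrix (Fin n) (Fin n) A),
      IsIrreducible v → IsIrreducible w →
        Mor (Matrix.kronecker v w) (Matrix.kronecker D.Λ (Matrix.kronecker v w)) = {0})
    {J : Ideal D.Tilde} (hJ : D.CondI J) : ∃ T, ∀ x, D.s T x ∈ J := by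
  have := hJ.isTwoSided
  have h1 : ∀ x : I × I, ∃ (c : I → A) (d : A),
      D.s 0 x + (∑ l, D.ι (c l) * D.p l + D.ι d) ∈ J := by
    intro x
    have hx : (D.filt 1).mkQ (D.s 0 x) ∈ (D.J₂ J).map (D.filt 1).mkQ := by
      rw [hJ.eq_ker, ← map_span_ι_mul_s (T := 0) hR]
      refine Submodule.mem_map_of_mem (Submodule.subset_span ⟨1, x, ?_⟩)
      rw [map_one, one_mul]
    obtain ⟨y, hy, hyx⟩ := hx
    have hd : y - D.s 0 x ∈ D.filt 1 := (Submodule.Quotient.eq _).1 hyx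
    obtain ⟨c, d, hcd⟩ := exists_of_mem_filt_one hd
    refine ⟨c, d, ?_⟩
    rw [← hcd, add_sub_cancel]
    exact hy.1
  choose c d hcd using h1
  obtain ⟨hΔc, hΔc', hΔd⟩ := comul_lower_terms hR hJ.inf_filt_one hJ.isCoideal hcd
  -- The coefficients of the `p_l` are scalars, and form an intertwiner, hence vanish.
  have hc1 : ∀ x l, c x l = algebraMap ℂ A (Coalgebra.counit (R := ℂ) (c x l)) := fun x l =>
    eq_algebraMap_of_comul_eq (hΔc x l)
  have hX : Matrix.of (fun x l => Coalgebra.counit (R := ℂ) (c x l)) ∈ Mor D.Λ (D.Λ ⊗ₖ D.Λ) := by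
    refine Matrix.ext fun x r => ?_
    rw [scal_mul_apply, mul_scal_apply]
    have h := congrArg (fun z => TensorProduct.rid ℂ A (Coalgebra.counit.lTensor A z)) (hΔc' x r)
    simp only [hΔc, Algebra.TensorProduct.tmul_mul_tmul, mul_one, map_sum,
      LinearMap.lTensor_tmul, Bialgebra.counit_one, TensorProduct.rid_tmul, one_smul] at h
    refine Eq.trans (Finset.sum_congr rfl fun l _ => ?_) h
    conv_rhs => rw [hc1, ← Algebra.smul_def]
    rfl
  have hX0 := eq_zero_of_mem_Mor hb hc hX
  have hc0 : ∀ x l, c x l = 0 := by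
    intro x l
    have : Coalgebra.counit (R := ℂ) (c x l) = 0 := congrFun (congrFun hX0 x) l
    rw [hc1, this, map_zero]
  simp only [hc0, map_zero, zero_mul, Finset.sum_const_zero, zero_add] at hcd
  -- The constant terms form a cocycle, hence a coboundary.
  obtain ⟨u, hu⟩ := (D.isRep.kronecker D.isRep).exists_coboundary ha hΔd
  -- They are antisymmetric, since `(R + 1) s = 0`.
  have hRd : ∀ x, ∑ z, D.R x z • d z = -d x := by
    intro x
    have hs0 : ∑ z, (D.R + 1) x z • D.s 0 z = 0 := by
      have h := sum_smul_vecMul ((D.R + 1) x) (D.R - 1) fun z => D.quad 0 z.1 z.2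
      have h' : (D.R + 1) x ᵥ* (D.R - 1) = 0 := by
        have : (D.R + 1) * (D.R - 1) = 0 := by
          rw [add_mul, mul_sub, hR, one_mul, mul_one]; abel
        exact congrFun this x
      rw [h'] at h
      refine h.trans ?_
      simp
    have hmem : ∑ z, (D.R + 1) x z • (D.s 0 z + D.ι (d z)) ∈ J.restrictScalars ℂ :=
      sum_mem fun z _ => Submodule.smul_mem _ _ (hcd z)
    simp only [smul_add, Finset.sum_add_distrib, hs0, zero_add, ← map_smul D.ι, ← map_sum]
      at hmem
    have h0 : D.ι (∑ z, (D.R + 1) x z • d z) ∈ J.restrictScalars ℂ ⊓ D.filt 1 :=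
      ⟨hmem, D.ι_mem_filt _ 1⟩
    rw [hJ.inf_filt_one, Submodule.mem_bot, map_eq_zero_iff D.ι ι_injective] at h0
    simp only [Matrix.add_apply, add_smul, Finset.sum_add_distrib, Matrix.one_apply, ite_smul,
      one_smul, zero_smul, Finset.sum_ite_eq, Finset.mem_univ, if_true] at h0
    exact eq_neg_of_add_eq_zero_left h0
  refine ⟨(-(1 / 2 : ℂ)) • u, fun x => ?_⟩
  have hs : D.s ((-(1 / 2 : ℂ)) • u) x = D.s 0 x + D.ι (d x) := by
    have hq : ∀ z : I × I, D.quad ((-(1 / 2 : ℂ)) • u) z.1 z.2 =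
        D.quad 0 z.1 z.2 + D.ι ((-(1 / 2 : ℂ)) • d z) := by
      intro z
      have e1 : D.ΛΛT ((-(1 / 2 : ℂ)) • u) z.1 z.2 =
          (-(1 / 2 : ℂ)) • ∑ m, u m • (D.Λ ⊗ₖ D.Λ) z m := by
        simp only [ΛΛT, Pi.smul_apply, smul_eq_mul, mul_smul, Finset.smul_sum,
          Fintype.sum_prod_type, Matrix.kroneckerMap_apply]
      have e2 : D.ΛΛT 0 z.1 z.2 = 0 := by simp [ΛΛT]
      rw [quad_eq, quad_eq, e1, e2, hu]
      simp only [Pi.smul_apply, Pi.zero_apply, map_zero, add_zero, sub_zero, smul_sub, map_sub,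
        map_smul, map_one, Prod.mk.eta, Algebra.algebraMap_eq_smul_one, smul_assoc]
      abel
    have e1 : ∑ z, (D.R - 1) x z • D.quad ((-(1 / 2 : ℂ)) • u) z.1 z.2 =
        ∑ z, (D.R - 1) x z • D.quad 0 z.1 z.2 +
          D.ι ((-(1 / 2 : ℂ)) • ∑ z, (D.R - 1) x z • d z) := by
      simp only [hq, smul_add, Finset.sum_add_distrib, map_smul, map_sum, Finset.smul_sum]
      congr 1
      exact Finset.sum_congr rfl fun z _ => smul_comm _ _ _
    refine e1.trans ?_
    congr 2
    simp only [Matrix.sub_apply, sub_smul, Finset.sum_sub_distrib, hRd, Matrix.one_apply,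
      ite_smul, one_smul, zero_smul, Finset.sum_ite_eq, Finset.mem_univ, if_true]
    module
  rw [hs]
  exact hcd x

end InhomData
end InhomQG

namespace InhomQG

/-- The antipode, applied entrywise, gives the inverse of a representation. -/
lemma IsRep.exists_inverse {C : Type*} [Ring C] [HopfAlgebra ℂ C] {n : Type*} [Fintype n]
    [DecidableEq n] {v : Matrix n n C} (hv : IsRep v) :
    ∃ v' : Matrix n n C, v * v' = 1 ∧ v' * v = 1 := by
  refine ⟨v.map (HopfAlgebra.antipode ℂ), ?_, ?_⟩
  · ext i j
    have h := HopfAlgebra.mul_antipode_lTensor_comul_apply (R := ℂ) (v i j)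
    rw [hv.comul, hv.counit] at h
    simpa [Matrix.mul_apply, Matrix.one_apply, apply_ite] using h
  · ext i j
    have h := HopfAlgebra.mul_antipode_rTensor_comul_apply (R := ℂ) (v i j)
    rw [hv.comul, hv.counit] at h
    simpa [Matrix.mul_apply, Matrix.one_apply, apply_ite] using h

namespace InhomData

variable {A I : Type*} [Ring A] [Bialgebra ℂ A] [Fintype I] [DecidableEq I] {D : InhomData A I}
  {T : I × I → ℂ}

/-! ### Convolution with a coefficient functional as a derivation of the associated graded algebra -/

/-- A coideal is stable under convolution with the functionals that vanish on it. -/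
lemma convR_mem {J : Ideal D.Tilde} (hJ : (J.restrictScalars ℂ).IsCoideal)
    {θ : D.Tilde →ₗ[ℂ] ℂ} (hθ : ∀ x ∈ J, θ x = 0) {x : D.Tilde} (hx : x ∈ J) : convR θ x ∈ J := by
  have h := map_comul_eq_zero hJ (J.restrictScalars ℂ).mkQ θ
    (fun x hx => (Submodule.Quotient.mk_eq_zero _).2 hx) hθ hx
  have e : ∀ w : D.Tilde ⊗[ℂ] D.Tilde, (J.restrictScalars ℂ).mkQ
      (TensorProduct.rid ℂ D.Tilde (TensorProduct.map LinearMap.id θ w)) =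
      TensorProduct.rid ℂ _ (TensorProduct.map (J.restrictScalars ℂ).mkQ θ w) := by
    intro w
    induction w with
    | zero => simp
    | add u v hu hv => simp only [map_add, hu, hv]
    | tmul a b => simp
  have h1 : (J.restrictScalars ℂ).mkQ (convR θ x) = 0 := (e _).trans (by rw [h, map_zero])
  exact (Submodule.Quotient.mk_eq_zero (J.restrictScalars ℂ)).1 h1

variable (D) in
/-- The derivation of words with `p̃_i ↦ Λ_it`: the letters are replaced one at a time. -/
def wordDeriv (t : I) : List I → D.Tilde
  | [] => 0
  | i :: w => D.ι (D.Λ i t) * D.word w + D.p i * wordDeriv t w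

variable (D) in
/-- The elements of degree at most `n - 2`; it is zero for `n < 2`. -/
def lowFilt (n : ℕ) : Submodule ℂ D.Tilde :=
  Submodule.span ℂ {x | ∃ k, k + 2 ≤ n ∧ x ∈ D.filt k}

variable (D) in
/-- The tensors whose first leg has degree at most `n - 2`. -/
def lowTensor (n : ℕ) : Submodule ℂ (D.Tilde ⊗[ℂ] D.Tilde) :=
  Submodule.span ℂ {z | ∃ (k : ℕ) (x y : D.Tilde), k + 2 ≤ n ∧ x ∈ D.filt k ∧ z = x ⊗ₜ[ℂ] y}

lemma wordDeriv_mem_filt (t : I) (w : List I) : D.wordDeriv t w ∈ D.filt (w.length - 1) := by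
  induction w with
  | nil => exact zero_mem _
  | cons i w ih =>
    refine add_mem (D.ι_mul_word_mem_filt _ _ (by simp)) ?_
    cases w with
    | nil => simp [wordDeriv]
    | cons j w => exact D.p_mul_mem_filt i ih

lemma tmul_mem_lowTensor {k n : ℕ} {x y : D.Tilde} (hx : x ∈ D.filt k) (h : k + 2 ≤ n) :
    x ⊗ₜ[ℂ] y ∈ D.lowTensor n := Submodule.subset_span ⟨k, x, y, h, hx, rfl⟩

lemma tmul_mul_mem_lowTensor {m n l : ℕ} {x y : D.Tilde} (hx : x ∈ D.filt m) (h : m + n ≤ l)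
    {z : D.Tilde ⊗[ℂ] D.Tilde} (hz : z ∈ D.lowTensor n) : x ⊗ₜ[ℂ] y * z ∈ D.lowTensor l := by
  have : D.lowTensor n ≤ (D.lowTensor l).comap (LinearMap.mulLeft ℂ (x ⊗ₜ[ℂ] y)) := by
    refine Submodule.span_le.2 ?_
    rintro _ ⟨k, u, v, hk, hu, rfl⟩
    simp only [SetLike.mem_coe, Submodule.mem_comap, LinearMap.mulLeft_apply,
      Algebra.TensorProduct.tmul_mul_tmul]
    exact tmul_mem_lowTensor (D.mul_mem_filt hx hu le_rfl) (by omega)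
  exact this hz

/-- `Δ(w) = w ⊗ 1 + ∑_r ∂_r w ⊗ p̃_r` up to terms whose first leg has degree at most `|w| - 2`. -/
lemma comul_word_sub_mem (w : List I) : Coalgebra.comul (R := ℂ) (D.word w) -
    D.word w ⊗ₜ[ℂ] 1 - ∑ r, D.wordDeriv r w ⊗ₜ[ℂ] D.p r ∈ D.lowTensor w.length := by
  induction w with
  | nil => simp [wordDeriv, Algebra.TensorProduct.one_def]
  | cons i w ih =>
    set z := Coalgebra.comul (R := ℂ) (D.word w) -
      D.word w ⊗ₜ[ℂ] 1 - ∑ r, D.wordDeriv r w ⊗ₜ[ℂ] D.p r with hz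
    have hw : Coalgebra.comul (R := ℂ) (D.word w) =
      z + D.word w ⊗ₜ[ℂ] 1 + ∑ r, D.wordDeriv r w ⊗ₜ[ℂ] D.p r := by rw [hz]; abel
    have e : Coalgebra.comul (R := ℂ) (D.word (i :: w)) -
        D.word (i :: w) ⊗ₜ[ℂ] 1 - ∑ r, D.wordDeriv r (i :: w) ⊗ₜ[ℂ] D.p r =
        ∑ t, D.ι (D.Λ i t) ⊗ₜ[ℂ] D.p t * z + D.p i ⊗ₜ[ℂ] 1 * z +
          ∑ t, ∑ r, (D.ι (D.Λ i t) * D.wordDeriv r w) ⊗ₜ[ℂ] (D.p t * D.p r) := by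
      simp only [word_cons, Bialgebra.comul_mul, comul_p, hw, wordDeriv, add_mul, mul_add,
        Finset.sum_mul, Finset.mul_sum, Algebra.TensorProduct.tmul_mul_tmul, mul_one, one_mul,
        Finset.sum_add_distrib, TensorProduct.add_tmul]
      rw [Finset.sum_comm (f := fun t r => (D.ι (D.Λ i t) * D.wordDeriv r w) ⊗ₜ[ℂ]
        (D.p t * D.p r))]
      abel
    rw [e]
    refine add_mem (add_mem (sum_mem fun t _ => ?_) ?_) (sum_mem fun t _ => sum_mem fun r _ => ?_)
    · exact tmul_mul_mem_lowTensor (D.ι_mem_filt _ 0) (by simp) ih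
    · exact tmul_mul_mem_lowTensor (D.p_mem_filt i le_rfl) (by simp [add_comm]) ih
    · cases w with
      | nil => simp [wordDeriv]
      | cons j w =>
        exact tmul_mem_lowTensor (D.ι_mul_mem_filt _ (wordDeriv_mem_filt r _)) (by simp)

lemma lowFilt_le_filt (n : ℕ) : D.lowFilt n ≤ D.filt (n - 1) :=
  Submodule.span_le.2 fun _ ⟨_, hk, hx⟩ => D.filt_mono (by omega) hx

lemma lowFilt_mul_mem {n : ℕ} {x y : D.Tilde} (hx : x ∈ D.lowFilt n) (hy : y ∈ D.filt 1) :
    x * y ∈ D.filt (n - 1) := by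
  have : D.lowFilt n ≤ (D.filt (n - 1)).comap (LinearMap.mulRight ℂ y) :=
    Submodule.span_le.2 fun x ⟨k, hk, hx⟩ => D.mul_mem_filt hx hy (by omega)
  exact this hx

section functional

variable {θ : D.Tilde →ₗ[ℂ] ℂ} {t : I} (hι : ∀ a, θ (D.ι a) = 0)
  (hp : ∀ a s, θ (D.ι a * D.p s) = if s = t then Coalgebra.counit (R := ℂ) a else 0)
include hι hp

/-- Convolution with a functional that extracts the coefficient of `p̃_t`, followed by `ε`, is the
derivation `∂_t` in the leading order. -/
lemma convR_ι_mul_word_sub_mem (a : A) (w : List I) :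
    convR θ (D.ι a * D.word w) - D.ι a * D.wordDeriv t w ∈ D.lowFilt w.length := by
  set z := Coalgebra.comul (R := ℂ) (D.word w) -
    D.word w ⊗ₜ[ℂ] 1 - ∑ r, D.wordDeriv r w ⊗ₜ[ℂ] D.p r with hz
  have hw : Coalgebra.comul (R := ℂ) (D.word w) =
    z + D.word w ⊗ₜ[ℂ] 1 + ∑ r, D.wordDeriv r w ⊗ₜ[ℂ] D.p r := by rw [hz]; abel
  have hzm : z ∈ D.lowTensor w.length := comul_word_sub_mem w
  let Ψ : D.Tilde ⊗[ℂ] D.Tilde →ₗ[ℂ] D.Tilde :=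
    (TensorProduct.rid ℂ D.Tilde).toLinearMap ∘ₗ TensorProduct.map LinearMap.id θ
  let W : D.Tilde ⊗[ℂ] D.Tilde :=
    Algebra.TensorProduct.map D.ιAlg D.ιAlg (Coalgebra.comul (R := ℂ) a)
  have h1 : ∀ x, Ψ (W * x ⊗ₜ[ℂ] 1) = 0 := by
    intro x
    have : ∀ v : A ⊗[ℂ] A,
        Ψ (Algebra.TensorProduct.map D.ιAlg D.ιAlg v * x ⊗ₜ[ℂ] 1) = 0 := by
      intro v
      induction v with
      | zero => simp
      | add u v hu hv => simp only [map_add, add_mul, hu, hv, add_zero]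
      | tmul b c => simp [Ψ, ← ι_eq, hι]
    exact this _
  have h2 : ∀ x r, Ψ (W * x ⊗ₜ[ℂ] D.p r) = if r = t then D.ι a * x else 0 := by
    intro x r
    have : ∀ v : A ⊗[ℂ] A,
        Ψ (Algebra.TensorProduct.map D.ιAlg D.ιAlg v * x ⊗ₜ[ℂ] D.p r) =
          if r = t then D.ι (TensorProduct.rid ℂ A (Coalgebra.counit.lTensor A v)) * x else 0 := by
      intro v
      induction v with
      | zero => simp
      | add u v hu hv =>
        simp only [map_add, add_mul, hu, hv]
        split_ifs <;> simp
      | tmul b c => simp [Ψ, ← ι_eq, hp]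
    rw [this, Coalgebra.lTensor_counit_comul]
    simp
  have h3 : Ψ (W * z) ∈ D.lowFilt w.length := by
    have h4 : ∀ v : A ⊗[ℂ] A, ∀ y ∈ D.lowTensor w.length,
        Ψ (Algebra.TensorProduct.map D.ιAlg D.ιAlg v * y) ∈ D.lowFilt w.length := by
      intro v y hy
      induction v with
      | zero => simp
      | add u v hu hv =>
        rw [map_add, add_mul, map_add]
        exact add_mem hu hv
      | tmul b c =>
        rw [Algebra.TensorProduct.map_tmul]
        have h5 := tmul_mul_mem_lowTensor (y := D.ιAlg c) (D.ι_mem_filt b 0) (zero_add _).le hy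
        have h6 : D.lowTensor w.length ≤ (D.lowFilt w.length).comap Ψ := by
          refine Submodule.span_le.2 ?_
          rintro _ ⟨k, x, y, hk, hx, rfl⟩
          simp only [SetLike.mem_coe, Submodule.mem_comap, Ψ, LinearMap.comp_apply,
            TensorProduct.map_tmul, LinearMap.id_apply, LinearEquiv.coe_coe,
            TensorProduct.rid_tmul]
          exact Submodule.smul_mem _ _ (Submodule.subset_span ⟨k, hk, hx⟩)
        exact h6 h5
    exact h4 _ z hzm
  have e : convR θ (D.ι a * D.word w) = Ψ (W * z) + D.ι a * D.wordDeriv t w := by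
    change Ψ (Coalgebra.comul (R := ℂ) (D.ι a * D.word w)) = _
    rw [Bialgebra.comul_mul, comul_ι, hw, mul_add, mul_add, map_add, map_add, Finset.mul_sum,
      map_sum, h1, add_zero]
    change Ψ (W * z) + ∑ r, Ψ (W * D.wordDeriv r w ⊗ₜ[ℂ] D.p r) = _
    simp only [h2, Finset.sum_ite_eq', Finset.mem_univ, if_true]
  rw [e, add_sub_cancel_right]
  exact h3

lemma convR_mem_filt {k : ℕ} {x : D.Tilde} (hx : x ∈ D.filt (k + 1)) : convR θ x ∈ D.filt k := by
  have : D.filt (k + 1) ≤ (D.filt k).comap (convR θ) := by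
    refine D.filt_le fun a w hw => ?_
    rw [Submodule.mem_comap, ← sub_add_cancel (convR θ _) (D.ι a * D.wordDeriv t w)]
    exact D.filt_mono (by omega) (add_mem (lowFilt_le_filt _
      (convR_ι_mul_word_sub_mem hι hp a w)) (D.ι_mul_mem_filt a (wordDeriv_mem_filt t w)))
  exact this hx

end functional

/-! ### Left-invariant coordinates and the Euler formula -/

variable (D) in
/-- The sum of the ideal generated by the `s_kl` and of `B̃^n`. -/
def idealFilt (T : I × I → ℂ) (n : ℕ) : Submodule ℂ D.Tilde :=
  (D.idealS T).restrictScalars ℂ ⊔ D.filt n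

lemma filt_le_idealFilt (n : ℕ) : D.filt n ≤ D.idealFilt T n := le_sup_right

lemma mem_idealFilt_of_mem_idealS {x : D.Tilde} (hx : x ∈ D.idealS T) (n : ℕ) :
    x ∈ D.idealFilt T n := Submodule.mem_sup_left hx

lemma mul_mem_idealFilt_left {m n k : ℕ} {x y : D.Tilde} (hx : x ∈ D.filt m)
    (hy : y ∈ D.idealFilt T n) (h : m + n ≤ k) : x * y ∈ D.idealFilt T k := by
  obtain ⟨u, hu, v, hv, rfl⟩ := Submodule.mem_sup.1 hy
  rw [mul_add]
  exact add_mem (mem_idealFilt_of_mem_idealS (Ideal.mul_mem_left _ _ hu) k)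
    (filt_le_idealFilt k (D.mul_mem_filt hx hv h))

lemma mul_mem_idealFilt_right {m n k : ℕ} {x y : D.Tilde} (hx : x ∈ D.idealFilt T m)
    (hy : y ∈ D.filt n) (h : m + n ≤ k) : x * y ∈ D.idealFilt T k := by
  obtain ⟨u, hu, v, hv, rfl⟩ := Submodule.mem_sup.1 hx
  rw [add_mul]
  exact add_mem (mem_idealFilt_of_mem_idealS (Ideal.mul_mem_right _ _ hu) k)
    (filt_le_idealFilt k (D.mul_mem_filt hv hy h))

lemma p_mul_p_sub_mem (i r : I) :
    D.p i * D.p r - ∑ x : I × I, D.R (i, r) x • (D.p x.1 * D.p x.2) ∈ D.idealFilt T 1 := by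
  have h := D.p_mul_p_add_s T i r
  rw [← eq_sub_iff_add_eq] at h
  have e : D.p i * D.p r - ∑ x : I × I, D.R (i, r) x • (D.p x.1 * D.p x.2) =
      D.sTail T i r - D.s T (i, r) := by
    rw [h]; abel
  rw [e]
  exact sub_mem (filt_le_idealFilt 1 (D.sTail_mem T i r))
    (mem_idealFilt_of_mem_idealS (s_mem_idealS _) 1)

variable (D) in
/-- The left-invariant combinations `ζ_t = Λ'_tr p̃_r` of the `p̃_r`, for an inverse `Λ'` of `Λ`. -/
def zeta (Λ' : Matrix I I A) (t : I) : D.Tilde := ∑ r, D.ι (Λ' t r) * D.p r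

lemma zeta_mem_filt (Λ' : Matrix I I A) (t : I) : D.zeta Λ' t ∈ D.filt 1 :=
  sum_mem fun r _ => D.ι_mul_mem_filt _ (D.p_mem_filt r le_rfl)

section inverse

variable {Λ' : Matrix I I A} (h₁ : D.Λ * Λ' = 1)
include h₁

lemma sum_ι_Λ_mul_zeta (i : I) : ∑ t, D.ι (D.Λ i t) * D.zeta Λ' t = D.p i := by
  have h : ∀ r, ∑ t, D.ι (D.Λ i t) * (D.ι (Λ' t r) * D.p r) =
      if i = r then D.p r else 0 := by
    intro r
    have := congrFun (congrFun h₁ i) r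
    rw [Matrix.mul_apply, Matrix.one_apply] at this
    simp only [← mul_assoc, ← map_mul, ← Finset.sum_mul, ← map_sum, this]
    split_ifs <;> simp
  simp only [zeta, Finset.mul_sum]
  rw [Finset.sum_comm]
  simp [h]

variable (h₂ : Λ' * D.Λ = 1) (hR : D.R * D.R = 1)
include h₂ hR

/-- Modulo the `s_kl` and lower-order terms, the braiding turns into a commutation relation with
left-invariant elements. -/
lemma p_mul_zeta_sub_mem (i t : I) :
    D.p i * D.zeta Λ' t - D.zeta Λ' t * D.p i ∈ D.idealFilt T 1 := by
  set x : I → I → D.Tilde := fun i t => D.p i * D.zeta Λ' t - D.zeta Λ' t * D.p i with hx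
  set y : I × I → D.Tilde := fun z => ∑ t, D.ι (D.Λ z.1 t) * x z.2 t with hy
  have hRy : ∀ z, ∑ z', D.R z z' • y z' ∈ D.idealFilt T 1 := by
    rintro ⟨i, r⟩
    have e1 : D.p i * D.p r = ∑ z' : I × I, D.R (i, r) z' •
        ∑ t, D.ι (D.Λ z'.1 t) * (D.p z'.2 * D.zeta Λ' t) +
        ∑ t, D.ι (D.φ i (D.Λ r t)) * D.zeta Λ' t := by
      have e : ∀ t, D.p i * (D.ι (D.Λ r t) * D.zeta Λ' t) = ∑ z' : I × I, D.R (i, r) z' •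
          (D.ι (D.Λ z'.1 t) * (D.p z'.2 * D.zeta Λ' t)) +
          D.ι (D.φ i (D.Λ r t)) * D.zeta Λ' t := by
        intro t
        rw [← mul_assoc, p_mul_ι', add_mul, Finset.sum_mul, Fintype.sum_prod_type,
          Finset.sum_comm]
        congr 1
        refine Finset.sum_congr rfl fun j _ => ?_
        rw [convL_rep D.isRep, map_sum, Finset.sum_mul, Finset.sum_mul]
        refine Finset.sum_congr rfl fun m _ => ?_
        rw [map_smul, smul_mul_assoc, smul_mul_assoc, mul_assoc]
        rfl
      conv_lhs => rw [← sum_ι_Λ_mul_zeta h₁ r, Finset.mul_sum]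
      simp only [e, Finset.sum_add_distrib, Finset.smul_sum]
      rw [Finset.sum_comm]
    have e2 : ∀ z' : I × I, D.p z'.1 * D.p z'.2 =
        ∑ t, D.ι (D.Λ z'.1 t) * (D.zeta Λ' t * D.p z'.2) := by
      intro z'
      simp only [← mul_assoc, ← Finset.sum_mul]
      rw [sum_ι_Λ_mul_zeta h₁]
    have h3 := p_mul_p_sub_mem (T := T) (D := D) i r
    have e3 : ∑ z', D.R (i, r) z' • y z' =
        (D.p i * D.p r - ∑ z' : I × I, D.R (i, r) z' • (D.p z'.1 * D.p z'.2)) -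
          ∑ t, D.ι (D.φ i (D.Λ r t)) * D.zeta Λ' t := by
      rw [e1]
      simp only [e2, hy, hx, mul_sub, Finset.sum_sub_distrib, smul_sub]
      abel
    rw [e3]
    exact sub_mem h3 (filt_le_idealFilt 1 (sum_mem fun t _ =>
      D.ι_mul_mem_filt _ (zeta_mem_filt Λ' t)))
  have hy1 : ∀ z, y z ∈ D.idealFilt T 1 := by
    intro z
    have h := sum_smul_vecMul (D.R z) D.R y
    have h' : D.R z ᵥ* D.R = (1 : Matrix (I × I) (I × I) ℂ) z := congrFun hR z
    rw [h'] at h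
    simp only [Matrix.one_apply, ite_smul, one_smul, zero_smul, Finset.sum_ite_eq,
      Finset.mem_univ, if_true] at h
    rw [← h]
    exact sum_mem fun z' _ => Submodule.smul_mem _ _ (hRy z')
  have e : x i t = ∑ m, D.ι (Λ' t m) * y (m, i) := by
    have h : ∀ r, ∑ m, D.ι (Λ' t m) * (D.ι (D.Λ m r) * x i r) = if t = r then x i r else 0 := by
      intro r
      have := congrFun (congrFun h₂ t) r
      rw [Matrix.mul_apply, Matrix.one_apply] at this
      simp only [← mul_assoc, ← map_mul, ← Finset.sum_mul, ← map_sum, this]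
      split_ifs <;> simp
    simp only [hy, Finset.mul_sum]
    rw [Finset.sum_comm]
    simp [h]
  change x i t ∈ _
  rw [e]
  exact sum_mem fun m _ => mul_mem_idealFilt_left (D.ι_mem_filt _ 0) (hy1 _) le_rfl

lemma word_mul_zeta_sub_mem (t : I) (w : List I) :
    D.word w * D.zeta Λ' t - D.zeta Λ' t * D.word w ∈ D.idealFilt T w.length := by
  induction w with
  | nil => simp
  | cons i w ih =>
    have e : D.word (i :: w) * D.zeta Λ' t - D.zeta Λ' t * D.word (i :: w) =
        D.p i * (D.word w * D.zeta Λ' t - D.zeta Λ' t * D.word w) +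
          (D.p i * D.zeta Λ' t - D.zeta Λ' t * D.p i) * D.word w := by
      rw [word_cons]; noncomm_ring
    rw [e]
    exact add_mem (mul_mem_idealFilt_left (D.p_mem_filt i le_rfl) ih (by simp [add_comm]))
      (mul_mem_idealFilt_right (p_mul_zeta_sub_mem h₁ h₂ hR i t) (D.word_mem_filt w le_rfl)
        (by simp [add_comm]))

/-- The Euler formula: `∑ t, (∂_t w) ζ_t = |w| w` up to lower-order terms and the `s_kl`. -/
lemma sum_wordDeriv_mul_zeta_sub_mem (w : List I) :
    ∑ t, D.wordDeriv t w * D.zeta Λ' t - (w.length : ℂ) • D.word w ∈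
      D.idealFilt T (w.length - 1) := by
  induction w with
  | nil => simp [wordDeriv]
  | cons i w ih =>
    have e : ∑ t, D.wordDeriv t (i :: w) * D.zeta Λ' t - ((i :: w).length : ℂ) • D.word (i :: w) =
        ∑ t, D.ι (D.Λ i t) * (D.word w * D.zeta Λ' t - D.zeta Λ' t * D.word w) +
          D.p i * (∑ t, D.wordDeriv t w * D.zeta Λ' t - (w.length : ℂ) • D.word w) := by
      have e1 : ∑ t, D.ι (D.Λ i t) * (D.zeta Λ' t * D.word w) = D.p i * D.word w := by
        simp only [← mul_assoc, ← Finset.sum_mul]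
        rw [sum_ι_Λ_mul_zeta h₁]
      simp only [wordDeriv, add_mul, mul_sub, Finset.sum_add_distrib, Finset.sum_sub_distrib,
        e1, word_cons, Finset.mul_sum, mul_assoc, List.length_cons, Nat.cast_add, Nat.cast_one,
        add_smul, one_smul, mul_smul_comm]
      abel
    rw [e]
    refine add_mem (sum_mem fun t _ => mul_mem_idealFilt_left (D.ι_mem_filt _ 0)
      (word_mul_zeta_sub_mem h₁ h₂ hR t w) (by simp)) ?_
    cases w with
    | nil => simp [wordDeriv]
    | cons j w =>
      exact mul_mem_idealFilt_left (D.p_mem_filt i le_rfl) ih (by simp [add_comm])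

/-- An ideal satisfying the intrinsic condition is generated by its quadratic elements. -/
theorem CondI.eq_idealS {J : Ideal D.Tilde} (hJ : D.CondI J) (hs : ∀ x, D.s T x ∈ J) :
    J = D.idealS T := by
  have := hJ.isTwoSided
  have hle : D.idealS T ≤ J := idealS_le hs
  refine le_antisymm ?_ hle
  -- As `J` meets `B̃¹` trivially, the functionals can be chosen to vanish on `J`.
  obtain ⟨μ, -, hμJ, -, hμι, hμp, -⟩ := exists_coeff hJ.inf_filt_one
  let θ : I → D.Tilde →ₗ[ℂ] ℂ := fun t => Coalgebra.counit ∘ₗ μ t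
  have hθJ : ∀ t, ∀ x ∈ J, θ t x = 0 := fun t x hx => by simp [θ, hμJ t x hx]
  have hθι : ∀ t a, θ t (D.ι a) = 0 := fun t a => by simp [θ, hμι]
  have hθp : ∀ t a s, θ t (D.ι a * D.p s) = if s = t then Coalgebra.counit (R := ℂ) a else 0 := by
    intro t a s
    simp only [θ, LinearMap.comp_apply, hμp]
    split_ifs <;> simp
  have euler : ∀ k, ∀ x ∈ D.filt (k + 1),
      ∑ t, convR (θ t) x * D.zeta Λ' t - ((k + 1 : ℕ) : ℂ) • x ∈ D.idealFilt T k := by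
    intro k x hx
    refine D.filt_induction (P := fun x => ∑ t, convR (θ t) x * D.zeta Λ' t -
      ((k + 1 : ℕ) : ℂ) • x ∈ D.idealFilt T k) (by simp) ?_ ?_ hx
    · intro x y hx hy
      have e : ∑ t, convR (θ t) (x + y) * D.zeta Λ' t - ((k + 1 : ℕ) : ℂ) • (x + y) =
          (∑ t, convR (θ t) x * D.zeta Λ' t - ((k + 1 : ℕ) : ℂ) • x) +
            (∑ t, convR (θ t) y * D.zeta Λ' t - ((k + 1 : ℕ) : ℂ) • y) := by
        simp only [map_add, add_mul, Finset.sum_add_distrib, smul_add]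
        abel
      rw [e]
      exact add_mem hx hy
    · intro a w hw
      have e : ∑ t, convR (θ t) (D.ι a * D.word w) * D.zeta Λ' t -
            ((k + 1 : ℕ) : ℂ) • (D.ι a * D.word w) =
          ∑ t, (convR (θ t) (D.ι a * D.word w) - D.ι a * D.wordDeriv t w) * D.zeta Λ' t +
          D.ι a * (∑ t, D.wordDeriv t w * D.zeta Λ' t - (w.length : ℂ) • D.word w) +
          ((w.length : ℂ) - ((k + 1 : ℕ) : ℂ)) • (D.ι a * D.word w) := by
        simp only [sub_mul, Finset.sum_sub_distrib, mul_sub, Finset.mul_sum, mul_assoc, sub_smul,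
          mul_smul_comm]
        abel
      rw [e]
      refine add_mem (add_mem (sum_mem fun t _ => filt_le_idealFilt k (D.filt_mono (by omega)
        (lowFilt_mul_mem (convR_ι_mul_word_sub_mem (hθι t) (hθp t) a w)
          (zeta_mem_filt Λ' t))))
        (mul_mem_idealFilt_left (D.ι_mem_filt a 0)
          (sum_wordDeriv_mul_zeta_sub_mem h₁ h₂ hR w) (by omega))) ?_
      rcases hw.lt_or_eq with h | h
      · exact Submodule.smul_mem _ _ (filt_le_idealFilt k
          (D.ι_mul_word_mem_filt a w (by omega)))
      · rw [h, sub_self, zero_smul]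
        exact zero_mem _
  have main : ∀ k, ∀ x ∈ J, x ∈ D.filt (k + 1) → x ∈ D.idealS T := by
    intro k
    induction k with
    | zero =>
      intro x hx hx'
      have h : x ∈ J.restrictScalars ℂ ⊓ D.filt 1 := ⟨hx, hx'⟩
      rw [hJ.inf_filt_one, Submodule.mem_bot] at h
      rw [h]
      exact zero_mem _
    | succ k ih =>
      intro x hx hx'
      -- The convolutions of `x` with the functionals lie in `J` and have lower degree. By the Euler
      -- formula `x` is then a multiple of an element of the ideal generated by the `s_kl`, up to terms
      -- of lower degree, which again lie in `J`.
      have h1 : ∑ t, convR (θ t) x * D.zeta Λ' t ∈ D.idealS T :=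
        sum_mem fun t _ => Ideal.mul_mem_right _ _ (ih _ (convR_mem hJ.isCoideal (hθJ t) hx)
          (convR_mem_filt (hθι t) (hθp t) hx'))
      obtain ⟨u, hu, v, hv, huv⟩ := Submodule.mem_sup.1 (euler (k + 1) x hx')
      have hu' : u ∈ D.idealS T := hu
      have hv' : v ∈ J := by
        have e : v = ∑ t, convR (θ t) x * D.zeta Λ' t - ((k + 1 + 1 : ℕ) : ℂ) • x - u := by
          rw [← huv]; abel
        rw [e]
        exact sub_mem (sub_mem (hle h1) ((J.restrictScalars ℂ).smul_mem _ hx)) (hle hu')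
      have e : x = (((k + 1 + 1 : ℕ) : ℂ)⁻¹) •
          (∑ t, convR (θ t) x * D.zeta Λ' t - (u + v)) := by
        rw [huv, sub_sub_cancel, smul_smul, inv_mul_cancel₀ (Nat.cast_ne_zero.2 (by omega)),
          one_smul]
      rw [e]
      exact ((D.idealS T).restrictScalars ℂ).smul_mem _
        (sub_mem h1 (add_mem hu' (ih v hv' hv)))
  intro x hx
  obtain ⟨k, hk⟩ := D.exists_mem_filt x
  exact main k x hx (D.filt_mono (Nat.le_succ k) hk)

end inverse

end InhomData
end InhomQG

end

theorem theorem3p1 {A I : Type*} [Ring A] [HopfAlgebra ℂ A] [Fintype I] [DecidableEq I]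
    (hS : Function.Bijective (HopfAlgebra.antipode ℂ (A := A)))
    (D : InhomQG.InhomData A I)
    (ha : ∀ (n : ℕ) (v : Matrix (Fin n) (Fin n) A),
      InhomQG.IsRep v → InhomQG.IsCompletelyReducible v)
    (hb : InhomQG.IsIrreducible D.Λ)
    (hc : ∀ (m n : ℕ) (v : Matrix (Fin m) (Fin m) A) (w : Matrix (Fin n) (Fin n) A),
      InhomQG.IsIrreducible v → InhomQG.IsIrreducible w →
        InhomQG.Mor (Matrix.kronecker v w) (Matrix.kronecker D.Λ (Matrix.kronecker v w)) = {0})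
    (hρ : D.braiding ∘ₗ D.braiding = LinearMap.id)
    (J : Ideal D.Tilde) :
    (D.CondI J ↔ D.CondII J) ∧
    (D.CondI J ∨ D.CondII J →
      (∀ T : I × I → ℂ, D.CondT T → J = D.idealS T →
        D.J₂ J = Submodule.span ℂ {x | ∃ (a : A) (kl : I × I), x = D.ι a * D.s T kl}) ∧
      D.QuotientIsInhomogeneous J) := by
  have hR := D.R_mul_self hρ
  have hiff : D.CondI J ↔ D.CondII J := by
    constructor
    · intro hJ
      have := hJ.isTwoSided
      obtain ⟨Λ', h₁, h₂⟩ := D.isRep.exists_inverse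
      obtain ⟨T, hT⟩ := hJ.exists_s_mem hR ha hb hc
      exact ⟨T, InhomQG.InhomData.condT_of_s_mem hR hJ.inf_filt_one hT,
        hJ.eq_idealS h₁ h₂ hR hT⟩
    · rintro ⟨T, hT, rfl⟩
      exact hT.condI hR
  refine ⟨hiff, fun h => ⟨?_, ?_⟩⟩
  · rintro T hT rfl
    exact hT.J₂_idealS hR
  · have : Nonempty I := hb.2.1
    have hJ : D.CondI J := h.elim id hiff.2
    exact hJ.quotientIsInhomogeneous
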